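/- Let $k$ be an algebraically closed field of characteristic $0$ and let $\mathcal{A}^{\#}=k\langle x_1,x_2,x_3\rangle/(x_1x_2+x_2x_1,\;x_2x_3+x_3x_2,\;x_3x_1+x_1x_3)$, graded by $|x_1|=|x_2|=|x_3|=1$. For $M=(m_{ij})\in M_3(k)$ let $\mathcal{A}$ be the cochain DG algebra with underlying graded algebra $\mathcal{A}^{\#}$ whose differential is the graded derivation of degree $1$ with $\partial(x_i)=\sum_j m_{ij}x_j^2$, let $H(\mathcal{A})$ be its cohomology graded algebra, write $\lceil z\rceil$ for the class of a cocycle $z$, and let $r(M)$ be the rank of $M$. A connected graded algebra $A$ is called AS-Gorenstein if $\dim_k\mathrm{Ext}^*_A(k,A)=1$, $\dim_k\mathrm{Ext}^*_{A^{op}}(k,A)=1$ and $A$ has finite injective dimension as a left and as a right module over itself; it is called AS-regular if, moreover, its (left and right) global dimension is finite. (1) If $r(M)\neq 1$, then $H(\mathcal{A})$ is connected graded and AS-Gorenstein. (2) If $r(M)=0$, then $x_i\mapsto\lceil x_i\rceil$ defines an isomorphism of graded algebras $\mathcal{A}^{\#}\cong H(\mathcal{A})$, and $H(\mathcal{A})$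 is AS-regular, of left and right global dimension $3$. (3) If $r(M)=3$, then $H(\mathcal{A})=k$. (4) Let $r(M)=2$, and let $s,t\in k^3$ be non-zero vectors with $Ms=0$ and $M^{T}t=0$. If $\sum_i s_it_i^2\neq 0$, then $H(\mathcal{A})\cong k[z]$ with $z=\lceil t_1x_1+t_2x_2+t_3x_3\rceil$ of degree $1$. If $\sum_i s_it_i^2=0$, then $H(\mathcal{A})\cong \bigl(k[z]/(z^2)\bigr)[w]$ with $z=\lceil t_1x_1+t_2x_2+t_3x_3\rceil$ of degree $1$ and $w=\lceil c_1x_1^2+c_2x_2^2+c_3x_3^2\rceil$ of degree $2$, for any $c\in k^3$ with $\sum_i c_is_i\neq 0$. -/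

import Mathlib

open CategoryTheory DirectSum

universe u

/-! ### Cochain DG algebras and their cohomology algebras -/

section DG

variable {k A : Type u} [Field k] [Ring A] [Algebra k A]

/-- The structure of a cochain DG algebra on a graded `k`-algebra `A = ⨁ i, 𝒜 i`: a `k`-linear
differential of degree `1` which is a graded derivation of square zero. -/
structure CochainDifferential (𝒜 : ℕ → Submodule k A) where
  /-- the differential -/
  d : A →ₗ[k] A
  d_mem : ∀ (i : ℕ) (a : A), a ∈ 𝒜 i → d a ∈ 𝒜 (i + 1)
  d_d : ∀ a : A, d (d a) = 0
  leibniz : ∀ (i : ℕ) (a b : A), a ∈ 𝒜 i → d (a * b) = d a * b + (-1 : k) ^ i • (a * d b)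

namespace CochainDifferential

variable {𝒜 : ℕ → Submodule k A} [GradedAlgebra 𝒜] (δ : CochainDifferential 𝒜)

theorem d_one : δ.d 1 = 0 := by
  have h := δ.leibniz 0 1 1 SetLike.GradedOne.one_mem
  simpa using h

/-- The homogeneous components of `d a` are the images of the components of `a`. -/
theorem d_proj (a : A) (i : ℕ) :
    (decompose 𝒜 (δ.d a) (i + 1) : A) = δ.d (decompose 𝒜 a i : A) := by
  classical
  induction a using DirectSum.Decomposition.inductionOn 𝒜 with
  | zero => simp
  | @homogeneous j m =>
    by_cases hij : j = i
    · subst hij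
      rw [DirectSum.decompose_of_mem_same _ (δ.d_mem j m m.2),
        DirectSum.decompose_of_mem_same _ m.2]
    · rw [DirectSum.decompose_of_mem_ne _ (δ.d_mem j m m.2) (by omega),
        DirectSum.decompose_of_mem_ne _ m.2 hij, map_zero]
  | add m m' hm hm' => simp [hm, hm']

theorem d_proj_zero (a : A) : (decompose 𝒜 (δ.d a) 0 : A) = 0 := by
  classical
  induction a using DirectSum.Decomposition.inductionOn 𝒜 with
  | zero => simp
  | @homogeneous j m =>
    rw [DirectSum.decompose_of_mem_ne _ (δ.d_mem j m m.2) (by omega)]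
  | add m m' hm hm' => simp [hm, hm']

theorem d_proj_of_d_eq_zero {a : A} (ha : δ.d a = 0) (i : ℕ) :
    δ.d (decompose 𝒜 a i : A) = 0 := by
  rw [← d_proj, ha]; simp

theorem d_mul_of_d_eq_zero {a b : A} (ha : δ.d a = 0) (hb : δ.d b = 0) : δ.d (a * b) = 0 := by
  classical
  rw [← DirectSum.sum_support_decompose 𝒜 a, Finset.sum_mul, map_sum]
  refine Finset.sum_eq_zero fun i _ => ?_
  rw [δ.leibniz i _ b (SetLike.coe_mem _), d_proj_of_d_eq_zero δ ha, hb]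
  simp

/-- The subalgebra of cocycles `ker d`. -/
def cocycles : Subalgebra k A where
  carrier := {a | δ.d a = 0}
  mul_mem' ha hb := δ.d_mul_of_d_eq_zero ha hb
  add_mem' {a b} ha hb := by
    simp only [Set.mem_ofPred_eq] at ha hb ⊢
    rw [map_add, ha, hb, add_zero]
  algebraMap_mem' r := by
    simp only [Set.mem_ofPred_eq]
    rw [Algebra.algebraMap_eq_smul_one, map_smul, d_one, smul_zero]

theorem mem_cocycles {a : A} : a ∈ δ.cocycles ↔ δ.d a = 0 := Iff.rfl

/-- The two-sided ideal of coboundaries `im d` in the algebra of cocycles. -/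
def coboundaries : Ideal δ.cocycles where
  carrier := {z | ∃ a : A, δ.d a = z}
  zero_mem' := ⟨0, by simp⟩
  add_mem' := by
    rintro y z ⟨a, ha⟩ ⟨b, hb⟩
    exact ⟨a + b, by simp [ha, hb]⟩
  smul_mem' := by
    rintro z y ⟨a, ha⟩
    classical
    refine ⟨∑ i ∈ (decompose 𝒜 (z : A)).support,
      (-1 : k) ^ i • ((decompose 𝒜 (z : A) i : A) * a), ?_⟩
    rw [map_sum, smul_eq_mul, Subalgebra.coe_mul, ← ha]
    conv_rhs => rw [← DirectSum.sum_support_decompose 𝒜 (z : A), Finset.sum_mul]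
    refine Finset.sum_congr rfl fun i _ => ?_
    rw [map_smul, δ.leibniz i _ a (SetLike.coe_mem _), d_proj_of_d_eq_zero δ z.2, zero_mul,
      zero_add, smul_smul, ← mul_pow]
    simp

theorem mem_coboundaries {z : δ.cocycles} : z ∈ δ.coboundaries ↔ ∃ a : A, δ.d a = z := Iff.rfl

instance : δ.coboundaries.IsTwoSided where
  mul_mem_of_left := by
    rintro y z ⟨a, ha⟩
    classical
    refine ⟨a * z, ?_⟩
    rw [Subalgebra.coe_mul, ← ha]
    conv_lhs => rw [← DirectSum.sum_support_decompose 𝒜 a]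
    conv_rhs => rw [← DirectSum.sum_support_decompose 𝒜 a]
    rw [Finset.sum_mul, map_sum, map_sum, Finset.sum_mul]
    refine Finset.sum_congr rfl fun i _ => ?_
    rw [δ.leibniz i _ _ (SetLike.coe_mem _), δ.mem_cocycles.1 z.2]
    simp

/-- The cohomology algebra `H(A) = ker d / im d`. -/
def Cohomology : Type u := δ.cocycles ⧸ δ.coboundaries

instance : Ring δ.Cohomology := Ideal.Quotient.ring δ.coboundaries

instance : Algebra k δ.Cohomology := Ideal.Quotient.algebra k (I := δ.coboundaries)

/-- The cohomology class `⌈z⌉` of a cocycle `z`, as an algebra homomorphism. -/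
def toCohomology : δ.cocycles →ₐ[k] δ.Cohomology := Ideal.Quotient.mkₐ k δ.coboundaries

/-- `h` is the cohomology class of the element `a` of `A`; in particular `a` is a cocycle. -/
def IsClassOf (h : δ.Cohomology) (a : A) : Prop :=
  ∃ z : δ.cocycles, (z : A) = a ∧ δ.toCohomology z = h

/-- The `i`-th cohomology `Hⁱ(A)`: the classes of the cocycles of degree `i`. -/
def cohomologyGrading (i : ℕ) : Submodule k δ.Cohomology :=
  ((𝒜 i).comap δ.cocycles.val.toLinearMap).map δ.toCohomology.toLinearMap

theorem mem_cohomologyGrading {i : ℕ} {h : δ.Cohomology} :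
    h ∈ δ.cohomologyGrading i ↔ ∃ z : δ.cocycles, (z : A) ∈ 𝒜 i ∧ δ.toCohomology z = h :=
  Iff.rfl

/-- The component of degree `i` of a cocycle, as a cocycle. -/
def cocycleProj (i : ℕ) : δ.cocycles →ₗ[k] δ.cocycles where
  toFun z := ⟨(decompose 𝒜 (z : A) i : A), δ.d_proj_of_d_eq_zero z.2 i⟩
  map_add' y z := by ext; simp
  map_smul' c z := by ext; simp [DirectSum.smul_apply]

theorem toCohomology_surjective : Function.Surjective δ.toCohomology :=
  Ideal.Quotient.mk_surjective

theorem toCohomology_eq_zero {z : δ.cocycles} : δ.toCohomology z = 0 ↔ ∃ a : A, δ.d a = z :=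
  Ideal.Quotient.eq_zero_iff_mem

theorem toCohomology_cocycleProj_eq {y z : δ.cocycles}
    (h : δ.toCohomology y = δ.toCohomology z) (i : ℕ) :
    δ.toCohomology (δ.cocycleProj i y) = δ.toCohomology (δ.cocycleProj i z) := by
  rw [← sub_eq_zero, ← map_sub, toCohomology_eq_zero] at h
  rw [← sub_eq_zero, ← map_sub, ← map_sub, toCohomology_eq_zero]
  obtain ⟨a, ha⟩ := h
  cases i with
  | zero => exact ⟨0, by rw [map_zero, ← δ.d_proj_zero a, ha]; rfl⟩
  | succ i => exact ⟨decompose 𝒜 a i, by rw [← δ.d_proj, ha]; rfl⟩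

/-- The projection of `H(A)` onto `Hⁱ(A)`. -/
noncomputable def classProj (i : ℕ) (h : δ.Cohomology) : δ.cohomologyGrading i :=
  ⟨δ.toCohomology (δ.cocycleProj i (Function.surjInv δ.toCohomology_surjective h)), _,
    SetLike.coe_mem (decompose 𝒜 _ i), rfl⟩

theorem classProj_toCohomology (i : ℕ) (z : δ.cocycles) :
    (δ.classProj i (δ.toCohomology z) : δ.Cohomology) = δ.toCohomology (δ.cocycleProj i z) :=
  δ.toCohomology_cocycleProj_eq (Function.surjInv_eq δ.toCohomology_surjective _) i

theorem classProj_add (i : ℕ) (g h : δ.Cohomology) :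
    δ.classProj i (g + h) = δ.classProj i g + δ.classProj i h := by
  obtain ⟨y, rfl⟩ := δ.toCohomology_surjective g
  obtain ⟨z, rfl⟩ := δ.toCohomology_surjective h
  ext
  rw [← map_add, Submodule.coe_add, classProj_toCohomology, classProj_toCohomology,
    classProj_toCohomology, map_add, map_add]

theorem classProj_of_mem {i j : ℕ} (h : δ.cohomologyGrading j) :
    δ.classProj i (h : δ.Cohomology) = if e : j = i then e ▸ h else 0 := by
  obtain ⟨h, z, hz, rfl⟩ := h
  have hz' : (z : A) ∈ 𝒜 j := hz
  split_ifs with e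
  · subst e
    ext
    refine (δ.classProj_toCohomology j z).trans (congrArg _ ?_)
    ext
    exact DirectSum.decompose_of_mem_same _ hz'
  · ext
    refine (δ.classProj_toCohomology i z).trans ?_
    have : δ.cocycleProj i z = 0 := by
      ext
      exact DirectSum.decompose_of_mem_ne _ hz' e
    rw [this, map_zero]; rfl

theorem cohomology_isInternal : DirectSum.IsInternal δ.cohomologyGrading := by
  classical
  constructor
  · intro x y hxy
    have key : ∀ (i : ℕ) (y : ⨁ i, δ.cohomologyGrading i),
        δ.classProj i (DirectSum.coeAddMonoidHom δ.cohomologyGrading y) = y i := by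
      intro i y
      induction y using DirectSum.induction_on with
      | zero =>
        ext
        rw [map_zero, ← map_zero δ.toCohomology, classProj_toCohomology]
        simp
      | of j y =>
        rw [DirectSum.coeAddMonoidHom_of, classProj_of_mem]
        split_ifs with e
        · subst e; simp
        · rw [DirectSum.of_eq_of_ne]; exact fun h => e h.symm
      | add y z hy hz => simp only [map_add, classProj_add, hy, hz, DirectSum.add_apply]
    exact DFinsupp.ext fun i => by rw [← key i x, ← key i y, hxy]
  · intro h
    obtain ⟨z, rfl⟩ := Ideal.Quotient.mk_surjective h
    refine ⟨∑ i ∈ (decompose 𝒜 (z : A)).support,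
      DirectSum.of (fun i => δ.cohomologyGrading i) i (δ.classProj i (δ.toCohomology z)), ?_⟩
    simp only [map_sum, DirectSum.coeAddMonoidHom_of, classProj_toCohomology]
    rw [← map_sum]
    refine congrArg δ.toCohomology ?_
    ext
    rw [AddSubmonoidClass.coe_finsetSum]
    exact DirectSum.sum_support_decompose 𝒜 (z : A)

instance : SetLike.GradedMonoid δ.cohomologyGrading where
  one_mem := ⟨1, SetLike.GradedOne.one_mem (A := 𝒜), map_one δ.toCohomology⟩
  mul_mem := by
    rintro i j _ _ ⟨y, hy, rfl⟩ ⟨z, hz, rfl⟩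
    exact ⟨y * z, SetLike.GradedMul.mul_mem (A := 𝒜) hy hz, map_mul δ.toCohomology y z⟩

/-- `H(A) = ⨁ i, Hⁱ(A)` is a graded algebra. -/
noncomputable instance : GradedAlgebra δ.cohomologyGrading where
  toDecomposition := δ.cohomology_isInternal.chooseDecomposition

end CochainDifferential

end DG

/-! ### AS-Gorenstein and AS-regular graded algebras -/

section AS

variable (k : Type u) {A : Type u} [Field k] [Ring A] [Algebra k A]

/-- The left global dimension of a ring: the supremum of the projective dimensions of its left
modules. -/
noncomputable def leftGlobalDimension (R : Type u) [Ring R] : WithBot ℕ∞ :=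
  ⨆ X : ModuleCat.{u} R, projectiveDimension X

/-- The right global dimension of a ring: the left global dimension of the opposite ring. -/
noncomputable def rightGlobalDimension (R : Type u) [Ring R] : WithBot ℕ∞ :=
  leftGlobalDimension Rᵐᵒᵖ

/-- The total `Ext`-space `Ext*(X, Y) = ⨁ n, Extⁿ(X, Y)` of two left modules over a `k`-algebra.
For a Noetherian connected graded algebra and finitely generated graded modules this is the space
underlying the (bigraded) graded `Ext`; likewise finiteness of the injective dimension of `A` and of
the global dimension mean the same for modules and for graded modules. -/
abbrev TotalExt (X Y : ModuleCat.{u} A) : Type u :=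
  ⨁ n : ℕ, Abelian.Ext X Y n

variable (𝒜 : ℕ → Submodule k A) [GradedAlgebra 𝒜]

/-- A graded algebra `A = ⨁ i, 𝒜 i` (without components of negative degree) is connected if its
component of degree `0` is `k`. -/
def IsConnectedGraded : Prop :=
  Function.Bijective (algebraMap k (𝒜 0))

/-- The left `A`-module `A / A_{>0} = A₀`, on which `A` acts through the projection `A → A₀`.
For a connected graded algebra this is the trivial left module `k`. -/
noncomputable def leftTrivialModule : ModuleCat.{u} A :=
  (ModuleCat.restrictScalars (GradedRing.projZeroRingHom' 𝒜)).obj (ModuleCat.of (𝒜 0) (𝒜 0))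

/-- The right `A`-module `A / A_{>0} = A₀`, on which `A` acts through the projection `A → A₀`.
For a connected graded algebra this is the trivial right module `k`. Right modules are modules over
the opposite ring. -/
noncomputable def rightTrivialModule : ModuleCat.{u} Aᵐᵒᵖ :=
  (ModuleCat.restrictScalars (GradedRing.projZeroRingHom' 𝒜).op).obj
    (ModuleCat.of (𝒜 0)ᵐᵒᵖ (𝒜 0)ᵐᵒᵖ)

/-- A connected graded algebra is left Gorenstein if `dim_k Ext*_A(k, A) = 1`. -/
structure IsLeftGorenstein : Prop where
  connected : IsConnectedGraded k 𝒜
  rank_ext : Module.rank k (TotalExt (leftTrivialModule k 𝒜) (ModuleCat.of A A)) = 1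

/-- A connected graded algebra is right Gorenstein if `dim_k Ext*_{Aᵒᵖ}(k, A) = 1`. -/
structure IsRightGorenstein : Prop where
  connected : IsConnectedGraded k 𝒜
  rank_ext : Module.rank k (TotalExt (rightTrivialModule k 𝒜) (ModuleCat.of Aᵐᵒᵖ Aᵐᵒᵖ)) = 1

/-- A left Gorenstein graded algebra is left AS-Gorenstein if the left module `A` has finite
injective dimension. -/
structure IsLeftASGorenstein : Prop extends IsLeftGorenstein k 𝒜 where
  injectiveDimension_lt : injectiveDimension (ModuleCat.of A A) < ⊤

/-- A right Gorenstein graded algebra is right AS-Gorenstein if the right module `A` has finite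
injective dimension. -/
structure IsRightASGorenstein : Prop extends IsRightGorenstein k 𝒜 where
  injectiveDimension_lt : injectiveDimension (ModuleCat.of Aᵐᵒᵖ Aᵐᵒᵖ) < ⊤

/-- AS-Gorenstein: left and right AS-Gorenstein. -/
structure IsASGorenstein : Prop where
  left : IsLeftASGorenstein k 𝒜
  right : IsRightASGorenstein k 𝒜

/-- AS-regular: AS-Gorenstein of finite (left and right) global dimension. -/
structure IsASRegular : Prop extends IsASGorenstein k 𝒜 where
  leftGlobalDimension_lt : leftGlobalDimension A < ⊤
  rightGlobalDimension_lt : rightGlobalDimension A < ⊤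

end AS

/-! ### The skew polynomial algebra in three variables and its differentials -/

section Skew

variable (k : Type u) [Field k]

/-- The relations `x_i x_j + x_j x_i = 0`, for `i ≠ j`, on the free algebra in `x_0, x_1, x_2`. -/
inductive SkewRel : FreeAlgebra k (Fin 3) → FreeAlgebra k (Fin 3) → Prop
  | anticomm (i j : Fin 3) (h : i ≠ j) :
      SkewRel (FreeAlgebra.ι k i * FreeAlgebra.ι k j + FreeAlgebra.ι k j * FreeAlgebra.ι k i) 0

/-- The skew polynomial algebra
`k⟨x_0, x_1, x_2⟩ / (x_0 x_1 + x_1 x_0, x_1 x_2 + x_2 x_1, x_2 x_0 + x_0 x_2)`. -/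
def SkewPoly : Type u := RingQuot (SkewRel k)

namespace SkewPoly

instance : Ring (SkewPoly k) := inferInstanceAs (Ring (RingQuot (SkewRel k)))

instance : Algebra k (SkewPoly k) := inferInstanceAs (Algebra k (RingQuot (SkewRel k)))

/-- The generators `x_0, x_1, x_2`. -/
def x (i : Fin 3) : SkewPoly k := RingQuot.mkAlgHom k (SkewRel k) (FreeAlgebra.ι k i)

variable {k}

theorem x_anticomm {i j : Fin 3} (h : i ≠ j) : x k i * x k j + x k j * x k i = 0 := by
  have := RingQuot.mkAlgHom_rel k (SkewRel.anticomm (k := k) i j h)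
  rw [map_add, map_mul, map_mul, map_zero] at this
  exact this

section lift

variable {B : Type*} [Ring B] [Algebra k B]

/-- The universal property: a homomorphism is given by pairwise anticommuting elements. -/
def lift (f : Fin 3 → B) (hf : ∀ i j, i ≠ j → f i * f j + f j * f i = 0) : SkewPoly k →ₐ[k] B :=
  RingQuot.liftAlgHom k ⟨FreeAlgebra.lift k f, by
    rintro _ _ ⟨i, j, h⟩
    simpa using hf i j h⟩

@[simp]
theorem lift_x (f : Fin 3 → B) (hf : ∀ i j, i ≠ j → f i * f j + f j * f i = 0) (i : Fin 3) :
    lift f hf (x k i) = f i :=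
  (RingQuot.liftAlgHom_mkAlgHom_apply ..).trans (FreeAlgebra.lift_ι_apply f i)

theorem algHom_ext {f g : SkewPoly k →ₐ[k] B} (h : ∀ i, f (x k i) = g (x k i)) : f = g :=
  RingQuot.ringQuot_ext' k f g (FreeAlgebra.hom_ext (funext h))

end lift

variable (k)

/-- The span of the generators. -/
def gens : Submodule k (SkewPoly k) := Submodule.span k (Set.range (x k))

/-- The grading with `|x_0| = |x_1| = |x_2| = 1`: the component of degree `n` is spanned by the
words of length `n` in the generators. -/
def grading (n : ℕ) : Submodule k (SkewPoly k) := gens k ^ n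

instance : SetLike.GradedMonoid (grading k) := Submodule.nat_power_gradedMonoid (gens k)

variable {k}

theorem x_mem (i : Fin 3) : x k i ∈ grading k 1 := by
  rw [grading, pow_one]
  exact Submodule.subset_span ⟨i, rfl⟩

variable (k)

/-- The decomposition of the skew polynomial algebra into homogeneous components. -/
def decomp : SkewPoly k →ₐ[k] ⨁ n, grading k n :=
  lift (fun i => DirectSum.of (fun n => grading k n) 1 ⟨x k i, x_mem i⟩) fun i j h => by
    rw [DirectSum.of_mul_of, DirectSum.of_mul_of, ← map_add]
    convert map_zero (DirectSum.of (fun n => grading k n) (1 + 1))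
    exact Subtype.ext (x_anticomm h)

instance : GradedAlgebra (grading k) :=
  GradedAlgebra.ofAlgHom _ (decomp k)
    (algHom_ext fun i => by
      rw [AlgHom.comp_apply, decomp, lift_x, DirectSum.coeAlgHom_of]; rfl)
    fun n a => by
      obtain ⟨a, ha⟩ := a
      dsimp only
      unfold grading at ha
      induction ha using Submodule.pow_induction_on_left' with
      | algebraMap r => rw [AlgHom.commutes, DirectSum.algebraMap_apply]; rfl
      | add y z n hy hz ihy ihz => rw [map_add, ihy, ihz, ← map_add]; rfl
      | mem_mul m hm n y hy ih =>
        have hm' : decomp k m = DirectSum.of (fun n => grading k n) 1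
            ⟨m, by rw [grading, pow_one]; exact hm⟩ := by
          induction hm using Submodule.span_induction with
          | mem m hm => obtain ⟨i, rfl⟩ := hm; rw [decomp, lift_x]
          | zero => rw [map_zero]; exact (map_zero _).symm
          | add y z hy hz ihy ihz => rw [map_add, ihy, ihz, ← map_add]; rfl
          | smul c y hy ih => rw [map_smul, ih]; exact (DirectSum.of_smul ..).symm
        rw [map_mul, ih, hm', DirectSum.of_mul_of]
        exact DirectSum.of_eq_of_gradedMonoid_eq (Sigma.subtype_ext (add_comm _ _) rfl)

variable {k}

/-- Induction on homogeneous elements. -/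
theorem grading_induction {motive : ℕ → SkewPoly k → Prop} (one : motive 0 1)
    (smul : ∀ n (c : k) a, motive n a → motive n (c • a))
    (add : ∀ n a b, motive n a → motive n b → motive n (a + b))
    (x_mul : ∀ n i a, motive n a → motive (n + 1) (x k i * a))
    {n : ℕ} {a : SkewPoly k} (ha : a ∈ grading k n) : motive n a := by
  unfold grading at ha
  induction ha using Submodule.pow_induction_on_left' with
  | algebraMap r => rw [Algebra.algebraMap_eq_smul_one]; exact smul _ _ _ one
  | add y z n hy hz ihy ihz => exact add _ _ _ ihy ihz
  | mem_mul m hm n y hy ih =>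
    induction hm using Submodule.span_induction with
    | mem m hm => obtain ⟨i, rfl⟩ := hm; exact x_mul _ _ _ ih
    | zero => rw [zero_mul, ← zero_smul k (x k 0 * y)]; exact smul _ _ _ (x_mul _ _ _ ih)
    | add y z hy hz ihy ihz => rw [add_mul]; exact add _ _ _ ihy ihz
    | smul c z hz ihz => rw [smul_mul_assoc]; exact smul _ _ _ ihz

/-- Induction on all elements. -/
theorem induction_x {motive : SkewPoly k → Prop} (one : motive 1)
    (smul : ∀ (c : k) a, motive a → motive (c • a))
    (add : ∀ a b, motive a → motive b → motive (a + b))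
    (x_mul : ∀ i a, motive a → motive (x k i * a)) (a : SkewPoly k) : motive a := by
  induction a using DirectSum.Decomposition.inductionOn (grading k) with
  | zero => rw [← zero_smul k 1]; exact smul _ _ one
  | @homogeneous n m =>
    exact grading_induction (motive := fun _ a => motive a) one (fun _ => smul) (fun _ => add)
      (fun _ => x_mul) m.2
  | add m m' hm hm' => exact add _ _ hm hm'

theorem x_sq_mul_x (i j : Fin 3) : x k i ^ 2 * x k j = x k j * x k i ^ 2 := by
  by_cases h : i = j
  · subst h; rw [← pow_succ, ← pow_succ']
  · have h1 : x k i * x k j = -(x k j * x k i) := eq_neg_of_add_eq_zero_left (x_anticomm h)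
    rw [pow_two, mul_assoc, h1, mul_neg, ← mul_assoc, h1, neg_mul, neg_neg, mul_assoc]

theorem x_sq_central (i : Fin 3) (a : SkewPoly k) : x k i ^ 2 * a = a * x k i ^ 2 := by
  induction a using induction_x with
  | one => rw [mul_one, one_mul]
  | smul c a h => rw [mul_smul_comm, smul_mul_assoc, h]
  | add a b ha hb => rw [mul_add, add_mul, ha, hb]
  | x_mul j a h => rw [← mul_assoc, x_sq_mul_x, mul_assoc, h, mul_assoc]

/-- The value `∑ j, m_ij x_j ^ 2` of the differential given by `M = (m_ij)` at `x_i`. -/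
def quad (M : Matrix (Fin 3) (Fin 3) k) (i : Fin 3) : SkewPoly k := ∑ j, M i j • x k j ^ 2

theorem quad_mem (M : Matrix (Fin 3) (Fin 3) k) (i : Fin 3) : quad M i ∈ grading k 2 := by
  refine Submodule.sum_mem _ fun j _ => Submodule.smul_mem _ _ ?_
  rw [pow_two]
  exact SetLike.GradedMul.mul_mem (x_mem j) (x_mem j)

theorem quad_central (M : Matrix (Fin 3) (Fin 3) k) (i : Fin 3) (a : SkewPoly k) :
    quad M i * a = a * quad M i := by
  simp only [quad, Finset.sum_mul, Finset.mul_sum, smul_mul_assoc, mul_smul_comm, x_sq_central]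

/-- The homomorphism `a ↦ !![σ a, d a; 0, a]`, where `σ a = (-1) ^ |a| a` and `d` is the graded
derivation with `d x_i = ∑ j, m_ij x_j ^ 2`. -/
def diffHom (M : Matrix (Fin 3) (Fin 3) k) :
    SkewPoly k →ₐ[k] Matrix (Fin 2) (Fin 2) (SkewPoly k) :=
  lift (fun i => !![-x k i, quad M i; 0, x k i]) fun i j h => by
    have h1 : x k i * x k j + x k j * x k i = 0 := x_anticomm h
    ext a b
    fin_cases a <;> fin_cases b <;> simp [h1, quad_central]

theorem diffHom_x (M : Matrix (Fin 3) (Fin 3) k) (i : Fin 3) :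
    diffHom M (x k i) = !![-x k i, quad M i; 0, x k i] := lift_x _ _ i

theorem diffHom_one_zero (M : Matrix (Fin 3) (Fin 3) k) (a : SkewPoly k) :
    diffHom M a 1 0 = 0 := by
  induction a using induction_x with
  | one => simp
  | smul c a h => simp [h]
  | add a b ha hb => simp [ha, hb]
  | x_mul j a h => simp [diffHom_x, Matrix.mul_apply, h]

theorem diffHom_one_one (M : Matrix (Fin 3) (Fin 3) k) (a : SkewPoly k) :
    diffHom M a 1 1 = a := by
  induction a using induction_x with
  | one => simp
  | smul c a h => simp [h]
  | add a b ha hb => simp [ha, hb]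
  | x_mul j a h => simp [diffHom_x, Matrix.mul_apply, h]

theorem diffHom_zero_zero (M : Matrix (Fin 3) (Fin 3) k) {n : ℕ} {a : SkewPoly k}
    (ha : a ∈ grading k n) : diffHom M a 0 0 = (-1 : k) ^ n • a := by
  refine grading_induction (motive := fun n a => diffHom M a 0 0 = (-1 : k) ^ n • a)
    (by simp) (fun n c a h => ?_) (fun n a b ha hb => ?_) (fun n j a h => ?_) ha
  · rw [map_smul, Matrix.smul_apply, h, smul_comm]
  · simp [ha, hb]
  · simp [diffHom_x, Matrix.mul_apply, h, diffHom_one_zero, pow_succ]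

theorem diffHom_mul (M : Matrix (Fin 3) (Fin 3) k) (a b : SkewPoly k) :
    diffHom M (a * b) 0 1 = diffHom M a 0 0 * diffHom M b 0 1 + diffHom M a 0 1 * b := by
  rw [map_mul, Matrix.mul_apply, Fin.sum_univ_two, diffHom_one_one]

theorem diffHom_x_mul (M : Matrix (Fin 3) (Fin 3) k) (i : Fin 3) (a : SkewPoly k) :
    diffHom M (x k i * a) 0 1 = -(x k i * diffHom M a 0 1) + quad M i * a := by
  rw [diffHom_mul, diffHom_x]; simp

theorem diffHom_x_sq_mul (M : Matrix (Fin 3) (Fin 3) k) (i : Fin 3) (a : SkewPoly k) :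
    diffHom M (x k i ^ 2 * a) 0 1 = x k i ^ 2 * diffHom M a 0 1 := by
  rw [pow_two, mul_assoc, diffHom_x_mul, diffHom_x_mul, mul_add, mul_assoc, ← mul_assoc (quad M i),
    quad_central M i (x k i), mul_assoc, mul_neg, neg_add_rev, neg_neg]
  abel

theorem diffHom_quad_mul (M : Matrix (Fin 3) (Fin 3) k) (i : Fin 3) (a : SkewPoly k) :
    diffHom M (quad M i * a) 0 1 = quad M i * diffHom M a 0 1 := by
  simp only [quad, Finset.sum_mul, smul_mul_assoc, map_sum, map_smul, Matrix.sum_apply,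
    Matrix.smul_apply, diffHom_x_sq_mul]

/-- The cochain DG algebra structure on the skew polynomial algebra given by a matrix `M = (m_ij)`:
the unique graded derivation `d` of degree `1` with `d x_i = ∑ j, m_ij x_j ^ 2`. -/
def differential (M : Matrix (Fin 3) (Fin 3) k) : CochainDifferential (grading k) where
  d :=
    { toFun := fun a => diffHom M a 0 1
      map_add' := fun a b => by simp
      map_smul' := fun c a => by simp }
  d_mem n a ha := by
    dsimp only [LinearMap.coe_mk, AddHom.coe_mk]
    refine (grading_induction
      (motive := fun n a => a ∈ grading k n ∧ diffHom M a 0 1 ∈ grading k (n + 1))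
      ⟨SetLike.GradedOne.one_mem, by simp⟩ (fun n c a h => ?_) (fun n a b ha hb => ?_)
      (fun n j a h => ?_) ha).2
    · rw [map_smul]; exact ⟨Submodule.smul_mem _ _ h.1, Submodule.smul_mem _ _ h.2⟩
    · rw [map_add]; exact ⟨Submodule.add_mem _ ha.1 hb.1, Submodule.add_mem _ ha.2 hb.2⟩
    · rw [diffHom_x_mul, add_comm n 1]
      refine ⟨SetLike.GradedMul.mul_mem (x_mem j) h.1,
        Submodule.add_mem _ (Submodule.neg_mem _ ?_) ?_⟩
      · rw [add_assoc]; exact SetLike.GradedMul.mul_mem (x_mem j) h.2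
      · rw [add_right_comm]; exact SetLike.GradedMul.mul_mem (quad_mem M j) h.1
  d_d a := by
    dsimp only [LinearMap.coe_mk, AddHom.coe_mk]
    induction a using induction_x with
    | one => simp
    | smul c a h => simp [h]
    | add a b ha hb => simp [ha, hb]
    | x_mul j a h => 
      rw [diffHom_x_mul, map_add, map_neg, Matrix.add_apply, Matrix.neg_apply, diffHom_x_mul,
        diffHom_quad_mul, h]
      simp
  leibniz n a b ha := by
    dsimp only [LinearMap.coe_mk, AddHom.coe_mk]
    rw [diffHom_mul, diffHom_zero_zero M ha, smul_mul_assoc, add_comm]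

theorem differential_x (M : Matrix (Fin 3) (Fin 3) k) (i : Fin 3) :
    (differential M).d (x k i) = ∑ j, M i j • x k j ^ 2 := by
  change diffHom M (x k i) 0 1 = _
  rw [diffHom_x]; rfl

/-- A cochain DG algebra structure on the skew polynomial algebra is determined by the values of its
differential on the generators. -/
theorem eq_differential (M : Matrix (Fin 3) (Fin 3) k) (δ : CochainDifferential (grading k))
    (h : ∀ i, δ.d (x k i) = ∑ j, M i j • x k j ^ 2) : δ = differential M := by
  have key : δ.d = (differential M).d := by
    ext a
    induction a using induction_x with
    | one => rw [δ.d_one, (differential M).d_one]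
    | smul c a ih => rw [map_smul, map_smul, ih]
    | add a b ha hb => rw [map_add, map_add, ha, hb]
    | x_mul j a ih =>
      rw [δ.leibniz 1 _ _ (x_mem j), (differential M).leibniz 1 _ _ (x_mem j), h,
        differential_x, ih]
  cases δ
  cases hM : differential M
  rw [hM] at key
  cases key
  rfl

end SkewPoly

end Skew

/-! Let P be the polynomial ring in the squares x_i². The squares are central and the skew
polynomial algebra is free of rank 8 over P. Each ∂x_i is a combination of squares, hence central,
so the two Leibniz terms of ∂(x_i²) cancel and ∂ is P-linear. For an invertible matrix G put Y_i = ∑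
G_ij x_j. The words Y_0^a Y_1^b Y_2^c with exponents at most 1 are again a P-basis
(`words_lin_bijective`; this needs 2 ≠ 0), and ∂(Y_i a) = -Y_i ∂a + ℓ_i a, where ℓ_i is the linear
form in the squares given by row i of GM. So the complex is an iterated cone of multiplications by
linear forms, that is, a Koszul complex over P, and G may be adapted to M
(`differentialLinear_words`, `CohomologyPresentation.cone`).

If M is invertible, G = M⁻¹ makes the forms the three variables, a regular sequence, and the
cohomology is P/(X_0, X_1, X_2) = k. If M has rank 2, let t be the last row of G. Then ℓ_2 = 0,
while ℓ_0 and ℓ_1 are independent, and their common zeros are the line spanned by s. The cohomology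
is two copies of P/(ℓ_0, ℓ_1) ≅ k[w], with basis 1 and z = ⌈∑ t_i x_i⌉. Since z² = ⌈∑ t_i² x_i²⌉,
restriction to the line gives z² = κw with κ proportional to ∑ s_i t_i². This is
`IsCorankOne.isQuadratic`; κ = 1 (after rescaling) and κ = 0 give the two algebras of the theorem.

For the homological properties in rank 0, modules have resolutions of length 3 obtained by iterating
0 → X'[T] → X[T] → X → 0, one generator at a time (`hasProjectiveDimensionLE`). The generators form
a normal regular sequence, and dividing by them successively shifts Ext up by one degree each time,
so that Ext*(k, A) is k in degree 3 (`exists_presentation_insert`). In rank 2 the quadratic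
extension is a Frobenius extension of k[w], hence of injective dimension at most 1
(`IsQuadratic.hasInjectiveDimensionLE`). The quotient A/w is an extension of k by k with
two-dimensional Ext in degree 1 only, which forces Ext*(k, A) to be one-dimensional. In rank 3 the
algebra is a field. Right-hand statements follow by applying the left-hand ones to the opposite
algebra. -/

/-! ### `Ext` concentrated in one degree -/

section ExtConcentrated

open Abelian

universe v w

variable {k : Type u} [CommRing k] {C : Type v} [Category.{w} C] [Abelian C] [HasExt.{u} C]
  [Linear k C]

/-- `Ext*(X, Y)` vanishes outside of degree `n`, and `π` presents `Extⁿ(X, Y)` as `V / K`. -/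
structure ExtPresentation {V : Type u} [AddCommGroup V] [Module k V] {X Y : C} {n : ℕ}
    (π : V →ₗ[k] Ext X Y n) (K : Submodule k V) : Prop where
  surjective : Function.Surjective π
  ker_eq : LinearMap.ker π = K
  subsingleton : ∀ m, m ≠ n → Subsingleton (Ext X Y m)

variable {V₁ V₂ : Type u} [AddCommGroup V₁] [Module k V₁] [AddCommGroup V₂] [Module k V₂]

/-- By the long exact sequence, the kernel of precomposition with `S.g` is the image of the
connecting map from the Ext of `S.X₁` one degree lower, which is assumed to vanish. In degree 0
there is no such group and `S.g` being epi suffices. -/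
theorem Ext.comp_eq_zero_of_epi {S : ShortComplex C} (hS : S.ShortExact) {Y : C} {m : ℕ}
    (h : ∀ m', 1 + m' = m → Subsingleton (Ext S.X₁ Y m')) (x : Ext S.X₃ Y m)
    (hx : (Ext.mk₀ S.g).comp x (zero_add m) = 0) : x = 0 := by
  cases m with
  | zero =>
    have := hS.epi_g
    exact Ext.precomp_mk₀_injective_of_epi Y S.g (by simpa using hx)
  | succ m =>
    obtain ⟨y, rfl⟩ := Ext.contravariant_sequence_exact₃ hS Y x hx (add_comm 1 m)
    have := h m (add_comm 1 m)
    rw [Subsingleton.elim y 0, Ext.comp_zero]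

/-- The presentation of `Extⁿ⁺¹(X₃, Y)` by the connecting homomorphism of a short exact sequence
`0 ⟶ X₁ ⟶ X₂ ⟶ X₃ ⟶ 0`. -/
theorem ExtPresentation.of_shortExact {S : ShortComplex C} (hS : S.ShortExact) {Y : C} {n : ℕ}
    {π₁ : V₁ →ₗ[k] Ext S.X₁ Y n} {K₁ : Submodule k V₁} (h₁ : ExtPresentation π₁ K₁)
    {π₂ : V₂ →ₗ[k] Ext S.X₂ Y n} {K₂ : Submodule k V₂} (h₂ : ExtPresentation π₂ K₂)
    (φ : V₂ →ₗ[k] V₁) (hφ : ∀ v, (Ext.mk₀ S.f).comp (π₂ v) (zero_add n) = π₁ (φ v))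
    (hK : ∀ v, φ v ∈ K₁ → v ∈ K₂) :
    ExtPresentation (hS.extClass.precompOfLinear k Y (add_comm 1 n) ∘ₗ π₁)
      (K₁ ⊔ LinearMap.range φ) where
  surjective x := by
    have := h₂.subsingleton (n + 1) (by omega)
    obtain ⟨y, rfl⟩ := Ext.contravariant_sequence_exact₃ hS Y x (Subsingleton.elim _ _)
      (add_comm 1 n)
    obtain ⟨v, rfl⟩ := h₁.surjective y
    exact ⟨v, rfl⟩
  ker_eq := by
    ext v
    rw [LinearMap.mem_ker]
    constructor
    · intro hv
      obtain ⟨x, hx⟩ := Ext.contravariant_sequence_exact₁ hS Y (π₁ v) (add_comm 1 n) hv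
      obtain ⟨v', rfl⟩ := h₂.surjective x
      rw [hφ, eq_comm, ← sub_eq_zero, ← map_sub] at hx
      rw [← sub_add_cancel v (φ v')]
      refine Submodule.add_mem_sup ?_ ⟨v', rfl⟩
      rw [← h₁.ker_eq]
      exact hx
    · intro hv
      obtain ⟨a, ha, _, ⟨b, rfl⟩, rfl⟩ := Submodule.mem_sup.1 hv
      rw [← h₁.ker_eq, LinearMap.mem_ker] at ha
      rw [LinearMap.comp_apply, map_add, ha, zero_add, ← hφ]
      exact hS.extClass_comp_assoc _ (h := add_comm 1 n)
  subsingleton m hm := by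
    refine subsingleton_of_forall_eq 0 fun x => ?_
    refine Ext.comp_eq_zero_of_epi hS (fun m' hm' => h₁.subsingleton m' (by omega)) x ?_
    -- Degree `n` is the only one in which the Ext of `S.X₂` can survive. There `hK` says that `φ`
    -- is injective modulo `K₂` and `K₁`, and a class pulled back along `S.g` dies along `S.f`.
    by_cases hmn : m = n
    · subst hmn
      obtain ⟨v, hv⟩ := h₂.surjective ((Ext.mk₀ S.g).comp x (zero_add m))
      rw [← hv, ← LinearMap.mem_ker, h₂.ker_eq]
      apply hK
      rw [← h₁.ker_eq, LinearMap.mem_ker, ← hφ, hv,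
        ← Ext.comp_assoc _ _ _ (zero_add 0) (zero_add m) (by omega), Ext.mk₀_comp_mk₀, S.zero,
        Ext.mk₀_zero, Ext.zero_comp]
    · have := h₂.subsingleton m hmn
      exact Subsingleton.elim _ _

/-- The connecting homomorphism commutes with endomorphisms of short exact sequences. -/
theorem ExtPresentation.comp_extClass {S : ShortComplex C} (hS : S.ShortExact) {Y : C} {n : ℕ}
    {π₁ : V₁ →ₗ[k] Ext S.X₁ Y n} (f : S ⟶ S) (ψ : V₁ →ₗ[k] V₁)
    (h : ∀ v, (Ext.mk₀ f.τ₁).comp (π₁ v) (zero_add n) = π₁ (ψ v)) (v : V₁) :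
    (Ext.mk₀ f.τ₃).comp ((hS.extClass.precompOfLinear k Y (add_comm 1 n) ∘ₗ π₁) v)
      (zero_add (n + 1)) =
    (hS.extClass.precompOfLinear k Y (add_comm 1 n) ∘ₗ π₁) (ψ v) := by
  rw [LinearMap.comp_apply, LinearMap.comp_apply, ← h]
  change (Ext.mk₀ f.τ₃).comp (hS.extClass.comp (π₁ v) (add_comm 1 n)) (zero_add (n + 1)) =
    hS.extClass.comp ((Ext.mk₀ f.τ₁).comp (π₁ v) (zero_add n)) (add_comm 1 n)
  rw [← Ext.comp_assoc _ _ _ (zero_add 1) (add_comm 1 n) (by omega),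
    ← ShortComplex.ShortExact.extClass_naturality hS hS f,
    ← Ext.comp_assoc _ _ _ (add_zero 1) (zero_add n) (by omega)]

end ExtConcentrated

/-! ### Dimension of the total Ext space, and Ext of the free module -/

section RankTotalExt

open Abelian

variable {k A : Type u} [Field k] [Ring A] [Algebra k A]

theorem rank_totalExt {X Y : ModuleCat.{u} A} (n : ℕ)
    (h : ∀ m, m ≠ n → Subsingleton (Ext X Y m)) :
    Module.rank k (TotalExt X Y) = Module.rank k (Ext X Y n) := by
  classical
  refine (LinearEquiv.rank_eq (LinearEquiv.ofBijective
    (DirectSum.lof k ℕ (fun n => Ext X Y n) n) ⟨DirectSum.of_injective n, fun x => ?_⟩)).symm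
  refine ⟨x n, ?_⟩
  refine DFinsupp.ext fun m => ?_
  by_cases hm : m = n
  · subst hm; exact DirectSum.of_eq_same _ _
  · have := h m hm
    exact Subsingleton.elim _ _

theorem rank_totalExt_of_presentation {V : Type u} [AddCommGroup V] [Module k V]
    {X Y : ModuleCat.{u} A} {n : ℕ} {π : V →ₗ[k] Ext X Y n} {K : Submodule k V}
    (h : ExtPresentation π K) : Module.rank k (TotalExt X Y) = Module.rank k (V ⧸ K) := by
  rw [rank_totalExt n h.subsingleton, ← h.ker_eq]
  exact (LinearMap.quotKerEquivOfSurjective π h.surjective).rank_eq.symm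

theorem rank_totalExt_congr {X X' Y : ModuleCat.{u} A} (e : X ≅ X') :
    Module.rank k (TotalExt X Y) = Module.rank k (TotalExt X' Y) := by
  classical
  refine LinearEquiv.rank_eq (DirectSum.congrLinearEquiv fun n => ?_)
  exact LinearEquiv.ofLinearMap ((Ext.mk₀ e.inv).precompOfLinear k Y (zero_add n))
    ((Ext.mk₀ e.hom).precompOfLinear k Y (zero_add n))
    (by
      ext x
      change (Ext.mk₀ e.inv).comp ((Ext.mk₀ e.hom).comp x (zero_add n)) (zero_add n) = x
      rw [← Ext.comp_assoc _ _ _ (zero_add 0) (zero_add n) (by omega), Ext.mk₀_comp_mk₀,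
        e.inv_hom_id, Ext.mk₀_id_comp])
    (by
      ext x
      change (Ext.mk₀ e.hom).comp ((Ext.mk₀ e.inv).comp x (zero_add n)) (zero_add n) = x
      rw [← Ext.comp_assoc _ _ _ (zero_add 0) (zero_add n) (by omega), Ext.mk₀_comp_mk₀,
        e.hom_inv_id, Ext.mk₀_id_comp])

/-- Right multiplication by `a`, as an endomorphism of the left module `A`. -/
def mulRightHom (a : A) : ModuleCat.of A A ⟶ ModuleCat.of A A :=
  ModuleCat.ofHom (LinearMap.toSpanSingleton A A a)

theorem mulRightHom_apply (a b : A) : (mulRightHom a).hom b = b * a := rfl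

/-- `Ext*(A, A)` is `A`, in degree `0`. -/
noncomputable def extSelf (k : Type u) (A : Type u) [Field k] [Ring A] [Algebra k A] :
    A →ₗ[k] Ext (ModuleCat.of A A) (ModuleCat.of A A) 0 where
  toFun a := Ext.mk₀ (mulRightHom a)
  map_add' a b := by
    rw [← Ext.mk₀_add]
    congr 1
    ext
    exact mul_add _ _ _
  map_smul' c a := by
    rw [RingHom.id_apply, ← Ext.mk₀_smul]
    congr 1
    ext
    change (1 : A) * (c • a) = algebraMap k A c * (1 * a)
    rw [one_mul, one_mul, Algebra.smul_def]

theorem extSelf_presentation :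
    ExtPresentation (extSelf k A) ⊥ where
  surjective x := by
    obtain ⟨f, rfl⟩ := Ext.addEquiv₀.symm.surjective x
    refine ⟨f.hom (1 : A), ?_⟩
    change Ext.mk₀ _ = Ext.mk₀ _
    congr 1
    ext
    exact one_mul _
  ker_eq := by
    rw [LinearMap.ker_eq_bot']
    intro a ha
    have h : mulRightHom a = 0 := (Ext.mk₀_eq_zero_iff _).1 ha
    rw [← one_mul a, ← mulRightHom_apply, h]
    rfl
  subsingleton m hm := by
    obtain ⟨m, rfl⟩ := Nat.exists_eq_succ_of_ne_zero hm
    have : Projective (ModuleCat.of A A) :=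
      ModuleCat.projective_of_free (Module.Basis.singleton PUnit.{u+1} A)
    exact Ext.subsingleton_of_projective ..

/-- Precomposing with right multiplication by `a` acts on the presenting space by left
multiplication by `a`. This exchange of sides is why normality of the generators matters below. -/
theorem comp_extSelf (a b : A) :
    (Ext.mk₀ (mulRightHom a)).comp (extSelf k A b) (zero_add 0) = extSelf k A (a * b) := by
  change (Ext.mk₀ _).comp (Ext.mk₀ _) _ = Ext.mk₀ _
  rw [Ext.mk₀_comp_mk₀]
  congr 1
  ext
  change (1 * a) * b = 1 * (a * b)
  rw [one_mul, one_mul]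

end RankTotalExt

/-! ### The global dimension of the skew polynomial algebra -/

section GlobalDimension

variable {k A : Type u} [Field k] [Ring A] [Algebra k A] (e : SkewPoly k ≃ₐ[k] A)

open scoped ModuleCat

namespace SkewPoly

theorem equiv_x_anticomm {i j : Fin 3} (h : i ≠ j) :
    e (x k i) * e (x k j) = -(e (x k j) * e (x k i)) := by
  rw [eq_neg_iff_add_eq_zero, ← map_mul, ← map_mul, ← map_add, x_anticomm h, map_zero]

/-- Induction on the elements of an algebra isomorphic to the skew polynomial algebra. -/
theorem equiv_induction {motive : A → Prop} (scalar : ∀ c, motive (algebraMap k A c))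
    (add : ∀ a b, motive a → motive b → motive (a + b))
    (mul : ∀ a b, motive a → motive b → motive (a * b))
    (x : ∀ i, motive (e (x k i))) (a : A) : motive a := by
  obtain ⟨a, rfl⟩ := e.surjective a
  induction a using induction_x with
  | one => rw [map_one, ← map_one (algebraMap k A)]; exact scalar 1
  | smul c a h => rw [map_smul, Algebra.smul_def]; exact mul _ _ (scalar c) h
  | add a b ha hb => rw [map_add]; exact add _ _ ha hb
  | x_mul i a h => rw [map_mul]; exact mul _ _ (x i) h

/-- An additive map commuting with scalars and generators is a module homomorphism. -/
def homOfCommute {X Y : ModuleCat.{u} A} (f : X →+ Y)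
    (hc : ∀ (c : k) m, f (algebraMap k A c • m) = algebraMap k A c • f m)
    (hx : ∀ i m, f (e (x k i) • m) = e (x k i) • f m) : X ⟶ Y :=
  ModuleCat.ofHom
    { f with
      map_smul' := fun a => by
        refine equiv_induction (motive := fun a => ∀ m, f (a • m) = a • f m) e hc ?_ ?_ hx a
        · intro a b ha hb m; rw [add_smul, map_add, ha, hb, add_smul]
        · intro a b ha hb m; rw [mul_smul, ha, hb, mul_smul] }

theorem homOfCommute_apply {X Y : ModuleCat.{u} A} (f : X →+ Y) (hc hx) (m : X) :
    (homOfCommute e f hc hx).hom m = f m := rfl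

variable (i : Fin 3) (X : ModuleCat.{u} A)

/-- The operators by which the generators act on the module induced from the subalgebra generated
by the `x_j` with `j ≠ i`. -/
noncomputable def inducedOp (j : Fin 3) : Module.End k (ℕ →₀ X) :=
  if j = i then Finsupp.lmapDomain X k Nat.succ
  -- The sign comes from moving x_j past T ^ n, where T plays the role of x_i.
  else Finsupp.lsum k fun n =>
    Finsupp.lsingle n ∘ₗ Algebra.lsmul k k X ((-1) ^ n * e (x k j))

theorem inducedOp_self_single (n : ℕ) (m : X) :
    inducedOp e i X i (Finsupp.single n m) = Finsupp.single (n + 1) m := by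
  rw [inducedOp, if_pos rfl]
  exact Finsupp.mapDomain_single

theorem inducedOp_single_of_ne {j : Fin 3} (h : j ≠ i) (n : ℕ) (m : X) :
    inducedOp e i X j (Finsupp.single n m) =
      Finsupp.single n (((-1) ^ n * e (x k j)) • m) := by
  rw [inducedOp, if_neg h, Finsupp.lsum_single]
  rfl

theorem inducedOp_anticomm {j l : Fin 3} (h : j ≠ l) :
    inducedOp e i X j * inducedOp e i X l + inducedOp e i X l * inducedOp e i X j = 0 := by
  refine Finsupp.lhom_ext fun n m => ?_
  simp only [LinearMap.add_apply, Module.End.mul_apply, LinearMap.zero_apply]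
  by_cases hj : j = i
  · subst hj
    rw [inducedOp_single_of_ne e _ X h.symm, inducedOp_self_single, inducedOp_self_single,
      inducedOp_single_of_ne e _ X h.symm, ← Finsupp.single_add, pow_succ]
    simp
  · by_cases hl : l = i
    · subst hl
      rw [inducedOp_single_of_ne e _ X hj, inducedOp_self_single, inducedOp_self_single,
        inducedOp_single_of_ne e _ X hj, ← Finsupp.single_add, pow_succ]
      simp
    · have hn : ∀ a : A, a * (-1) ^ n = (-1) ^ n * a := fun a =>
        ((Commute.neg_one_right a).pow_right n).eq
      rw [inducedOp_single_of_ne e _ X hj, inducedOp_single_of_ne e _ X hl,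
        inducedOp_single_of_ne e _ X hj, inducedOp_single_of_ne e _ X hl, ← Finsupp.single_add,
        smul_smul, smul_smul, ← add_smul]
      have : (-1) ^ n * e (x k j) * ((-1) ^ n * e (x k l)) +
          (-1) ^ n * e (x k l) * ((-1) ^ n * e (x k j)) = 0 := by
        rw [mul_assoc, mul_assoc, ← mul_assoc (e _), ← mul_assoc (e _), hn, hn, mul_assoc,
          mul_assoc, equiv_x_anticomm e h]
        simp
      rw [this, zero_smul, Finsupp.single_zero]

/-- The action on the induced module. -/
noncomputable def inducedAction : A →ₐ[k] Module.End k (ℕ →₀ X) :=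
  (lift (inducedOp e i X) fun _ _ => inducedOp_anticomm e i X).comp e.symm.toAlgHom

theorem inducedAction_x (j : Fin 3) : inducedAction e i X (e (x k j)) = inducedOp e i X j :=
  (congrArg (lift _ _) (e.symm_apply_apply _)).trans (lift_x ..)

/-- The module `X[T]` induced from the restriction of `X` to the subalgebra generated by the `x_j`
with `j ≠ i`. -/
noncomputable def induced : ModuleCat.{u} A :=
  letI : Module A (ℕ →₀ X) := Module.compHom _ (inducedAction e i X).toRingHom
  ModuleCat.of A (ℕ →₀ X)

namespace induced

/-- The inclusion of `X` as `T ^ n X` into `X[T]`. -/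
noncomputable def single (n : ℕ) : X →+ induced e i X := Finsupp.singleAddHom n

theorem x_smul_single (n : ℕ) (m : X) :
    e (x k i) • single e i X n m = single e i X (n + 1) m := by
  change inducedAction e i X _ (Finsupp.single n m) = Finsupp.single (n + 1) m
  rw [inducedAction_x, inducedOp_self_single]

theorem x_smul_single_of_ne {j : Fin 3} (h : j ≠ i) (n : ℕ) (m : X) :
    e (x k j) • single e i X n m = single e i X n (((-1) ^ n * e (x k j)) • m) := by
  change inducedAction e i X _ (Finsupp.single n m) = Finsupp.single n _
  rw [inducedAction_x, inducedOp_single_of_ne e i X h]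

theorem algebraMap_smul_single (c : k) (n : ℕ) (m : X) :
    algebraMap k A c • single e i X n m = single e i X n (algebraMap k A c • m) := by
  change inducedAction e i X _ (Finsupp.single n m) = Finsupp.single n (c • m)
  rw [AlgHom.commutes, Module.algebraMap_end_apply, Finsupp.smul_single]

variable {e i X}

/-- Induction on the elements of `X[T]`. -/
theorem induction {motive : induced e i X → Prop} (zero : motive 0)
    (add : ∀ p q, motive p → motive q → motive (p + q))
    (single : ∀ n m, motive (single e i X n m)) (p : induced e i X) : motive p :=
  Finsupp.induction_linear (motive := motive) p zero add single

/-- The coefficient of `T ^ n`. -/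
noncomputable def coeff (n : ℕ) : induced e i X →+ X := Finsupp.applyAddHom n

theorem coeff_single (n n' : ℕ) (m : X) :
    coeff n (single e i X n' m) = if n' = n then m else 0 := Finsupp.single_apply

theorem ext_coeff {p q : induced e i X} (h : ∀ n, coeff n p = coeff n q) : p = q :=
  Finsupp.ext h

theorem exists_coeff_eq_zero (p : induced e i X) : ∃ N, ∀ n, N ≤ n → coeff n p = 0 := by
  refine ⟨(show ℕ →₀ X from p).support.sup id + 1, fun n hn => ?_⟩
  by_contra h
  have := Finset.le_sup (f := id) (Finsupp.mem_support_iff.2 h)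
  exact absurd (this.trans_lt (Nat.lt_of_succ_le hn)) (lt_irrefl n)

theorem exists_coeff_eq {m : ℕ → X} {N : ℕ} (h : ∀ n, N ≤ n → m n = 0) :
    ∃ p : induced e i X, ∀ n, coeff n p = m n :=
  ⟨(Finsupp.onFinset (Finset.range N) m fun n hn => Finset.mem_range.2 <|
    not_le.1 fun h' => hn (h n h') : ℕ →₀ X), fun _ => rfl⟩

/-- Additive maps on `X[T]`. -/
noncomputable def addLift {Y : Type*} [AddCommGroup Y] (h : ℕ → X →+ Y) : induced e i X →+ Y :=
  Finsupp.liftAddHom h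

theorem addLift_single {Y : Type*} [AddCommGroup Y] (h : ℕ → X →+ Y) (n : ℕ) (m : X) :
    addLift h (single e i X n m) = h n m :=
  Finsupp.liftAddHom_apply_single ..

theorem addHom_ext {Y : Type*} [AddCommGroup Y] {f g : induced e i X →+ Y}
    (h : ∀ n m, f (single e i X n m) = g (single e i X n m)) : f = g :=
  Finsupp.addHom_ext h

variable {Y : ModuleCat.{u} A}

/-- Maps which commute with `x_i` are determined by their restriction to `X`. -/
theorem eq_of_commute {f g : induced e i X →+ Y}
    (hf : ∀ p, f (e (x k i) • p) = e (x k i) • f p) (hg : ∀ p, g (e (x k i) • p) = e (x k i) • g p)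
    (h : ∀ m, f (single e i X 0 m) = g (single e i X 0 m)) : f = g := by
  refine addHom_ext fun n => ?_
  induction n with
  | zero => exact h
  | succ n ih => intro m; rw [← x_smul_single, hf, hg, ih]

/-- The extension of a map `X ⟶ Y` to `X[T]` which commutes with `x_i`. -/
noncomputable def extend (h : X →+ Y) : induced e i X →+ Y :=
  addLift fun n => (DistribSMul.toAddMonoidHom Y (e (x k i) ^ n)).comp h

theorem extend_single (h : X →+ Y) (n : ℕ) (m : X) :
    extend h (single e i X n m) = e (x k i) ^ n • h m :=
  addLift_single ..

theorem commute_of_single {f : induced e i X →+ Y} {a : A}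
    (h : ∀ n m, f (a • single e i X n m) = a • f (single e i X n m)) (p : induced e i X) :
    f (a • p) = a • f p :=
  DFunLike.congr_fun (addHom_ext (f := f.comp (DistribSMul.toAddMonoidHom (induced e i X) a))
    (g := (DistribSMul.toAddMonoidHom Y a).comp f) h) p

theorem extend_x_smul (h : X →+ Y) (p : induced e i X) :
    extend h (e (x k i) • p) = e (x k i) • extend h p := by
  refine commute_of_single (fun n m => ?_) p
  rw [x_smul_single, extend_single, extend_single, pow_succ', mul_smul]

theorem extend_algebraMap_smul {h : X →+ Y}
    (hc : ∀ (c : k) m, h (algebraMap k A c • m) = algebraMap k A c • h m) (c : k)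
    (p : induced e i X) : extend h (algebraMap k A c • p) = algebraMap k A c • extend h p := by
  refine commute_of_single (fun n m => ?_) p
  rw [algebraMap_smul_single, extend_single, extend_single, hc, smul_smul, smul_smul,
    Algebra.commutes]

theorem neg_one_pow_mul (i j : Fin 3) (h : j ≠ i) (n : ℕ) :
    e (x k i) ^ n * ((-1) ^ n * e (x k j)) = e (x k j) * e (x k i) ^ n := by
  induction n with
  | zero => simp
  | succ n ih =>
    rw [pow_succ (-1 : A), mul_neg_one, neg_mul, mul_neg, pow_succ', mul_assoc, ih, ← mul_assoc,
      equiv_x_anticomm e h.symm, neg_mul, neg_neg, mul_assoc]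

theorem extend_x_smul_of_ne {h : X →+ Y} {j : Fin 3} (hj : j ≠ i)
    (hx : ∀ m, h (e (x k j) • m) = e (x k j) • h m) (p : induced e i X) :
    extend h (e (x k j) • p) = e (x k j) • extend h p := by
  refine commute_of_single (fun n m => ?_) p
  have hn : h (((-1) ^ n * e (x k j)) • m) = ((-1) ^ n * e (x k j)) • h m := by
    rcases Nat.even_or_odd n with h | h
    · rw [h.neg_one_pow, one_mul, hx]
    · rw [h.neg_one_pow, neg_one_mul, neg_smul, neg_smul, map_neg, hx]
  rw [x_smul_single_of_ne e i X hj, extend_single, extend_single, hn, smul_smul, smul_smul,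
    neg_one_pow_mul i j hj]

end induced

end SkewPoly

end GlobalDimension

/-! ### The short exact sequence 0 → X'[T] → X[T] → X → 0 and the bound on projective dimension -/

section GlobalDimensionBound

variable {k A : Type u} [Field k] [Ring A] [Algebra k A] (e : SkewPoly k ≃ₐ[k] A)

open scoped ModuleCat

namespace SkewPoly

/-- The automorphism `x_j ↦ -x_j`. -/
def signHom : A →ₐ[k] A :=
  (e.toAlgHom.comp (lift (fun j => -x k j) fun i j h => by
    rw [neg_mul_neg, neg_mul_neg, x_anticomm h])).comp e.symm.toAlgHom

theorem signHom_x (j : Fin 3) : signHom e (e (x k j)) = -e (x k j) := by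
  change e (lift _ _ (e.symm (e _))) = _
  rw [e.symm_apply_apply, lift_x, map_neg]

/-- The module `X` on which the generators act with the opposite sign. -/
noncomputable def twist (X : ModuleCat.{u} A) : ModuleCat.{u} A :=
  (ModuleCat.restrictScalars (signHom e).toRingHom).obj X

namespace induced

/-- The identity map from the twist of `X` to `X`. -/
def untwist (X : ModuleCat.{u} A) : twist e X →+ X := AddMonoidHom.id X

theorem untwist_injective (X : ModuleCat.{u} A) : Function.Injective (untwist e X) :=
  Function.injective_id

theorem untwist_surjective (X : ModuleCat.{u} A) : Function.Surjective (untwist e X) :=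
  Function.surjective_id

theorem untwist_smul (X : ModuleCat.{u} A) (a : A) (m : twist e X) :
    untwist e X (a • m) = signHom e a • untwist e X m := rfl

variable (i : Fin 3) (X : ModuleCat.{u} A)

/-- The map `T ^ n m ↦ T ^ (n + 1) m - T ^ n (x_i m)`, as an additive map. -/
noncomputable def relAddHom : induced e i (twist e X) →+ induced e i X :=
  addLift fun n => (single e i X (n + 1)).comp (untwist e X) -
    ((single e i X n).comp (DistribSMul.toAddMonoidHom X (e (x k i)))).comp (untwist e X)

theorem relAddHom_single (n : ℕ) (m : twist e X) :
    relAddHom e i X (single e i (twist e X) n m) =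
      single e i X (n + 1) (untwist e X m) - single e i X n (e (x k i) • untwist e X m) :=
  addLift_single ..

/-- The map `T ^ n m ↦ T ^ (n + 1) m - T ^ n (x_i m)`. -/
noncomputable def relHom : induced e i (twist e X) ⟶ induced e i X :=
  homOfCommute e (relAddHom e i X)
    (fun c => commute_of_single fun n m => by
      simp only [algebraMap_smul_single, relAddHom_single, untwist_smul, AlgHom.commutes,
        smul_sub, smul_smul, Algebra.commutes])
    (fun j => commute_of_single fun n m => by
      by_cases hj : j = i
      · subst hj
        simp only [x_smul_single, relAddHom_single, smul_sub]
      -- Raising the exponent of T changes the sign of the action of x_j, and so does moving x_j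
      -- past x_i. The twist on the source absorbs both signs.
      · have hn : e (x k i) * ((-1) ^ n * e (x k j)) = -((-1) ^ n * e (x k j) * e (x k i)) := by
          rw [← mul_assoc, ((Commute.neg_one_right (e (x k i))).pow_right n).eq, mul_assoc,
            equiv_x_anticomm e (Ne.symm hj), mul_neg, mul_assoc]
        simp only [x_smul_single_of_ne _ _ _ hj, relAddHom_single, smul_sub, untwist_smul, map_mul,
          map_pow, map_neg, map_one, signHom_x, smul_smul, smul_neg, mul_neg, hn, neg_smul, pow_succ,
          neg_neg, neg_mul, mul_one])

theorem relHom_single (n : ℕ) (m : twist e X) :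
    (relHom e i X).hom (single e i (twist e X) n m) =
      single e i X (n + 1) (untwist e X m) - single e i X n (e (x k i) • untwist e X m) :=
  relAddHom_single ..

/-- The action map `T ^ n m ↦ x_i ^ n m`. -/
noncomputable def actHom : induced e i X ⟶ X :=
  homOfCommute e (extend (AddMonoidHom.id X)) (extend_algebraMap_smul fun _ _ => rfl) fun j => by
    by_cases hj : j = i
    · subst hj; exact extend_x_smul _
    · exact extend_x_smul_of_ne hj fun _ => rfl

theorem actHom_single (n : ℕ) (m : X) :
    (actHom e i X).hom (single e i X n m) = e (x k i) ^ n • m :=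
  extend_single (AddMonoidHom.id X) n m

theorem relHom_actHom : relHom e i X ≫ actHom e i X = 0 := by
  refine ModuleCat.hom_ext (LinearMap.toAddMonoidHom_injective (addHom_ext fun n m => ?_))
  change (actHom e i X).hom ((relHom e i X).hom (single e i (twist e X) n m)) = 0
  rw [relHom_single, map_sub, actHom_single, actHom_single, pow_succ, mul_smul, sub_self]

/-- The short exact sequence `0 ⟶ X'[T] ⟶ X[T] ⟶ X ⟶ 0`. -/
noncomputable def shortComplex : ShortComplex (ModuleCat.{u} A) :=
  ShortComplex.mk _ _ (relHom_actHom e i X)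

theorem coeff_relHom_succ (p : induced e i (twist e X)) (n : ℕ) :
    coeff (n + 1) ((relHom e i X).hom p) =
      untwist e X (coeff n p) - e (x k i) • untwist e X (coeff (n + 1) p) := by
  induction p using induction with
  | zero => simp only [map_zero, smul_zero, sub_zero]
  | add p q hp hq => simp only [map_add, hp, hq, smul_add]; abel
  | single n' m =>
    rw [relHom_single, map_sub, coeff_single, coeff_single, coeff_single, coeff_single]
    simp only [Nat.add_right_cancel_iff]
    split_ifs <;> simp

/-- Modulo the image of `relHom`, T ^ (n + 1) m is congruent to T ^ n (x_i m), so every element can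
be pushed down to its value under the action map, placed in degree 0. This gives exactness in the
middle. -/
theorem exists_relHom_eq (p : induced e i X) : ∃ q, (relHom e i X).hom q =
    p - single e i X 0 ((actHom e i X).hom p) := by
  induction p using induction with
  | zero => exact ⟨0, by simp only [map_zero, sub_zero]⟩
  | add p q hp hq =>
    obtain ⟨p', hp'⟩ := hp
    obtain ⟨q', hq'⟩ := hq
    exact ⟨p' + q', by simp only [map_add, hp', hq']; abel⟩
  | single n m =>
    induction n generalizing m with
    | zero => exact ⟨0, by rw [actHom_single, pow_zero, one_smul, sub_self, map_zero]⟩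
    | succ n ih =>
      obtain ⟨q, hq⟩ := ih (e (x k i) • m)
      obtain ⟨m, rfl⟩ := untwist_surjective e X m
      refine ⟨single e i (twist e X) n m + q, ?_⟩
      rw [map_add, hq, relHom_single, actHom_single, actHom_single, smul_smul, ← pow_succ]
      exact sub_add_sub_cancel ..

/-- In the kernel each coefficient is x_i times the next one, up to the twist. Coefficients vanish
from some `N` on, hence all of them vanish by descending induction. -/
theorem relHom_injective : Function.Injective (relHom e i X).hom := by
  refine (injective_iff_map_eq_zero (relHom e i X).hom).2 fun p hp => ?_
  have h1 : ∀ n, untwist e X (coeff n p) = e (x k i) • untwist e X (coeff (n + 1) p) := fun n => by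
    rw [← sub_eq_zero, ← coeff_relHom_succ, hp, map_zero]
  obtain ⟨N, hN⟩ := exists_coeff_eq_zero p
  have h2 : ∀ l n, N ≤ n + l → untwist e X (coeff n p) = 0 := by
    intro l
    induction l with
    | zero => intro n h; rw [hN n h, map_zero]
    | succ l ih => intro n h; rw [h1 n, ih (n + 1) (by omega), smul_zero]
  refine ext_coeff fun n => untwist_injective e X ?_
  rw [h2 N n (by omega), map_zero, map_zero]

theorem shortExact : (shortComplex e i X).ShortExact := by
  refine ModuleCat.shortComplex_shortExact _ (fun p => ⟨fun hp => ?_, ?_⟩)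
    (relHom_injective e i X) fun m => ?_
  · obtain ⟨q, hq⟩ := exists_relHom_eq e i X p
    refine ⟨q, hq.trans ?_⟩
    have hp' : (actHom e i X).hom p = 0 := hp
    rw [hp', map_zero]
    exact sub_zero _
  · rintro ⟨q, rfl⟩
    exact congrArg (fun f => f.hom q) (relHom_actHom e i X)
  · refine ⟨single e i X 0 m, (actHom_single e i X 0 m).trans ?_⟩
    rw [pow_zero]
    exact one_smul A (show X from m)

variable {X}

/-- The functoriality of `X[T]`, as an additive map. -/
noncomputable def mapAddHom {Y : ModuleCat.{u} A} (f : X ⟶ Y) : induced e i X →+ induced e i Y :=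
  addLift fun n => (single e i Y n).comp f.hom.toAddMonoidHom

theorem mapAddHom_single {Y : ModuleCat.{u} A} (f : X ⟶ Y) (n : ℕ) (m : X) :
    mapAddHom e i f (single e i X n m) = single e i Y n (f.hom m) :=
  addLift_single ..

/-- The functoriality of `X[T]`. -/
noncomputable def map {Y : ModuleCat.{u} A} (f : X ⟶ Y) : induced e i X ⟶ induced e i Y :=
  homOfCommute e (mapAddHom e i f)
    (fun c => commute_of_single fun n m => by
      simp only [algebraMap_smul_single, mapAddHom_single, map_smul])
    (fun j => commute_of_single fun n m => by
      by_cases hj : j = i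
      · subst hj
        simp only [x_smul_single, mapAddHom_single]
      · simp only [x_smul_single_of_ne _ _ _ hj, mapAddHom_single, map_smul])

theorem coeff_map {Y : ModuleCat.{u} A} (f : X ⟶ Y) (p : induced e i X) (n : ℕ) :
    coeff n ((map e i f).hom p) = f.hom (coeff n p) := by
  induction p using induction with
  | zero => simp only [map_zero]
  | add p q hp hq => simp only [map_add, hp, hq]
  | single n' m =>
    rw [coeff_single, map, homOfCommute_apply, mapAddHom_single, coeff_single]
    split_ifs
    · rfl
    · rw [map_zero]

theorem map_comp_map {S : ShortComplex (ModuleCat.{u} A)} :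
    map e i S.f ≫ map e i S.g = 0 := by
  refine ModuleCat.hom_ext (LinearMap.ext fun p => ext_coeff fun n => ?_)
  change coeff n ((map e i S.g).hom ((map e i S.f).hom p)) = 0
  rw [coeff_map, coeff_map, ← ModuleCat.comp_apply, S.zero]
  rfl

theorem map_shortExact {S : ShortComplex (ModuleCat.{u} A)} (hS : S.ShortExact) :
    (ShortComplex.mk (map e i S.f) (map e i S.g) (map_comp_map e i)).ShortExact := by
  refine ModuleCat.shortComplex_shortExact _ (fun (p : induced e i S.X₂) => ⟨fun hp => ?_, ?_⟩)
    ?_ ?_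
  · have hex := (ShortComplex.ShortExact.moduleCat_exact_iff_function_exact S).1 hS.exact
    have hp0 : (map e i S.g).hom p = 0 := hp
    have hp' : ∀ n, ∃ m, S.f.hom m = coeff n p := fun n =>
      (hex _).1 (by
        change S.g.hom _ = 0
        rw [← coeff_map, hp0, map_zero])
    choose m hm using hp'
    obtain ⟨N, hN⟩ := exists_coeff_eq_zero p
    -- Beyond the support of `p` the chosen preimages are zero because `S.f` is injective, so they
    -- are the coefficients of an element.
    obtain ⟨q, hq⟩ := exists_coeff_eq (e := e) (i := i) (m := m) (N := N) fun n hn =>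
      hS.moduleCat_injective_f ((hm n).trans ((hN n hn).trans (map_zero S.f.hom).symm))
    exact ⟨q, ext_coeff fun n => (coeff_map e i S.f q n).trans (by rw [hq, hm])⟩
  · rintro ⟨q, rfl⟩
    exact congrArg (fun f => f.hom q) (map_comp_map e i)
  · refine (injective_iff_map_eq_zero (map e i S.f).hom).2 fun p hp => ext_coeff fun n => ?_
    apply hS.moduleCat_injective_f
    change S.f.hom _ = S.f.hom _
    rw [← coeff_map, hp, map_zero, map_zero, map_zero]
  · intro (p : induced e i S.X₃)
    change ∃ q, (map e i S.g).hom q = p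
    induction p using induction with
    | zero => exact ⟨0, map_zero _⟩
    | add p q hp hq =>
      obtain ⟨p', hp'⟩ := hp
      obtain ⟨q', hq'⟩ := hq
      exact ⟨p' + q', by rw [map_add, hp', hq']⟩
    | single n m =>
      obtain ⟨m', rfl⟩ := hS.moduleCat_surjective_g m
      exact ⟨single e i S.X₂ n m', mapAddHom_single e i S.g n m'⟩

end induced

/-- After inducing along all three generators nothing of the action on `X` is left: the module is A
⊗ X over k, through ordered monomials. A lift is therefore found k-linearly on `X` and extended by
commuting with x_2, then x_1, then x_0. Two maps commuting with x_i agree as soon as they agree on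
the constant terms. -/
theorem projective_induced (X : ModuleCat.{u} A) :
    Projective (induced e 0 (induced e 1 (induced e 2 X))) where
  factors {E Y} g φ _ := by
    have hφ : Function.Surjective φ := (ModuleCat.epi_iff_surjective φ).1 inferInstance
    let X₂ := induced e 2 X
    let X₁ := induced e 1 X₂
    obtain ⟨h, hh⟩ := Module.projective_lifting_property (R := k) (P := X)
      (φ.hom.restrictScalars k)
      { toFun := fun m => g.hom (induced.single e 0 X₁ 0
          (induced.single e 1 X₂ 0 (induced.single e 2 X 0 m)))
        map_add' := fun m m' => by simp only [map_add]
        map_smul' := fun c m => by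
          rw [RingHom.id_apply]
          change _ = algebraMap k A c • g.hom _
          rw [← map_smul, induced.algebraMap_smul_single, induced.algebraMap_smul_single,
            induced.algebraMap_smul_single]
          rfl } hφ
    let h₂ : X₂ →+ E := induced.extend h.toAddMonoidHom
    let h₁ : X₁ →+ E := induced.extend h₂
    let h₀ : induced e 0 X₁ →+ E := induced.extend h₁
    have c₂ : ∀ (c : k) m, h₂ (algebraMap k A c • m) = algebraMap k A c • h₂ m :=
      induced.extend_algebraMap_smul (map_smul h)
    have c₁ : ∀ (c : k) m, h₁ (algebraMap k A c • m) = algebraMap k A c • h₁ m :=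
      induced.extend_algebraMap_smul c₂
    have x22 : ∀ m, h₂ (e (x k 2) • m) = e (x k 2) • h₂ m := induced.extend_x_smul _
    have x12 : ∀ m, h₁ (e (x k 2) • m) = e (x k 2) • h₁ m :=
      induced.extend_x_smul_of_ne (by decide) x22
    have x11 : ∀ m, h₁ (e (x k 1) • m) = e (x k 1) • h₁ m := induced.extend_x_smul _
    have x00 : ∀ m, h₀ (e (x k 0) • m) = e (x k 0) • h₀ m := induced.extend_x_smul _
    refine ⟨homOfCommute e h₀ (induced.extend_algebraMap_smul c₁) fun i => ?_, ?_⟩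
    · fin_cases i
      · exact x00
      · exact induced.extend_x_smul_of_ne (by decide) x11
      · exact induced.extend_x_smul_of_ne (by decide) x12
    · refine ModuleCat.hom_ext (LinearMap.toAddMonoidHom_injective ?_)
      have s0 : ∀ (j : Fin 3) (hj : j ≠ 0) m, induced.single e 0 X₁ 0 (e (x k j) • m) =
          e (x k j) • induced.single e 0 X₁ 0 m := fun j hj m => by
        rw [induced.x_smul_single_of_ne e 0 X₁ hj, pow_zero, one_mul]
      have s1 : ∀ m, induced.single e 1 X₂ 0 (e (x k 2) • m) =
          e (x k 2) • induced.single e 1 X₂ 0 m := fun m => by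
        rw [induced.x_smul_single_of_ne e 1 X₂ (by decide), pow_zero, one_mul]
      refine induced.eq_of_commute (fun p => ?_) (fun p => map_smul g.hom _ _) fun p => ?_
      · change φ.hom (h₀ _) = _ • φ.hom (h₀ _)
        rw [x00, map_smul]
      change φ.hom (h₀ _) = g.hom _
      rw [show h₀ (induced.single e 0 X₁ 0 p) = h₁ p by
        rw [induced.extend_single, pow_zero, one_smul]]
      refine DFunLike.congr_fun (induced.eq_of_commute (f := φ.hom.toAddMonoidHom.comp h₁)
        (g := g.hom.toAddMonoidHom.comp (induced.single e 0 X₁ 0)) (fun p => ?_) (fun p => ?_)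
        fun p => ?_) p
      · change φ.hom (h₁ _) = _ • φ.hom (h₁ _)
        rw [x11, map_smul]
      · change g.hom _ = _ • g.hom _
        rw [s0 1 (by decide), map_smul]
      change φ.hom (h₁ _) = g.hom _
      rw [show h₁ (induced.single e 1 X₂ 0 p) = h₂ p by
        rw [induced.extend_single, pow_zero, one_smul]]
      refine DFunLike.congr_fun (induced.eq_of_commute (f := φ.hom.toAddMonoidHom.comp h₂)
        (g := g.hom.toAddMonoidHom.comp ((induced.single e 0 X₁ 0).comp
          (induced.single e 1 X₂ 0))) (fun p => ?_) (fun p => ?_) fun p => ?_) p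
      · change φ.hom (h₂ _) = _ • φ.hom (h₂ _)
        rw [x22, map_smul]
      · change g.hom (induced.single e 0 X₁ 0 (induced.single e 1 X₂ 0 _)) = _ • g.hom _
        rw [s1, s0 2 (by decide), map_smul]
        rfl
      change φ.hom (h₂ _) = g.hom _
      rw [show h₂ (induced.single e 2 X 0 p) = h p by
        rw [induced.extend_single, pow_zero, one_smul]; rfl]
      exact LinearMap.congr_fun hh p

include e in
-- Induction is exact, so each removal of one induced variable through `shortExact` raises the
-- projective dimension by at most one, starting from the projective module with three of them. The
-- indices are strict bounds: 1 means projective and 4 means dimension at most 3.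
theorem hasProjectiveDimensionLE (X : ModuleCat.{u} A) : HasProjectiveDimensionLE X 3 := by
  have h0 : ∀ X, HasProjectiveDimensionLT (induced e 0 (induced e 1 (induced e 2 X))) 1 :=
    fun X => have := projective_induced e X; inferInstance
  have h0' : ∀ X, HasProjectiveDimensionLT (induced e 0 (induced e 1 (induced e 2 X))) 2 :=
    fun X => have := h0 X; hasProjectiveDimensionLT_of_ge _ 1 2 (by omega)
  have h1 : ∀ X, HasProjectiveDimensionLT (induced e 0 (induced e 1 X)) 2 := fun X =>
    (induced.map_shortExact e 0 (induced.map_shortExact e 1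
      (induced.shortExact e 2 X))).hasProjectiveDimensionLT_X₃ 1 (h0 _) (h0' _)
  have h1' : ∀ X, HasProjectiveDimensionLT (induced e 0 (induced e 1 X)) 3 :=
    fun X => have := h1 X; hasProjectiveDimensionLT_of_ge _ 2 3 (by omega)
  have h2 : ∀ X, HasProjectiveDimensionLT (induced e 0 X) 3 := fun X =>
    (induced.map_shortExact e 0 (induced.shortExact e 1 X)).hasProjectiveDimensionLT_X₃ 2 (h1 _)
      (h1' _)
  have h2' : ∀ X, HasProjectiveDimensionLT (induced e 0 X) 4 :=
    fun X => have := h2 X; hasProjectiveDimensionLT_of_ge _ 3 4 (by omega)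
  exact (induced.shortExact e 0 X).hasProjectiveDimensionLT_X₃ 3 (h2 _) (h2' _)

include e in
theorem leftGlobalDimension_le : leftGlobalDimension A ≤ 3 :=
  iSup_le fun X => (projectiveDimension_le_iff X 3).2 (hasProjectiveDimensionLE e X)

end SkewPoly

end GlobalDimensionBound

/-! ### The monomial basis of the skew polynomial algebra -/

namespace SkewPoly

section Monomials

variable {k : Type u} [Field k]

/-- The automorphism of the polynomial ring changing the sign of the variables before `X i`. -/
noncomputable def signChange (i : Fin 3) :
    MvPolynomial (Fin 3) k →ₐ[k] MvPolynomial (Fin 3) k :=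
  MvPolynomial.aeval fun j => if j < i then -MvPolynomial.X j else MvPolynomial.X j

theorem signChange_X (i j : Fin 3) : signChange (k := k) i (MvPolynomial.X j) =
    if j < i then -MvPolynomial.X j else MvPolynomial.X j := MvPolynomial.aeval_X ..

theorem signChange_comm (i j : Fin 3) (p : MvPolynomial (Fin 3) k) :
    signChange i (signChange j p) = signChange j (signChange i p) := by
  refine DFunLike.congr_fun (MvPolynomial.algHom_ext (f := (signChange i).comp (signChange j))
    (g := (signChange j).comp (signChange i)) fun l => ?_) p
  simp only [AlgHom.comp_apply, signChange_X]
  split_ifs <;> simp only [map_neg, signChange_X, if_pos, *] <;> simp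

theorem signChange_signChange (i : Fin 3) (p : MvPolynomial (Fin 3) k) :
    signChange i (signChange i p) = p := by
  refine DFunLike.congr_fun (MvPolynomial.algHom_ext (f := (signChange i).comp (signChange i))
    (g := AlgHom.id k _) fun l => ?_) p
  simp only [AlgHom.comp_apply, signChange_X]
  split_ifs <;> simp only [map_neg, signChange_X, if_pos, *] <;> simp

/-- The representation of the skew polynomial algebra on the polynomial ring. -/
noncomputable def polyRep : SkewPoly k →ₐ[k] Module.End k (MvPolynomial (Fin 3) k) :=
  lift (fun i => LinearMap.mulLeft k (MvPolynomial.X i) ∘ₗ (signChange i).toLinearMap)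
    fun i j h => by
      refine LinearMap.ext fun p => ?_
      simp only [LinearMap.add_apply, Module.End.mul_apply, LinearMap.comp_apply,
        LinearMap.mulLeft_apply, AlgHom.toLinearMap_apply, map_mul, signChange_X,
        signChange_comm j i, LinearMap.zero_apply]
      rcases lt_or_gt_of_ne h with h | h
      · rw [if_neg (not_lt.2 h.le), if_pos h]; ring
      · rw [if_neg (not_lt.2 h.le), if_pos h]; ring

/-- The polynomial with the same coefficients with respect to ordered monomials. -/
noncomputable def toPoly : SkewPoly k →ₗ[k] MvPolynomial (Fin 3) k :=
  (LinearMap.applyₗ (1 : MvPolynomial (Fin 3) k)).comp polyRep.toLinearMap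

theorem toPoly_one : toPoly (1 : SkewPoly k) = 1 := by
  change polyRep (1 : SkewPoly k) 1 = 1
  rw [map_one polyRep]; rfl

theorem toPoly_x_mul (i : Fin 3) (a : SkewPoly k) :
    toPoly (x k i * a) = MvPolynomial.X i * signChange i (toPoly a) := by
  change polyRep (x k i * a) 1 = _
  rw [map_mul, polyRep, lift_x]; rfl

theorem toPoly_x_sq_mul (i : Fin 3) (a : SkewPoly k) :
    toPoly (x k i ^ 2 * a) = MvPolynomial.X i ^ 2 * toPoly a := by
  rw [pow_two, mul_assoc, toPoly_x_mul, toPoly_x_mul, map_mul, signChange_X, if_neg (lt_irrefl i),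
    signChange_signChange]
  ring

/-- The linear map to the skew polynomial algebra preserving ordered monomials. -/
noncomputable def ofPoly : MvPolynomial (Fin 3) k →ₗ[k] SkewPoly k :=
  (MvPolynomial.basisMonomials (Fin 3) k).constr k fun m =>
    x k 0 ^ m 0 * (x k 1 ^ m 1 * x k 2 ^ m 2)

theorem ofPoly_monomial (m : Fin 3 →₀ ℕ) :
    ofPoly (MvPolynomial.monomial m (1 : k)) = x k 0 ^ m 0 * (x k 1 ^ m 1 * x k 2 ^ m 2) := by
  have h : (MvPolynomial.basisMonomials (Fin 3) k) m = MvPolynomial.monomial m (1 : k) := by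
    rw [MvPolynomial.coe_basisMonomials]
  rw [← h, ofPoly, Module.Basis.constr_basis]

theorem x_mul_x_pow {i j : Fin 3} (h : i ≠ j) (n : ℕ) :
    x k i * x k j ^ n = (-1 : k) ^ n • (x k j ^ n * x k i) := by
  induction n with
  | zero => simp
  | succ n ih =>
    rw [pow_succ (x k j), ← mul_assoc, ih, smul_mul_assoc, mul_assoc, mul_assoc,
      eq_neg_of_add_eq_zero_left (x_anticomm h), pow_succ]
    simp

theorem signChange_monomial (i : Fin 3) (m : Fin 3 →₀ ℕ) :
    signChange i (MvPolynomial.monomial m (1 : k)) =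
      (∏ j, if j < i then (-1 : k) ^ m j else 1) • MvPolynomial.monomial m 1 := by
  rw [signChange, MvPolynomial.aeval_monomial, map_one, one_mul, MvPolynomial.monomial_eq,
    map_one, one_mul, Finsupp.prod_fintype _ _ fun _ => pow_zero _,
    Finsupp.prod_fintype _ _ fun _ => pow_zero _, Algebra.smul_def, map_prod,
    ← Finset.prod_mul_distrib]
  refine Finset.prod_congr rfl fun j _ => ?_
  split_ifs
  · rw [neg_pow]; simp
  · simp

/-- Putting x_i into its place in an ordered monomial moves it past the powers of the x_j with j <
i, and the signs produced are those of `signChange i`. -/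
theorem ofPoly_X_mul (i : Fin 3) (p : MvPolynomial (Fin 3) k) :
    ofPoly (MvPolynomial.X i * signChange i p) = x k i * ofPoly p := by
  refine DFunLike.congr_fun ((MvPolynomial.basisMonomials (Fin 3) k).ext
    (f₁ := ofPoly ∘ₗ LinearMap.mulLeft k (MvPolynomial.X i) ∘ₗ (signChange i).toLinearMap)
    (f₂ := LinearMap.mulLeft k (x k i) ∘ₗ ofPoly) fun m => ?_) p
  simp only [LinearMap.comp_apply, LinearMap.mulLeft_apply, AlgHom.toLinearMap_apply,
    MvPolynomial.coe_basisMonomials, signChange_monomial, map_smul,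
    MvPolynomial.X, MvPolynomial.monomial_mul, one_mul, ofPoly_monomial, Fin.prod_univ_three]
  fin_cases i
  · simp [pow_add, mul_assoc]
  · simp only [Finsupp.add_apply, Finsupp.single_apply]
    simp [pow_add, ← mul_assoc, x_mul_x_pow (k := k) (i := 1) (j := 0) (by decide)]
  · simp only [Finsupp.add_apply, Finsupp.single_apply]
    simp [pow_add, ← mul_assoc, x_mul_x_pow (k := k) (i := 2) (j := 0) (by decide)]
    rw [mul_assoc (x k 0 ^ m 0) (x k 2), x_mul_x_pow (k := k) (i := 2) (j := 1) (by decide)]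
    simp [mul_assoc, mul_smul]

theorem ofPoly_toPoly (a : SkewPoly k) : ofPoly (toPoly a) = a := by
  induction a using induction_x with
  | one =>
    rw [toPoly_one, ← MvPolynomial.C_1, MvPolynomial.C_apply, ofPoly_monomial]
    simp
  | smul c a h => rw [map_smul, map_smul, h]
  | add a b ha hb => rw [map_add, map_add, ha, hb]
  | x_mul i a h => rw [toPoly_x_mul, ofPoly_X_mul, h]

theorem toPoly_injective : Function.Injective (toPoly (k := k)) :=
  Function.LeftInverse.injective ofPoly_toPoly

instance : Nontrivial (SkewPoly k) :=
  ⟨0, 1, fun h => by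
    have := congrArg toPoly h
    rw [map_zero, toPoly_one] at this
    exact zero_ne_one this⟩

/-- Under the injective map `toPoly`, left multiplication by x_i becomes an automorphism followed by
multiplication by X_i in a domain. -/
theorem eq_zero_of_x_mul {i : Fin 3} {a : SkewPoly k} (h : x k i * a = 0) : a = 0 := by
  have h1 := toPoly_x_mul i a
  rw [h, map_zero, eq_comm, mul_eq_zero] at h1
  have h2 := h1.resolve_left (MvPolynomial.X_ne_zero i)
  apply toPoly_injective
  rw [map_zero, ← signChange_signChange i (toPoly a), h2, map_zero]

end Monomials

/-! ### Normality of the generators, and division by them -/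

section Kill

variable {k : Type u} [Field k]

/-- The automorphism `x_j ↦ x_j`, `x_i ↦ -x_i` for `i ≠ j`. -/
def conj (j : Fin 3) : SkewPoly k →ₐ[k] SkewPoly k :=
  lift (fun i => if i = j then x k i else -x k i) fun i l h => by
    have := x_anticomm (k := k) h
    split_ifs <;> simp [← neg_add, this]

theorem x_mul_eq (j : Fin 3) (a : SkewPoly k) : x k j * a = conj j a * x k j := by
  induction a using induction_x with
  | one => simp
  | smul c a h => rw [map_smul, mul_smul_comm, h, smul_mul_assoc]
  | add a b ha hb => rw [map_add, mul_add, ha, hb, add_mul]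
  | x_mul i a h =>
    rw [map_mul, mul_assoc, ← h, conj, lift_x]
    split_ifs with hij
    · rw [hij]
    · rw [← mul_assoc, ← mul_assoc, neg_mul, eq_neg_of_add_eq_zero_left (x_anticomm (Ne.symm hij))]

theorem mul_x_eq (j : Fin 3) (a : SkewPoly k) : a * x k j = x k j * conj j a := by
  induction a using induction_x with
  | one => simp
  | smul c a h => rw [map_smul, mul_smul_comm, ← h, smul_mul_assoc]
  | add a b ha hb => rw [map_add, add_mul, ha, hb, mul_add]
  | x_mul i a h =>
    rw [map_mul, mul_assoc, h, conj, lift_x]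
    split_ifs with hij
    · rw [hij]
    · rw [← mul_assoc, ← mul_assoc, mul_neg, eq_neg_of_add_eq_zero_left (x_anticomm hij)]

theorem conj_conj (j : Fin 3) (a : SkewPoly k) : conj j (conj j a) = a := by
  refine DFunLike.congr_fun (algHom_ext (f := (conj j).comp (conj j)) (g := AlgHom.id k _)
    fun i => ?_) a
  rw [AlgHom.comp_apply, conj, lift_x]
  split_ifs with h
  · rw [lift_x, if_pos h]; rfl
  · rw [map_neg, lift_x, if_neg h, neg_neg]; rfl

theorem eq_zero_of_mul_x {i : Fin 3} {a : SkewPoly k} (h : a * x k i = 0) : a = 0 := by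
  rw [mul_x_eq] at h
  rw [← conj_conj i a, eq_zero_of_x_mul h, map_zero]

/-- The endomorphism sending the generators `x_i` with `i ∈ S` to zero. -/
def kill (S : Finset (Fin 3)) : SkewPoly k →ₐ[k] SkewPoly k :=
  lift (fun i => if i ∈ S then 0 else x k i) fun i l h => by
    have := x_anticomm (k := k) h
    split_ifs <;> simp [this]

theorem kill_x (S : Finset (Fin 3)) (i : Fin 3) :
    kill S (x k i) = if i ∈ S then 0 else x k i := lift_x ..

theorem kill_insert (S : Finset (Fin 3)) (j : Fin 3) (a : SkewPoly k) :
    kill (insert j S) a = kill S (kill {j} a) := by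
  refine DFunLike.congr_fun (algHom_ext (f := kill (insert j S))
    (g := (kill S).comp (kill {j})) fun i => ?_) a
  rw [AlgHom.comp_apply, kill_x, kill_x]
  by_cases h : i = j
  · simp [h]
  · simp [h, kill_x]

theorem kill_empty (a : SkewPoly k) : kill ∅ a = a := by
  refine DFunLike.congr_fun (algHom_ext (f := kill ∅) (g := AlgHom.id k _) fun i => ?_) a
  rw [kill_x]; rfl

/-- Division with remainder by x_j: `kill {j}` gives the part without x_j, and a left factor x_j can
be moved to the right at the cost of `conj j`. -/
theorem exists_eq_kill_add (j : Fin 3) (a : SkewPoly k) : ∃ b, a = kill {j} a + b * x k j := by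
  induction a using induction_x with
  | one => exact ⟨0, by simp⟩
  | smul c a h =>
    obtain ⟨b, h⟩ := h
    exact ⟨c • b, by rw [map_smul, smul_mul_assoc, ← smul_add, ← h]⟩
  | add a b ha hb =>
    obtain ⟨a', ha⟩ := ha
    obtain ⟨b', hb⟩ := hb
    exact ⟨a' + b', by rw [map_add, add_mul, add_add_add_comm, ← ha, ← hb]⟩
  | x_mul i a h =>
    by_cases hij : i = j
    · exact ⟨conj j a, by rw [map_mul, kill_x, hij, if_pos (Finset.mem_singleton_self j), zero_mul,
        zero_add, x_mul_eq]⟩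
    · obtain ⟨b, h⟩ := h
      refine ⟨x k i * b, ?_⟩
      rw [map_mul, kill_x, if_neg (by simpa using hij), mul_assoc, ← mul_add, ← h]

end Kill

end SkewPoly

/-! ### The Gorenstein property of the skew polynomial algebra -/

section TransportPresentation

open Abelian

variable {k A : Type u} [Field k] [Ring A] [Algebra k A]

theorem ExtPresentation.of_iso {V : Type u} [AddCommGroup V] [Module k V]
    {X X' Y : ModuleCat.{u} A} {n : ℕ} {π : V →ₗ[k] Ext X Y n} {K : Submodule k V}
    (h : ExtPresentation π K) (i : X' ≅ X) :
    ExtPresentation ((Ext.mk₀ i.hom).precompOfLinear k Y (zero_add n) ∘ₗ π) K := by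
  have key : ∀ {n : ℕ} (x : Ext X' Y n),
      (Ext.mk₀ i.hom).comp ((Ext.mk₀ i.inv).comp x (zero_add n)) (zero_add n) = x := fun {n} x => by
    rw [← Ext.comp_assoc _ _ _ (zero_add 0) (zero_add n) (by omega), Ext.mk₀_comp_mk₀,
      i.hom_inv_id, Ext.mk₀_id_comp]
  have key' : ∀ {n : ℕ} (x : Ext X Y n),
      (Ext.mk₀ i.inv).comp ((Ext.mk₀ i.hom).comp x (zero_add n)) (zero_add n) = x := fun {n} x => by
    rw [← Ext.comp_assoc _ _ _ (zero_add 0) (zero_add n) (by omega), Ext.mk₀_comp_mk₀,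
      i.inv_hom_id, Ext.mk₀_id_comp]
  refine ⟨fun x => ?_, ?_, fun m hm => ?_⟩
  · obtain ⟨v, hv⟩ := h.surjective ((Ext.mk₀ i.inv).comp x (zero_add n))
    exact ⟨v, (congrArg (fun y => (Ext.mk₀ i.hom).comp y (zero_add n)) hv).trans (key x)⟩
  · rw [← h.ker_eq]
    ext v
    rw [LinearMap.mem_ker, LinearMap.mem_ker]
    constructor
    · intro hv
      rw [← key' (π v)]
      refine (congrArg (fun y => (Ext.mk₀ i.inv).comp y (zero_add n)) hv).trans ?_
      exact Ext.comp_zero ..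
    · intro hv
      rw [LinearMap.comp_apply, hv, map_zero]
  · have := h.subsingleton m hm
    refine ⟨fun x y => ?_⟩
    rw [← key x, ← key y, Subsingleton.elim ((Ext.mk₀ i.inv).comp x (zero_add m))]

end TransportPresentation

namespace SkewPoly

section Koszul

open Abelian

variable {k A : Type u} [Field k] [Ring A] [Algebra k A] (e : SkewPoly k ≃ₐ[k] A)

/-- The ideal generated by the `x_i` with `i ∈ S`. -/
def killIdeal (S : Finset (Fin 3)) : Ideal A :=
  RingHom.ker ((kill S).comp e.symm.toAlgHom : A →ₐ[k] SkewPoly k)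

theorem mem_killIdeal {S : Finset (Fin 3)} {a : A} :
    a ∈ killIdeal e S ↔ kill S (e.symm a) = 0 := Iff.rfl

/-- `kill S` fixes x_j for j outside `S`, and x_j is not a zero divisor. So x_j is regular modulo
the ideal, on the right here and on the left in the next lemma. -/
theorem mul_x_mem_killIdeal_iff {S : Finset (Fin 3)} {j : Fin 3} (hj : j ∉ S) {a : A} :
    a * e (x k j) ∈ killIdeal e S ↔ a ∈ killIdeal e S := by
  rw [mem_killIdeal, mem_killIdeal, map_mul, e.symm_apply_apply, map_mul, kill_x, if_neg hj]
  exact ⟨eq_zero_of_mul_x, fun h => by rw [h, zero_mul]⟩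

theorem x_mul_mem_killIdeal_iff {S : Finset (Fin 3)} {j : Fin 3} (hj : j ∉ S) {a : A} :
    e (x k j) * a ∈ killIdeal e S ↔ a ∈ killIdeal e S := by
  rw [mem_killIdeal, mem_killIdeal, map_mul, e.symm_apply_apply, map_mul, kill_x, if_neg hj]
  exact ⟨eq_zero_of_x_mul, fun h => by rw [h, mul_zero]⟩

theorem mul_mem_killIdeal {S : Finset (Fin 3)} {a : A} (ha : a ∈ killIdeal e S) (b : A) :
    a * b ∈ killIdeal e S := by
  rw [mem_killIdeal, map_mul, map_mul, (mem_killIdeal e).1 ha, zero_mul]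

theorem killIdeal_le_insert (S : Finset (Fin 3)) (j : Fin 3) :
    killIdeal e S ≤ killIdeal e (insert j S) := by
  intro a ha
  obtain ⟨b, hb⟩ := exists_eq_kill_add j (e.symm a)
  have h := (mem_killIdeal e).1 ha
  rw [mem_killIdeal, kill_insert]
  have h2 : kill (insert j S) (kill S (e.symm a)) = kill S (kill {j} (e.symm a)) := by
    refine DFunLike.congr_fun (algHom_ext (f := (kill (insert j S)).comp (kill S))
      (g := (kill S).comp (kill {j})) fun i => ?_) _
    rw [AlgHom.comp_apply, AlgHom.comp_apply, kill_x, kill_x]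
    by_cases hij : i = j
    · subst hij; by_cases hi : i ∈ S <;> simp [hi, kill_x]
    · by_cases hi : i ∈ S <;> simp [hi, hij, kill_x]
  rw [← h2, h, map_zero]

theorem x_mem_killIdeal {S : Finset (Fin 3)} {j : Fin 3} (hj : j ∈ S) :
    e (x k j) ∈ killIdeal e S := by
  rw [mem_killIdeal, e.symm_apply_apply, kill_x, if_pos hj]

theorem exists_add_mul_x {S : Finset (Fin 3)} {j : Fin 3} {a : A}
    (ha : a ∈ killIdeal e (insert j S)) : ∃ b ∈ killIdeal e S, ∃ c, a = b + c * e (x k j) := by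
  obtain ⟨c, hc⟩ := exists_eq_kill_add j (e.symm a)
  refine ⟨e (kill {j} (e.symm a)), ?_, e c, ?_⟩
  · rw [mem_killIdeal, e.symm_apply_apply, ← kill_insert, (mem_killIdeal e).1 ha]
  · rw [← map_mul, ← map_add, ← hc, e.apply_symm_apply]

theorem exists_mul_x_eq (j : Fin 3) (a : A) : ∃ b, a * e (x k j) = e (x k j) * b :=
  ⟨e (conj j (e.symm a)), by rw [← map_mul, ← mul_x_eq, map_mul, e.apply_symm_apply]⟩

/-- The left module `A / (x_i, i ∈ S)`. -/
def quotient (S : Finset (Fin 3)) : ModuleCat.{u} A := ModuleCat.of A (A ⧸ killIdeal e S)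

/-- The class of an element in `A / (x_i, i ∈ S)`. -/
def quotientMk (S : Finset (Fin 3)) : A →ₗ[A] quotient e S := (killIdeal e S).mkQ

theorem quotientMk_surjective (S : Finset (Fin 3)) : Function.Surjective (quotientMk e S) :=
  (killIdeal e S).mkQ_surjective

theorem quotientMk_eq_zero {S : Finset (Fin 3)} {a : A} :
    quotientMk e S a = 0 ↔ a ∈ killIdeal e S := Submodule.Quotient.mk_eq_zero _

theorem quotient_hom_ext {S : Finset (Fin 3)} {Y : ModuleCat.{u} A} {f g : quotient e S ⟶ Y}
    (h : ∀ a, f.hom (quotientMk e S a) = g.hom (quotientMk e S a)) : f = g :=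
  ModuleCat.hom_ext (Submodule.linearMap_qext _ (LinearMap.ext h))

/-- Right multiplication by `x_j` on `A / (x_i, i ∈ S)`. -/
def quotientMul (S : Finset (Fin 3)) (j : Fin 3) : quotient e S ⟶ quotient e S :=
  ModuleCat.ofHom ((killIdeal e S).mapQ (killIdeal e S) (LinearMap.toSpanSingleton A A (e (x k j)))
    fun _ ha => mul_mem_killIdeal e ha _)

theorem quotientMul_mk (S : Finset (Fin 3)) (j : Fin 3) (a : A) :
    (quotientMul e S j).hom (quotientMk e S a) = quotientMk e S (a * e (x k j)) := rfl

/-- The projection `A / (x_i, i ∈ S) ⟶ A / (x_j, x_i, i ∈ S)`. -/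
def quotientProj (S : Finset (Fin 3)) (j : Fin 3) : quotient e S ⟶ quotient e (insert j S) :=
  ModuleCat.ofHom (Submodule.factor (killIdeal_le_insert e S j))

theorem quotientProj_mk (S : Finset (Fin 3)) (j : Fin 3) (a : A) :
    (quotientProj e S j).hom (quotientMk e S a) = quotientMk e (insert j S) a := rfl

theorem quotientMul_proj (S : Finset (Fin 3)) (j : Fin 3) :
    quotientMul e S j ≫ quotientProj e S j = 0 := by
  refine quotient_hom_ext e fun a => ?_
  rw [ModuleCat.hom_comp, LinearMap.comp_apply, quotientMul_mk, quotientProj_mk]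
  exact (quotientMk_eq_zero e).2
    (Ideal.mul_mem_left _ _ (x_mem_killIdeal e (Finset.mem_insert_self j S)))

/-- Multiplication by `x_j` on `A / (x_i, i ∈ S)`, with its cokernel. -/
def quotientComplex (S : Finset (Fin 3)) (j : Fin 3) : ShortComplex (ModuleCat.{u} A) :=
  ShortComplex.mk (quotientMul e S j) (quotientProj e S j) (quotientMul_proj e S j)

theorem quotientComplex_shortExact {S : Finset (Fin 3)} {j : Fin 3} (hj : j ∉ S) :
    (quotientComplex e S j).ShortExact := by
  refine ModuleCat.shortComplex_shortExact _ (fun p => ⟨fun hp => ?_, ?_⟩) ?_ ?_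
  · obtain ⟨a, rfl⟩ := quotientMk_surjective e S p
    have ha : a ∈ killIdeal e (insert j S) := (quotientMk_eq_zero e).1 hp
    obtain ⟨b, hb, c, rfl⟩ := exists_add_mul_x e ha
    refine ⟨quotientMk e S c, (quotientMul_mk e S j c).trans ?_⟩
    rw [map_add, (quotientMk_eq_zero e).2 hb]
    exact (zero_add _).symm
  · rintro ⟨q, rfl⟩
    exact congrArg (fun f => f.hom q) (quotientMul_proj e S j)
  · refine (injective_iff_map_eq_zero (quotientMul e S j).hom).2 fun p hp => ?_
    obtain ⟨a, rfl⟩ := quotientMk_surjective e S p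
    rw [quotientMul_mk, quotientMk_eq_zero, mul_x_mem_killIdeal_iff e hj] at hp
    exact (quotientMk_eq_zero e).2 hp
  · exact Submodule.factor_surjective (killIdeal_le_insert e S j)

theorem quotientMul_anticomm (S : Finset (Fin 3)) {i j : Fin 3} (hij : i ≠ j) :
    (-quotientMul e S i) ≫ quotientMul e S j = quotientMul e S j ≫ quotientMul e S i := by
  refine quotient_hom_ext e fun a => ?_
  rw [ModuleCat.hom_comp, LinearMap.comp_apply, ModuleCat.hom_comp, LinearMap.comp_apply,
    ModuleCat.hom_neg, LinearMap.neg_apply, map_neg, quotientMul_mk, quotientMul_mk, quotientMul_mk,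
    quotientMul_mk, ← map_neg, mul_assoc, mul_assoc, equiv_x_anticomm e hij, mul_neg, neg_neg]

theorem quotientMul_proj_comm (S : Finset (Fin 3)) (i j : Fin 3) :
    quotientMul e S i ≫ quotientProj e S j = quotientProj e S j ≫ quotientMul e (insert j S) i := by
  refine quotient_hom_ext e fun a => ?_
  rw [ModuleCat.hom_comp, LinearMap.comp_apply, ModuleCat.hom_comp, LinearMap.comp_apply,
    quotientMul_mk, quotientProj_mk, quotientProj_mk, quotientMul_mk]

/-- Right multiplication by `x_i` as an endomorphism of the short exact sequence given by `x_j`. -/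
def quotientComplexMul (S : Finset (Fin 3)) {i j : Fin 3} (hij : i ≠ j) :
    quotientComplex e S j ⟶ quotientComplex e S j where
  -- The sign compensates for exchanging x_i and x_j in the square with the multiplication by x_j.
  τ₁ := -quotientMul e S i
  τ₂ := quotientMul e S i
  τ₃ := quotientMul e (insert j S) i
  comm₁₂ := quotientMul_anticomm e S hij
  comm₂₃ := quotientMul_proj_comm e S i j

variable {e} in
/-- `Ext*(A / (x_i, i ∈ S), A)` is presented by `A → Extⁿ(A / (x_i, i ∈ S), A)`, and the right
multiplications with the other generators induce the left multiplications up to the sign `ε`. -/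
structure QuotientPresentation (S : Finset (Fin 3)) (n : ℕ) (ε : k)
    (π : A →ₗ[k] Ext (quotient e S) (ModuleCat.of A A) n) : Prop extends
    ExtPresentation π ((killIdeal e S).restrictScalars k) where
  comp_eq : ∀ i ∉ S, ∀ a, (Ext.mk₀ (quotientMul e S i)).comp (π a) (zero_add n) =
    π (ε • (e (x k i) * a))

theorem exists_presentation_empty :
    ∃ π, QuotientPresentation (e := e) ∅ 0 1 π := by
  have h0 : killIdeal e ∅ = ⊥ := by
    ext a
    rw [mem_killIdeal, kill_empty, Ideal.mem_bot, map_eq_zero_iff _ e.symm.injective]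
  have hI : (killIdeal e ∅).restrictScalars k = ⊥ := by rw [h0]; rfl
  let i : quotient e ∅ ≅ ModuleCat.of A A :=
    (Submodule.quotEquivOfEqBot _ h0).toModuleIso
  refine ⟨(Ext.mk₀ i.hom).precompOfLinear k _ (zero_add 0) ∘ₗ extSelf k A, ⟨?_, fun j _ a => ?_⟩⟩
  · rw [hI]
    exact (extSelf_presentation (k := k) (A := A)).of_iso i
  · change (Ext.mk₀ _).comp ((Ext.mk₀ i.hom).comp (extSelf k A a) (zero_add 0)) (zero_add 0) =
      (Ext.mk₀ i.hom).comp (extSelf k A _) (zero_add 0)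
    rw [one_smul, ← comp_extSelf, ← Ext.comp_assoc _ _ _ (zero_add 0) (zero_add 0) (by omega),
      ← Ext.comp_assoc _ _ _ (zero_add 0) (zero_add 0) (by omega), Ext.mk₀_comp_mk₀,
      Ext.mk₀_comp_mk₀]
    congr 2
    exact quotient_hom_ext e fun b => rfl

/-- One step of the Koszul computation. In 0 → A/I → A/I → A/(I, x_j) → 0 the first map induces ε
times left multiplication by x_j on the presenting space. It is injective modulo I, so the Ext of
the cokernel sits one degree higher and is presented by A/(I + x_j A). The connecting map
intertwines right multiplication by x_i on A/(I, x_j) with minus that on A/I, whence the change of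
sign of ε. -/
theorem exists_presentation_insert {S : Finset (Fin 3)} {j : Fin 3} (hj : j ∉ S) {n : ℕ} {ε : k}
    (hε : ε ≠ 0) (h : ∃ π, QuotientPresentation (e := e) S n ε π) :
    ∃ π, QuotientPresentation (e := e) (insert j S) (n + 1) (-ε) π := by
  obtain ⟨π, h⟩ := h
  have hS := quotientComplex_shortExact e hj
  let φ (i : Fin 3) : A →ₗ[k] A := ε • LinearMap.mulLeft k (e (x k i))
  have hφ : ∀ i a, φ i a = ε • (e (x k i) * a) := fun _ _ => rfl
  refine ⟨hS.extClass.precompOfLinear k _ (add_comm 1 n) ∘ₗ π, ⟨?_, fun i hi a => ?_⟩⟩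
  · have := ExtPresentation.of_shortExact hS h.toExtPresentation h.toExtPresentation (φ j)
      (h.comp_eq j hj) (fun a ha => by
        have ha' : ε⁻¹ • φ j a ∈ (killIdeal e S).restrictScalars k := Submodule.smul_mem _ _ ha
        rw [hφ, smul_smul, inv_mul_cancel₀ hε, one_smul] at ha'
        exact (x_mul_mem_killIdeal_iff e hj).1 ha')
    suffices hI : (killIdeal e (insert j S)).restrictScalars k =
        (killIdeal e S).restrictScalars k ⊔ LinearMap.range (φ j) by
      rw [hI]
      exact this
    refine le_antisymm (fun a ha => ?_) (sup_le (killIdeal_le_insert e S j) ?_)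
    · obtain ⟨b, hb, c, rfl⟩ := exists_add_mul_x e (Submodule.restrictScalars_mem k _ _ |>.1 ha)
      -- Normality of x_j identifies the left multiples `c * e (x k j)` in the ideal with the right
      -- multiples in the range of `φ j`.
      obtain ⟨c', hc'⟩ := exists_mul_x_eq e j c
      refine Submodule.add_mem_sup hb ⟨ε⁻¹ • c', ?_⟩
      rw [map_smul, hφ, smul_smul, inv_mul_cancel₀ hε, one_smul, hc']
    · rintro _ ⟨a, rfl⟩
      exact Submodule.smul_mem _ _
        (mul_mem_killIdeal e (x_mem_killIdeal e (Finset.mem_insert_self j S)) a)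
  · have hij : i ≠ j := fun h => hi (h ▸ Finset.mem_insert_self i S)
    have hiS : i ∉ S := fun h => hi (Finset.mem_insert_of_mem h)
    have key : ∀ v, (Ext.mk₀ (-quotientMul e S i)).comp (π v) (zero_add n) = π ((-φ i) v) := by
      intro v
      rw [Ext.mk₀_neg, Ext.neg_comp, h.comp_eq i hiS, LinearMap.neg_apply, map_neg, hφ]
    refine (ExtPresentation.comp_extClass hS (quotientComplexMul e S hij) (-φ i) key a).trans ?_
    rw [LinearMap.neg_apply, hφ, neg_smul]
    rfl

theorem exists_presentation_univ :
    ∃ π, QuotientPresentation (e := e) Finset.univ 3 (-1) π := by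
  have h0 := exists_presentation_empty e
  have h1 := exists_presentation_insert e (j := 0) (by decide) one_ne_zero h0
  have h2 := exists_presentation_insert e (j := 1) (by decide) (neg_ne_zero.2 one_ne_zero) h1
  have h3 := exists_presentation_insert e (j := 2) (by decide) (by simp) h2
  have hU : insert 2 (insert 1 (insert 0 ∅)) = (Finset.univ : Finset (Fin 3)) := by decide
  rw [neg_neg, hU] at h3
  exact h3

variable (ε : A →ₐ[k] k) (hε : ∀ i, ε (e (x k i)) = 0)

include hε in
theorem killIdeal_univ : killIdeal e Finset.univ = RingHom.ker ε := by
  ext a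
  obtain ⟨a, rfl⟩ := e.surjective a
  rw [mem_killIdeal, e.symm_apply_apply, RingHom.mem_ker]
  have h : algebraMap k (SkewPoly k) (ε (e a)) = kill Finset.univ a := by
    refine DFunLike.congr_fun (algHom_ext (f := (Algebra.ofId k (SkewPoly k)).comp
      (ε.comp e.toAlgHom)) (g := kill Finset.univ) fun i => ?_) a
    rw [kill_x, if_pos (Finset.mem_univ i)]
    exact (congrArg (algebraMap k (SkewPoly k)) (hε i)).trans (map_zero _)
  rw [← h, map_eq_zero_iff _ (algebraMap k (SkewPoly k)).injective]

end Koszul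

end SkewPoly

/-! ### Ext of the trivial module over the skew polynomial algebra, and the exact global dimension
-/

section Augmentation

open Abelian

variable {k A : Type u} [Field k] [Ring A] [Algebra k A]

/-- The trivial module given by an augmentation. -/
def augmentationModule (ε : A →ₐ[k] k) : ModuleCat.{u} A := ModuleCat.of A (A ⧸ RingHom.ker ε)

theorem rank_quotient_ker_augmentation (ε : A →ₐ[k] k) :
    Module.rank k (A ⧸ (RingHom.ker ε).restrictScalars k) = 1 := by
  have h : (RingHom.ker ε).restrictScalars k = LinearMap.ker ε.toLinearMap := rfl
  rw [h, (LinearMap.quotKerEquivOfSurjective ε.toLinearMap fun c =>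
    ⟨algebraMap k A c, ε.commutes c⟩).rank_eq, Module.rank_self]

namespace SkewPoly

variable (e : SkewPoly k ≃ₐ[k] A) (ε : A →ₐ[k] k) (hε : ∀ i, ε (e (x k i)) = 0)

include hε

theorem exists_presentation_augmentationModule :
    ∃ π : A →ₗ[k] Ext (augmentationModule ε) (ModuleCat.of A A) 3,
      ExtPresentation π ((RingHom.ker ε).restrictScalars k) := by
  have h : ∃ π : A →ₗ[k] Ext (ModuleCat.of A (A ⧸ killIdeal e Finset.univ)) (ModuleCat.of A A) 3,
      ExtPresentation π ((killIdeal e Finset.univ).restrictScalars k) := by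
    obtain ⟨π, h⟩ := exists_presentation_univ e
    exact ⟨π, h.toExtPresentation⟩
  rw [killIdeal_univ e ε hε] at h
  exact h

theorem rank_totalExt_augmentationModule :
    Module.rank k (TotalExt (augmentationModule ε) (ModuleCat.of A A)) = 1 := by
  obtain ⟨π, h⟩ := exists_presentation_augmentationModule e ε hε
  rw [rank_totalExt_of_presentation h, rank_quotient_ker_augmentation]

/-- The lower bound holds because Ext³ of the trivial module with values in A is nonzero: it is
presented as A modulo the kernel of ε, where 1 survives. -/
theorem leftGlobalDimension_eq : leftGlobalDimension A = 3 := by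
  refine le_antisymm (leftGlobalDimension_le e) ?_
  refine le_trans ?_ (le_iSup _ (augmentationModule ε))
  by_contra hlt
  rw [not_le] at hlt
  have := (projectiveDimension_lt_iff (n := 3)).1 hlt
  obtain ⟨π, h⟩ := exists_presentation_augmentationModule e ε hε
  have hs := HasProjectiveDimensionLT.subsingleton (augmentationModule ε) 3 3 le_rfl
    (ModuleCat.of A A)
  have hmem : (1 : A) ∈ LinearMap.ker π := LinearMap.mem_ker.2 (Subsingleton.elim _ _)
  rw [h.ker_eq] at hmem
  have : ε 1 = 0 := hmem
  rw [map_one] at this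
  exact one_ne_zero this

omit hε in
include e in
theorem injectiveDimension_lt : injectiveDimension (ModuleCat.of A A) < ⊤ := by
  have : HasInjectiveDimensionLT (ModuleCat.of A A) 4 :=
    HasInjectiveDimensionLT.mk fun i hi Y x =>
      have := hasProjectiveDimensionLE e Y
      x.eq_zero_of_hasProjectiveDimensionLT 4 hi
  exact (injectiveDimension_lt_iff.2 this).trans (WithBot.coe_lt_coe.2 (ENat.natCast_lt_top 4))

end SkewPoly

end Augmentation

/-! ### Quadratic extensions of a polynomial ring -/

section Divisible

/-- A divisible module over a principal ideal domain is injective. -/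
theorem Module.Baer.of_divisible_of_isPrincipalIdealRing {R M : Type*} [CommRing R]
    [IsPrincipalIdealRing R] [AddCommGroup M] [Module R M]
    (h : ∀ r : R, r ≠ 0 → ∀ m : M, ∃ m', r • m' = m) : Module.Baer R M := by
  intro I g
  obtain ⟨a, rfl⟩ := IsPrincipalIdealRing.principal I
  by_cases ha : a = 0
  · subst ha
    refine ⟨0, fun x hx => ?_⟩
    have : x = 0 := by simpa using hx
    subst this
    exact (map_zero g).symm
  · obtain ⟨m, hm⟩ := h a ha (g ⟨a, Submodule.mem_span_singleton_self a⟩)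
    refine ⟨LinearMap.toSpanSingleton R M m, fun x hx => ?_⟩
    obtain ⟨r, rfl⟩ := Submodule.mem_span_singleton.1 hx
    refine (smul_smul r a m).symm.trans ?_
    rw [hm, ← map_smul]
    rfl

end Divisible

open Polynomial in
/-- `A` is the quadratic extension `k[w] ⊕ k[w] z` of `k[w]`, with `z ^ 2 = κ w`. -/
structure IsQuadratic {k A : Type u} [Field k] [Ring A] [Algebra k A] (κ : k) (w z : A) : Prop where
  comm : w * z = z * w
  sq : z * z = κ • w
  bijective : Function.Bijective fun p : k[X] × k[X] => aeval w p.1 + aeval w p.2 * z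

namespace IsQuadratic

open Polynomial

variable {k A : Type u} [Field k] [Ring A] [Algebra k A] {κ : k} {w z : A}

theorem op (h : IsQuadratic κ w z) : IsQuadratic κ (MulOpposite.op w) (MulOpposite.op z) where
  comm := congrArg MulOpposite.op h.comm.symm
  sq := congrArg MulOpposite.op h.sq
  bijective := by
    have hw : ∀ p : k[X], aeval (MulOpposite.op w) p = MulOpposite.op (aeval w p) := fun p => by
      induction p using Polynomial.induction_on' with
      | add p q hp hq => rw [map_add, map_add, hp, hq, MulOpposite.op_add]
      | monomial n a =>
        rw [aeval_monomial, aeval_monomial, MulOpposite.op_mul, MulOpposite.op_pow,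
          MulOpposite.algebraMap_apply, ← MulOpposite.algebraMap_apply, Algebra.commutes]
    have hz : ∀ p : k[X], Commute (aeval w p) z := fun p => by
      induction p using Polynomial.induction_on' with
      | add p q hp hq => rw [map_add]; exact hp.add_left hq
      | monomial n a =>
        rw [aeval_monomial]
        exact (Algebra.commute_algebraMap_left a z).mul_left (Commute.pow_left h.comm n)
    convert MulOpposite.op_bijective.comp h.bijective using 2 with p
    rw [hw, hw, Function.comp_apply, MulOpposite.op_add, (hz _).eq, MulOpposite.op_mul]

theorem aeval_mul_self (w : A) (p : k[X]) :
    aeval w p * w = w * aeval w p := by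
  have := congrArg (aeval w) (mul_comm p (X : k[X]))
  rwa [map_mul, map_mul, aeval_X] at this

variable (h : IsQuadratic κ w z)

include h

theorem commute_aeval (p : k[X]) : aeval w p * z = z * aeval w p := by
  induction p using Polynomial.induction_on' with
  | add p q hp hq => rw [map_add, add_mul, mul_add, hp, hq]
  | monomial n a =>
    rw [aeval_monomial]
    exact ((Algebra.commute_algebraMap_left a z).mul_left (Commute.pow_left h.comm n)).eq

/-- The coordinates with respect to the basis `1, z` over `k[w]`. -/
noncomputable def coord : A ≃+ k[X] × k[X] :=
  (AddEquiv.ofBijective (AddMonoidHom.mk' _ fun p q => by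
    rw [Prod.fst_add, Prod.snd_add, map_add, map_add, add_mul]
    exact add_add_add_comm ..)
    h.bijective).symm

theorem coord_symm (p q : k[X]) : h.coord.symm (p, q) = aeval w p + aeval w q * z := rfl

theorem coord_eq (p q : k[X]) : h.coord (aeval w p + aeval w q * z) = (p, q) := by
  rw [← coord_symm h, AddEquiv.apply_symm_apply]

theorem exists_eq (a : A) : ∃ p q : k[X], a = aeval w p + aeval w q * z :=
  ⟨(h.coord a).1, (h.coord a).2, by rw [← coord_symm h, Prod.mk.eta, AddEquiv.symm_apply_apply]⟩

theorem coord_aeval_mul (r : k[X]) (a : A) : h.coord (aeval w r * a) = r • h.coord a := by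
  obtain ⟨p, q, rfl⟩ := h.exists_eq a
  rw [mul_add, ← mul_assoc, ← map_mul, ← map_mul, coord_eq, coord_eq, Prod.smul_mk, smul_eq_mul,
    smul_eq_mul]

theorem coord_z_mul (a : A) :
    h.coord (z * a) = (C κ * X * (h.coord a).2, (h.coord a).1) := by
  obtain ⟨p, q, rfl⟩ := h.exists_eq a
  have : z * (aeval w p + aeval w q * z) =
      aeval w (C κ * X * q) + aeval w p * z := by
    rw [mul_add, ← h.commute_aeval p, ← mul_assoc, ← h.commute_aeval q, mul_assoc, h.sq, add_comm,
      map_mul, map_mul, aeval_C, aeval_X, ← Algebra.smul_def, mul_smul_comm, smul_mul_assoc]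
    rw [aeval_mul_self]
  rw [this, coord_eq, coord_eq]

theorem coord_mul_z (a : A) : h.coord (a * z) = h.coord (z * a) := by
  obtain ⟨p, q, rfl⟩ := h.exists_eq a
  congr 1
  rw [add_mul, mul_add, h.commute_aeval, ← mul_assoc z, ← h.commute_aeval q]

theorem mul_w (a : A) : a * w = w * a := by
  obtain ⟨p, q, rfl⟩ := h.exists_eq a
  rw [add_mul, mul_add, mul_assoc, ← h.comm, ← mul_assoc, aeval_mul_self, aeval_mul_self,
    mul_assoc]

theorem coord_w_mul (a : A) : h.coord (w * a) = (X : k[X]) • h.coord a := by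
  rw [← coord_aeval_mul, aeval_X]

omit h in
/-- The ring `A` as a module over `k[w]`. -/
noncomputable abbrev restricted (k : Type u) {A : Type u} [Field k] [Ring A] [Algebra k A] (w : A) :
    ModuleCat.{u} k[X] :=
  (ModuleCat.restrictScalars (aeval (R := k) w).toRingHom).obj (ModuleCat.of A A)

/-- The coordinates as a linear equivalence. -/
noncomputable def coordLinearEquiv : restricted k w ≃ₗ[k[X]] k[X] × k[X] :=
  { h.coord with
    map_smul' := fun r a => h.coord_aeval_mul r a }

theorem restricted_hom_ext {M : Type*} [AddCommGroup M] [Module k[X] M]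
    {f g : restricted k w →ₗ[k[X]] M} (h₁ : f (1 : A) = g (1 : A)) (h₂ : f z = g z) : f = g := by
  refine LinearMap.ext fun a => ?_
  obtain ⟨p, q, hpq⟩ := h.exists_eq a
  have ha : a = p • (show restricted k w from (1 : A)) + q • (show restricted k w from z) := by
    refine hpq.trans ?_
    rw [← mul_one (aeval w p)]
    rfl
  rw [ha, map_add, map_add, map_smul, map_smul, map_smul, map_smul]
  exact congr_arg₂ _ (congrArg _ h₁) (congrArg _ h₂)

/-- A is a Frobenius extension of k[w]: with λ the coefficient of z, the pairing (s, a) ↦ λ(s a)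
identifies A with Hom(A, k[w]) over k[w]. Coextending the injective resolution k[w] → F → F/k[w],
with F the fraction field, gives an injective resolution of A of length 1. Coextension preserves
injectives because it is right adjoint to the exact restriction functor, and it keeps the sequence
exact because A is free over k[w]. -/
theorem hasInjectiveDimensionLE : HasInjectiveDimensionLE (ModuleCat.of A A) 1 := by
  let F := FractionRing k[X]
  let L : Submodule k[X] F := LinearMap.range (Algebra.linearMap k[X] F)
  have hF : ∀ r : k[X], r ≠ 0 → ∀ m : F, ∃ m', r • m' = m := fun r hr m => by
    have hr' : algebraMap k[X] F r ≠ 0 := by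
      rwa [Ne, FaithfulSMul.algebraMap_eq_zero_iff]
    exact ⟨(algebraMap k[X] F r)⁻¹ * m, by rw [Algebra.smul_def, mul_inv_cancel_left₀ hr']⟩
  have hQ : ∀ r : k[X], r ≠ 0 → ∀ m : F ⧸ L, ∃ m', r • m' = m := fun r hr m => by
    obtain ⟨m, rfl⟩ := L.mkQ_surjective m
    obtain ⟨m', rfl⟩ := hF r hr m
    exact ⟨L.mkQ m', (map_smul L.mkQ r m').symm⟩
  let f : k[X] →+* A := (aeval (R := k) w).toRingHom
  let MF := ModuleCat.of k[X] F
  let MQ := ModuleCat.of k[X] (F ⧸ L)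
  have iF : Injective MF :=
    Module.injective_object_of_injective_module _ _
      (inj := (Module.Baer.of_divisible_of_isPrincipalIdealRing hF).injective)
  have iQ : Injective MQ :=
    Module.injective_object_of_injective_module _ _
      (inj := (Module.Baer.of_divisible_of_isPrincipalIdealRing hQ).injective)
  let adj := ModuleCat.restrictCoextendScalarsAdj.{u, u, u} f
  have jF : Injective ((ModuleCat.coextendScalars f).obj MF) :=
    Injective.injective_of_adjoint adj MF
  have jQ : Injective ((ModuleCat.coextendScalars f).obj MQ) :=
    Injective.injective_of_adjoint adj MQ
  let lam : restricted k w →ₗ[k[X]] F := (Algebra.linearMap k[X] F).comp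
      ((LinearMap.snd k[X] k[X] k[X]).comp h.coordLinearEquiv.toLinearMap)
  have hlam : ∀ a : A, lam a = algebraMap k[X] F (h.coord a).2 := fun _ => rfl
  let i : ModuleCat.of A A ⟶ (ModuleCat.coextendScalars f).obj MF :=
    ModuleCat.RestrictionCoextensionAdj.HomEquiv.fromRestriction f
      (ModuleCat.ofHom (X := restricted k w) (Y := F) lam)
  have hi : ∀ a s : A, ModuleCat.CoextendScalars.equiv f MF (i.hom a) s = lam (s * a : A) :=
    fun _ _ => rfl
  let p : (ModuleCat.coextendScalars f).obj MF ⟶ (ModuleCat.coextendScalars f).obj MQ :=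
    (ModuleCat.coextendScalars f).map (ModuleCat.ofHom L.mkQ)
  have hp : ∀ x, ModuleCat.CoextendScalars.equiv f MQ (p.hom x) =
    L.mkQ.comp (ModuleCat.CoextendScalars.equiv f MF x) := fun _ => rfl
  have hip : i ≫ p = 0 := by
    refine ModuleCat.hom_ext (LinearMap.ext fun a => ?_)
    apply (ModuleCat.CoextendScalars.equiv f MQ).injective
    rw [ModuleCat.hom_comp, LinearMap.comp_apply, hp]
    refine LinearMap.ext fun s => ?_
    refine (congrArg L.mkQ (hi a s)).trans ?_
    exact (Submodule.Quotient.mk_eq_zero _).2 ⟨_, rfl⟩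
  have hS : (ShortComplex.mk i p hip).ShortExact := by
    refine ModuleCat.shortComplex_shortExact _ (fun x => ⟨fun hx => ?_, ?_⟩) ?_ ?_
    · let x' := ModuleCat.CoextendScalars.equiv f MF x
      have hx' : ∀ s : A, ∃ b, algebraMap k[X] F b = x' s := fun s => by
        have h1 : ModuleCat.CoextendScalars.equiv f MQ (p.hom x) = 0 :=
          (congrArg _ hx).trans (map_zero _)
        rw [hp] at h1
        exact (Submodule.Quotient.mk_eq_zero _).1 (LinearMap.congr_fun h1 s)
      obtain ⟨b, hb⟩ := hx' 1
      obtain ⟨a, ha⟩ := hx' z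
      -- For y = p + q z the functional λ takes the value q at 1·y and p at z·y, so the values of
      -- `x'` at 1 and z are the coefficients of the preimage.
      refine ⟨aeval w a + aeval w b * z, ?_⟩
      apply (ModuleCat.CoextendScalars.equiv f MF).injective
      refine h.restricted_hom_ext ?_ ?_
      · refine (hi _ _).trans ?_
        rw [one_mul, hlam, coord_eq]
        exact hb
      · refine (hi _ _).trans ?_
        rw [hlam, coord_z_mul, coord_eq]
        exact ha
    · rintro ⟨q, rfl⟩
      exact congrArg (fun f => f.hom q) hip
    · refine (injective_iff_map_eq_zero i.hom).2 fun a ha => ?_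
      have h0 : ∀ s, (h.coord (s * a)).2 = 0 := fun s => by
        rw [← FaithfulSMul.algebraMap_eq_zero_iff k[X] F, ← hlam, ← hi, ha, map_zero]
        rfl
      have h1 := h0 1
      have h2 := h0 z
      rw [coord_z_mul] at h2
      rw [one_mul] at h1
      exact (map_eq_zero_iff h.coord h.coord.injective).1 (Prod.ext h2 h1)
    · intro y
      -- Surjectivity is lifting a homomorphism A → F/k[w] to F, possible since A is free over k[w].
      have : Module.Projective k[X] (restricted k w) :=
        Module.Projective.of_equiv h.coordLinearEquiv.symm
      obtain ⟨x, hx⟩ := Module.projective_lifting_property L.mkQ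
        (ModuleCat.CoextendScalars.equiv f MQ y) L.mkQ_surjective
      exact ⟨(ModuleCat.CoextendScalars.equiv f MF).symm x,
        (ModuleCat.CoextendScalars.equiv f MQ).injective hx⟩
  exact hS.hasInjectiveDimensionLT_X₁ 1 inferInstance inferInstance

end IsQuadratic

/-! ### Ext of the trivial module over a quadratic extension -/

namespace IsQuadratic

section Ext

open Polynomial Abelian

variable {k A : Type u} [Field k] [Ring A] [Algebra k A] {κ : k} {w z : A}
  (h : IsQuadratic κ w z)

/-- The residues modulo `w` of the coordinates. -/
noncomputable def residue : A →ₗ[k] k × k where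
  toFun a := ((h.coord a).1.coeff 0, (h.coord a).2.coeff 0)
  map_add' a b := by simp
  map_smul' c a := by
    have : c • a = aeval w (C c) * a := by rw [aeval_C, Algebra.smul_def]
    rw [this, coord_aeval_mul]
    simp

theorem residue_eq (a : A) :
    h.residue a = ((h.coord a).1.coeff 0, (h.coord a).2.coeff 0) := rfl

theorem residue_aeval_add (p q : k[X]) :
    h.residue (aeval w p + aeval w q * z) = (p.coeff 0, q.coeff 0) := by
  rw [residue_eq, coord_eq]

theorem residue_surjective : Function.Surjective h.residue := fun c =>
  ⟨aeval w (C c.1) + aeval w (C c.2) * z, by rw [residue_aeval_add, coeff_C_zero, coeff_C_zero]⟩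

/-- Since z² is a multiple of w, the square of z vanishes modulo w whatever κ is: A/w always looks
like k[z]/(z²). -/
theorem residue_mul_z (a : A) : h.residue (a * z) = (0, (h.residue a).1) := by
  rw [residue_eq, residue_eq, coord_mul_z, coord_z_mul]
  simp

include h in
theorem w_mul_eq_zero {a : A} (ha : w * a = 0) : a = 0 := by
  have h1 := h.coord_w_mul a
  rw [ha, map_zero, eq_comm, smul_eq_zero_iff_right X_ne_zero] at h1
  exact (map_eq_zero_iff h.coord h.coord.injective).1 h1

theorem residue_eq_zero_iff {a : A} : h.residue a = 0 ↔ ∃ b, w * b = a := by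
  constructor
  · intro ha
    obtain ⟨p, q, rfl⟩ := h.exists_eq a
    rw [residue_aeval_add, Prod.mk_eq_zero, ← X_dvd_iff, ← X_dvd_iff] at ha
    obtain ⟨⟨p, rfl⟩, q, rfl⟩ := ha
    exact ⟨aeval w p + aeval w q * z, by
      rw [mul_add, map_mul, map_mul, aeval_X, mul_assoc]⟩
  · rintro ⟨b, rfl⟩
    rw [residue_eq, coord_w_mul]
    simp

/-- The left ideal generated by `w`. -/
def ideal (w : A) : Ideal A := LinearMap.range (LinearMap.toSpanSingleton A A w)

theorem mem_ideal {a : A} : a ∈ ideal w ↔ h.residue a = 0 := by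
  rw [residue_eq_zero_iff]
  exact exists_congr fun b => by rw [← h.mul_w]; rfl

/-- The module `A / w`. -/
noncomputable def quotient (w : A) : ModuleCat.{u} A := ModuleCat.of A (A ⧸ ideal w)

/-- The class of an element in `A / w`. -/
def quotientMk (w : A) : A →ₗ[A] quotient w := (ideal w).mkQ

theorem quotientMk_surjective : Function.Surjective (quotientMk w) :=
  (ideal w).mkQ_surjective

theorem quotientMk_eq_zero {a : A} : quotientMk w a = 0 ↔ h.residue a = 0 :=
  (Submodule.Quotient.mk_eq_zero _).trans h.mem_ideal

theorem mulRightHom_quotientMk (w : A) : mulRightHom w ≫ ModuleCat.ofHom (quotientMk w) = 0 := by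
  refine ModuleCat.hom_ext (LinearMap.ext fun a => ?_)
  exact (Submodule.Quotient.mk_eq_zero _).2 ⟨a, rfl⟩

/-- Multiplication by `w` with its cokernel. -/
noncomputable def quotientComplex (w : A) : ShortComplex (ModuleCat.{u} A) :=
  ShortComplex.mk (mulRightHom w) (ModuleCat.ofHom (quotientMk w)) (mulRightHom_quotientMk w)

include h in
theorem quotientComplex_shortExact : (quotientComplex w).ShortExact := by
  refine ModuleCat.shortComplex_shortExact _ (fun p => ⟨fun hp => ?_, ?_⟩) ?_ ?_
  · exact (Submodule.Quotient.mk_eq_zero _).1 hp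
  · rintro ⟨q, rfl⟩
    exact congrArg (fun f => f.hom q) (mulRightHom_quotientMk w)
  · refine (injective_iff_map_eq_zero (mulRightHom w).hom).2 fun p hp => ?_
    rw [mulRightHom_apply, h.mul_w] at hp
    exact h.w_mul_eq_zero hp
  · exact (quotientMk_surjective : Function.Surjective (quotientMk w))

include h in
-- As w is central and regular, A → A is a free resolution of A/w. Its Ext is therefore concentrated
-- in degree 1, where it is A/wA.
theorem exists_presentation_quotient :
    ∃ π : A →ₗ[k] Ext (quotient w) (ModuleCat.of A A) 1,
      ExtPresentation π (LinearMap.ker h.residue) := by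
  have key := ExtPresentation.of_shortExact h.quotientComplex_shortExact
    (extSelf_presentation (k := k) (A := A)) (extSelf_presentation (k := k) (A := A))
    (LinearMap.mulLeft k w) (fun v => comp_extSelf w v) (fun v hv => h.w_mul_eq_zero hv)
  suffices hI : LinearMap.ker h.residue = ⊥ ⊔ LinearMap.range (LinearMap.mulLeft k w) by
    rw [hI]
    exact ⟨_, key⟩
  rw [bot_sup_eq]
  ext a
  exact h.residue_eq_zero_iff

include h in
theorem rank_ext_quotient : Module.rank k (Ext (quotient w) (ModuleCat.of A A) 1) = 2 := by
  obtain ⟨π, hπ⟩ := h.exists_presentation_quotient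
  rw [← rank_totalExt 1 hπ.subsingleton, rank_totalExt_of_presentation hπ,
    (LinearMap.quotKerEquivOfSurjective _ h.residue_surjective).rank_eq, rank_prod',
    Module.rank_self, one_add_one_eq_two]

include h in
theorem subsingleton_ext_quotient {m : ℕ} (hm : m ≠ 1) :
    Subsingleton (Ext (quotient w) (ModuleCat.of A A) m) := by
  obtain ⟨π, hπ⟩ := h.exists_presentation_quotient
  exact hπ.subsingleton m hm

variable (ε : A →ₐ[k] k)

include h in
theorem augmentation_eq (hw : ε w = 0) (hz : ε z = 0) (a : A) : ε a = (h.residue a).1 := by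
  obtain ⟨p, q, rfl⟩ := h.exists_eq a
  rw [residue_aeval_add, map_add, map_mul, hz, mul_zero, add_zero, ← Polynomial.aeval_algHom_apply,
    hw, coeff_zero_eq_aeval_zero]

include h in
theorem mul_z_mem_ideal_iff (hw : ε w = 0) (hz : ε z = 0) {a : A} :
    a * z ∈ ideal w ↔ a ∈ RingHom.ker ε := by
  rw [h.mem_ideal, residue_mul_z, RingHom.mem_ker, h.augmentation_eq ε hw hz, Prod.mk_eq_zero]
  exact and_iff_right rfl

theorem ideal_le_ker (hw : ε w = 0) : ideal w ≤ RingHom.ker ε := by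
  rintro _ ⟨a, rfl⟩
  change ε (a * w) = 0
  rw [map_mul, hw, mul_zero]

/-- The class of an element in the trivial module. -/
def augmentationMk : A →ₗ[A] augmentationModule ε := (RingHom.ker ε).mkQ

theorem augmentationMk_surjective : Function.Surjective (augmentationMk ε) :=
  (RingHom.ker ε).mkQ_surjective

theorem augmentationMk_eq_zero {a : A} : augmentationMk ε a = 0 ↔ a ∈ RingHom.ker ε :=
  Submodule.Quotient.mk_eq_zero _

theorem augmentation_hom_ext {Y : ModuleCat.{u} A} {f g : augmentationModule ε ⟶ Y}
    (h : ∀ a, f.hom (augmentationMk ε a) = g.hom (augmentationMk ε a)) : f = g :=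
  ModuleCat.hom_ext (Submodule.linearMap_qext _ (LinearMap.ext h))

/-- Multiplication by `z`, from the trivial module to `A / w`. -/
def socleHom (hw : ε w = 0) (hz : ε z = 0) : augmentationModule ε ⟶ quotient w :=
  ModuleCat.ofHom ((RingHom.ker ε).mapQ (ideal w) (LinearMap.toSpanSingleton A A z)
    fun _ ha => (h.mul_z_mem_ideal_iff ε hw hz).2 ha)

theorem socleHom_mk (hw : ε w = 0) (hz : ε z = 0) (a : A) :
    (h.socleHom ε hw hz).hom (augmentationMk ε a) = quotientMk w (a * z) := rfl

/-- The projection of `A / w` onto the trivial module. -/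
def topHom (hw : ε w = 0) : quotient w ⟶ augmentationModule ε :=
  ModuleCat.ofHom (Submodule.factor (ideal_le_ker ε hw))

theorem topHom_mk (hw : ε w = 0) (a : A) :
    (topHom ε hw).hom (quotientMk w a) = augmentationMk ε a := rfl

theorem socleHom_topHom (hw : ε w = 0) (hz : ε z = 0) :
    h.socleHom ε hw hz ≫ topHom ε hw = 0 := by
  refine augmentation_hom_ext ε fun a => ?_
  rw [ModuleCat.hom_comp, LinearMap.comp_apply, socleHom_mk, topHom_mk]
  refine (augmentationMk_eq_zero ε).2 ?_
  rw [RingHom.mem_ker, map_mul, hz, mul_zero]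

/-- The module `A / w` as an extension of the trivial module by itself. -/
noncomputable def trivialComplex (hw : ε w = 0) (hz : ε z = 0) : ShortComplex (ModuleCat.{u} A) :=
  ShortComplex.mk (h.socleHom ε hw hz) (topHom ε hw) (h.socleHom_topHom ε hw hz)

/-- A/w has k-basis 1, z. The line of z is annihilated by w and z, and so is the quotient by it, so
both are trivial modules. -/
theorem trivialComplex_shortExact (hw : ε w = 0) (hz : ε z = 0) :
    (h.trivialComplex ε hw hz).ShortExact := by
  refine ModuleCat.shortComplex_shortExact _ (fun p => ⟨fun hp => ?_, ?_⟩) ?_ ?_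
  · obtain ⟨a, rfl⟩ := quotientMk_surjective p
    have ha : a ∈ RingHom.ker ε := (augmentationMk_eq_zero ε).1 hp
    rw [RingHom.mem_ker, h.augmentation_eq ε hw hz] at ha
    -- An element of A/w with zero constant term is its z-coefficient times z.
    refine ⟨augmentationMk ε (algebraMap k A (h.residue a).2),
      (h.socleHom_mk ε hw hz _).trans ?_⟩
    rw [← sub_eq_zero, ← map_sub, quotientMk_eq_zero h, map_sub, residue_mul_z, sub_eq_zero]
    refine Prod.ext ha.symm ?_
    change (h.residue (algebraMap k A (h.residue a).2)).1 = (h.residue a).2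
    rw [← h.augmentation_eq ε hw hz, ε.commutes]
    rfl
  · rintro ⟨q, rfl⟩
    exact congrArg (fun f => f.hom q) (h.socleHom_topHom ε hw hz)
  · refine (injective_iff_map_eq_zero (h.socleHom ε hw hz).hom).2 fun p hp => ?_
    obtain ⟨a, rfl⟩ := augmentationMk_surjective ε p
    rw [socleHom_mk] at hp
    exact (augmentationMk_eq_zero ε).2 ((h.mul_z_mem_ideal_iff ε hw hz).1
      ((Submodule.Quotient.mk_eq_zero _).1 hp))
  · exact Submodule.factor_surjective (ideal_le_ker ε hw)

include h in
-- Write E^n for Ext^n(k, A) and apply the long exact sequence to 0 → k → A/w → k → 0. E^0 embeds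
-- into Ext^0(A/w, A) = 0, and E^n = 0 for n ≥ 2 by the bound on the injective dimension. What
-- remains is 0 → E^1 → Ext^1(A/w, A) → E^1 → 0 with a two-dimensional middle term, so E^1 has
-- dimension 1.
theorem rank_totalExt_augmentationModule (hw : ε w = 0) (hz : ε z = 0) :
    Module.rank k (TotalExt (augmentationModule ε) (ModuleCat.of A A)) = 1 := by
  have hS := h.trivialComplex_shortExact ε hw hz
  have h0 : Subsingleton (Ext (augmentationModule ε) (ModuleCat.of A A) 0) := by
    refine subsingleton_of_forall_eq 0 fun x => ?_
    refine Ext.comp_eq_zero_of_epi hS (fun m' hm' => by omega) x ?_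
    have := h.subsingleton_ext_quotient zero_ne_one
    exact Subsingleton.elim (α := Ext (quotient w) (ModuleCat.of A A) 0) _ _
  have h2 : ∀ m, 2 ≤ m → Subsingleton (Ext (augmentationModule ε) (ModuleCat.of A A) m) :=
    fun m hm => by
      have := h.hasInjectiveDimensionLE
      exact HasInjectiveDimensionLT.subsingleton _ 2 m hm _
  rw [rank_totalExt 1 fun m hm => by
    match m with
    | 0 => exact h0
    | 1 => exact absurd rfl hm
    | m + 2 => exact h2 _ (by omega)]
  let α : Ext (augmentationModule ε) (ModuleCat.of A A) 1 →ₗ[k]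
      Ext (quotient w) (ModuleCat.of A A) 1 :=
    (Ext.mk₀ (topHom ε hw)).precompOfLinear k _ (zero_add 1)
  let β : Ext (quotient w) (ModuleCat.of A A) 1 →ₗ[k]
      Ext (augmentationModule ε) (ModuleCat.of A A) 1 :=
    (Ext.mk₀ (h.socleHom ε hw hz)).precompOfLinear k _ (zero_add 1)
  have hα : Function.Injective α := (injective_iff_map_eq_zero α).2 fun x hx =>
    Ext.comp_eq_zero_of_epi hS (fun m' hm' => by
      obtain rfl : m' = 0 := by omega
      exact h0) x hx
  have hβ : Function.Surjective β := fun x => by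
    have := h2 2 le_rfl
    exact Ext.contravariant_sequence_exact₁ hS _ x (n₁ := 2) (by omega)
      (Subsingleton.elim (α := Ext (augmentationModule ε) (ModuleCat.of A A) 2) _ _)
  have hαβ : LinearMap.ker β = LinearMap.range α := by
    ext x
    constructor
    · intro hx
      obtain ⟨y, hy⟩ := Ext.contravariant_sequence_exact₂ hS _ x hx
      exact ⟨y, hy⟩
    · rintro ⟨y, rfl⟩
      change (Ext.mk₀ (h.socleHom ε hw hz)).comp ((Ext.mk₀ (topHom ε hw)).comp y (zero_add 1))
        (zero_add 1) = 0
      rw [← Ext.comp_assoc _ _ _ (zero_add 0) (zero_add 1) (by omega), Ext.mk₀_comp_mk₀,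
        socleHom_topHom, Ext.mk₀_zero, Ext.zero_comp]
  have hr := LinearMap.rank_range_add_rank_ker β
  rw [h.rank_ext_quotient, hαβ, rank_range_of_surjective β hβ,
    rank_range_of_injective α hα] at hr
  -- The dimension is a cardinal, so finiteness is established first and the equation is then halved
  -- in the natural numbers.
  have hlt : Module.rank k (Ext (augmentationModule ε) (ModuleCat.of A A) 1) < Cardinal.aleph0 :=
    lt_of_le_of_lt (self_le_add_left _ _) (hr.trans_lt (Cardinal.natCast_lt_aleph0 (n := 2)))
  obtain ⟨n, hn⟩ := Cardinal.lt_aleph0.1 hlt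
  rw [hn] at hr ⊢
  have : n + n = 2 := by exact_mod_cast hr
  obtain rfl : n = 1 := by omega
  exact Nat.cast_one

end Ext

end IsQuadratic

/-! ### Connected graded algebras and their augmentations -/

section Connected

variable {k A : Type u} [Field k] [Ring A] [Algebra k A]

/-- A cyclic module whose generator is annihilated by the kernel of an augmentation is the trivial
module. -/
noncomputable def augmentationModuleIso (ε : A →ₐ[k] k) {X : ModuleCat.{u} A} (g : A →ₗ[A] X)
    (hg : Function.Surjective g) (hε : ∀ a, g a = 0 ↔ ε a = 0) : X ≅ augmentationModule ε :=
  ((Submodule.quotEquivOfEq _ (LinearMap.ker g) (by ext a; exact (hε a).symm)).trans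
    (g.quotKerEquivOfSurjective hg)).symm.toModuleIso

variable {𝒜 : ℕ → Submodule k A} [GradedAlgebra 𝒜]

namespace IsConnectedGraded

variable (h : IsConnectedGraded k 𝒜)

/-- The augmentation of a connected graded algebra. -/
noncomputable def augmentation : A →ₐ[k] k :=
  { (RingEquiv.ofBijective (algebraMap k (𝒜 0)) h).symm.toRingHom.comp
      (GradedRing.projZeroRingHom' 𝒜) with
    commutes' := fun c => by
      refine (RingEquiv.symm_apply_eq (RingEquiv.ofBijective (algebraMap k (𝒜 0)) h)).2 ?_
      refine Subtype.ext ?_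
      exact DirectSum.decompose_of_mem_same 𝒜 (SetLike.algebraMap_mem_graded 𝒜 c) }

theorem augmentation_eq_zero_iff (a : A) :
    h.augmentation a = 0 ↔ GradedRing.projZeroRingHom' 𝒜 a = 0 :=
  map_eq_zero_iff (RingEquiv.ofBijective (algebraMap k (𝒜 0)) h).symm (RingEquiv.injective _)

theorem augmentation_of_mem {n : ℕ} (hn : n ≠ 0) {a : A} (ha : a ∈ 𝒜 n) :
    h.augmentation a = 0 :=
  (h.augmentation_eq_zero_iff a).2 (Subtype.ext (DirectSum.decompose_of_mem_ne 𝒜 ha hn))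

/-- The augmentation of the opposite algebra. -/
noncomputable def augmentationOp : Aᵐᵒᵖ →ₐ[k] k :=
  h.augmentation.fromOpposite fun _ _ => Commute.all _ _

theorem rank_leftTrivialModule :
    Module.rank k (TotalExt (leftTrivialModule k 𝒜) (ModuleCat.of A A)) =
      Module.rank k (TotalExt (augmentationModule h.augmentation) (ModuleCat.of A A)) := by
  let X := leftTrivialModule k 𝒜
  let g : A →ₗ[A] X := LinearMap.toSpanSingleton A X (show 𝒜 0 from 1)
  have hg : ∀ a, g a = (show X from GradedRing.projZeroRingHom' 𝒜 a) := fun a =>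
    mul_one (GradedRing.projZeroRingHom' 𝒜 a)
  refine rank_totalExt_congr (augmentationModuleIso h.augmentation g (fun y => ?_) fun a => ?_)
  · exact ⟨((show 𝒜 0 from y) : A), (hg _).trans (Subtype.ext
      (DirectSum.decompose_of_mem_same 𝒜 (show 𝒜 0 from y).2))⟩
  · rw [hg, augmentation_eq_zero_iff]
    rfl

theorem rank_rightTrivialModule :
    Module.rank k (TotalExt (rightTrivialModule k 𝒜) (ModuleCat.of Aᵐᵒᵖ Aᵐᵒᵖ)) =
      Module.rank k (TotalExt (augmentationModule h.augmentationOp)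
        (ModuleCat.of Aᵐᵒᵖ Aᵐᵒᵖ)) := by
  let X := rightTrivialModule k 𝒜
  let g : Aᵐᵒᵖ →ₗ[Aᵐᵒᵖ] X := LinearMap.toSpanSingleton Aᵐᵒᵖ X (show (𝒜 0)ᵐᵒᵖ from 1)
  have hg : ∀ a, g a = (show X from MulOpposite.op (GradedRing.projZeroRingHom' 𝒜 a.unop)) :=
    fun a => mul_one (MulOpposite.op (GradedRing.projZeroRingHom' 𝒜 a.unop))
  refine rank_totalExt_congr (augmentationModuleIso h.augmentationOp g (fun y => ?_) fun a => ?_)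
  · exact ⟨MulOpposite.op ((show (𝒜 0)ᵐᵒᵖ from y).unop : A), (hg _).trans
      (congrArg MulOpposite.op (Subtype.ext
        (DirectSum.decompose_of_mem_same 𝒜 (show (𝒜 0)ᵐᵒᵖ from y).unop.2)))⟩
  · rw [hg]
    exact (MulOpposite.op_eq_zero_iff _).trans (h.augmentation_eq_zero_iff a.unop).symm

include h in
theorem isASGorenstein
    (hl : Module.rank k (TotalExt (augmentationModule h.augmentation) (ModuleCat.of A A)) = 1)
    (hr : Module.rank k (TotalExt (augmentationModule h.augmentationOp)
      (ModuleCat.of Aᵐᵒᵖ Aᵐᵒᵖ)) = 1)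
    (il : injectiveDimension (ModuleCat.of A A) < ⊤)
    (ir : injectiveDimension (ModuleCat.of Aᵐᵒᵖ Aᵐᵒᵖ) < ⊤) : IsASGorenstein k 𝒜 where
  left := ⟨⟨h, h.rank_leftTrivialModule.trans hl⟩, il⟩
  right := ⟨⟨h, h.rank_rightTrivialModule.trans hr⟩, ir⟩

include h in
-- Being a quadratic extension is symmetric under passing to the opposite algebra, so the left-hand
-- results apply on both sides.
theorem isASGorenstein_of_isQuadratic {κ : k} {w z : A} (q : IsQuadratic κ w z) {m n : ℕ}
    (hm : m ≠ 0) (hn : n ≠ 0) (hw : w ∈ 𝒜 m) (hz : z ∈ 𝒜 n) : IsASGorenstein k 𝒜 := by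
  have key : ∀ {B : Type u} [Ring B] [Algebra k B] {w z : B}, IsQuadratic κ w z →
      injectiveDimension (ModuleCat.of B B) < ⊤ := fun q =>
    (injectiveDimension_lt_iff (n := 2).2 q.hasInjectiveDimensionLE).trans
      (WithBot.coe_lt_coe.2 (ENat.natCast_lt_top 2))
  exact h.isASGorenstein
    (q.rank_totalExt_augmentationModule _ (h.augmentation_of_mem hm hw)
      (h.augmentation_of_mem hn hz))
    (q.op.rank_totalExt_augmentationModule _ (h.augmentation_of_mem hm hw)
      (h.augmentation_of_mem hn hz)) (key q) (key q.op)

end IsConnectedGraded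

section Trivial

theorem rank_totalExt_augmentationModule_of_bijective (hb : Function.Bijective (algebraMap k A))
    (ε : A →ₐ[k] k) : Module.rank k (TotalExt (augmentationModule ε) (ModuleCat.of A A)) = 1 := by
  have hε : ∀ a, ε a = 0 ↔ a = 0 := fun a => by
    obtain ⟨c, rfl⟩ := hb.2 a
    rw [ε.commutes, map_eq_zero_iff _ hb.1]
    rfl
  have i : ModuleCat.of A A ≅ augmentationModule ε :=
    augmentationModuleIso ε LinearMap.id Function.surjective_id fun a => (hε a).symm
  rw [← rank_totalExt_congr i, rank_totalExt_of_presentation (extSelf_presentation (k := k)),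
    (Submodule.quotEquivOfEqBot _ rfl).rank_eq,
    ← (LinearEquiv.ofBijective (Algebra.linearMap k A) hb).rank_eq, Module.rank_self]

theorem injectiveDimension_lt_of_bijective (hb : Function.Bijective (algebraMap k A)) :
    injectiveDimension (ModuleCat.of A A) < ⊤ := by
  let e : k ≃+* A := RingEquiv.ofBijective _ hb
  have hd : IsSemisimpleRing A := e.isSemisimpleRing
  have : Injective (ModuleCat.of A A) :=
    Module.injective_object_of_injective_module _ _
      (inj := Module.injective_of_isSemisimpleRing A A)
  exact (injectiveDimension_lt_iff (n := 1).2 inferInstance).trans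
      (WithBot.coe_lt_coe.2 (ENat.natCast_lt_top 1))

theorem IsConnectedGraded.isASGorenstein_of_bijective (h : IsConnectedGraded k 𝒜)
    (hb : Function.Bijective (algebraMap k A)) : IsASGorenstein k 𝒜 := by
  have hb' : Function.Bijective (algebraMap k Aᵐᵒᵖ) := MulOpposite.op_bijective.comp hb
  exact h.isASGorenstein (rank_totalExt_augmentationModule_of_bijective hb _)
    (rank_totalExt_augmentationModule_of_bijective hb' _)
    (injectiveDimension_lt_of_bijective hb) (injectiveDimension_lt_of_bijective hb')

end Trivial

end Connected

/-! ### Opposite algebras, and AS-regularity of skew polynomial algebras -/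

namespace SkewPoly

variable {k A : Type u} [Field k] [Ring A] [Algebra k A]

/-- The skew polynomial algebra is isomorphic to its opposite. -/
noncomputable def opEquiv : SkewPoly k ≃ₐ[k] (SkewPoly k)ᵐᵒᵖ :=
  have h : ∀ i j, i ≠ j → MulOpposite.op (x k i) * MulOpposite.op (x k j) +
      MulOpposite.op (x k j) * MulOpposite.op (x k i) = 0 := fun i j hij => by
    rw [← MulOpposite.op_mul, ← MulOpposite.op_mul, ← MulOpposite.op_add, x_anticomm hij.symm,
      MulOpposite.op_zero]
  let f : SkewPoly k →ₐ[k] (SkewPoly k)ᵐᵒᵖ := lift (fun i => MulOpposite.op (x k i)) h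
  have hf : ∀ a, (f (f a).unop).unop = a := fun a => by
    induction a using induction_x with
    | one => simp
    | smul c a ih => simp [ih]
    | add a b ha hb => simp [ha, hb]
    | x_mul i a ih => simp [ih, f, lift_x]
  AlgEquiv.ofBijective f ⟨fun a b hab => by rw [← hf a, hab, hf b],
    fun a => ⟨(f a.unop).unop, MulOpposite.unop_injective (hf _)⟩⟩

theorem opEquiv_x (i : Fin 3) : opEquiv (x k i) = MulOpposite.op (x k i) := lift_x ..

/-- An isomorphism with the skew polynomial algebra, on opposite algebras. -/
noncomputable def equivOp (e : SkewPoly k ≃ₐ[k] A) : SkewPoly k ≃ₐ[k] Aᵐᵒᵖ :=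
  opEquiv.trans (AlgEquiv.op e)

theorem equivOp_x (e : SkewPoly k ≃ₐ[k] A) (i : Fin 3) :
    equivOp e (x k i) = MulOpposite.op (e (x k i)) := by
  rw [equivOp, AlgEquiv.trans_apply, opEquiv_x]
  rfl

variable {𝒜 : ℕ → Submodule k A} [GradedAlgebra 𝒜] (h : IsConnectedGraded k 𝒜)
  (e : SkewPoly k ≃ₐ[k] A) (he : ∀ i, e (x k i) ∈ 𝒜 1)

include h he

theorem isASGorenstein : IsASGorenstein k 𝒜 := by
  have hε : ∀ i, h.augmentation (e (x k i)) = 0 := fun i =>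
    h.augmentation_of_mem one_ne_zero (he i)
  exact h.isASGorenstein (rank_totalExt_augmentationModule e _ hε)
    (rank_totalExt_augmentationModule (equivOp e) _ fun i => by
      rw [equivOp_x]
      exact hε i)
    (injectiveDimension_lt e) (injectiveDimension_lt (equivOp e))

theorem leftGlobalDimension_eq_three : leftGlobalDimension A = 3 :=
  leftGlobalDimension_eq e _ fun i => h.augmentation_of_mem one_ne_zero (he i)

theorem rightGlobalDimension_eq_three : rightGlobalDimension A = 3 :=
  leftGlobalDimension_eq (equivOp e) h.augmentationOp fun i => by
    rw [equivOp_x]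
    exact h.augmentation_of_mem one_ne_zero (he i)

theorem isASRegular : IsASRegular k 𝒜 where
  toIsASGorenstein := isASGorenstein h e he
  leftGlobalDimension_lt := by
    rw [leftGlobalDimension_eq_three h e he]
    exact WithBot.coe_lt_coe.2 (ENat.natCast_lt_top 3)
  rightGlobalDimension_lt := by
    rw [rightGlobalDimension_eq_three h e he]
    exact WithBot.coe_lt_coe.2 (ENat.natCast_lt_top 3)

end SkewPoly

/-! ### The skew polynomial algebra over the polynomial ring in the squares of the generators -/

namespace SkewPoly

variable {k : Type u} [Field k]

/-- The central homomorphism `X_i ↦ x_i ^ 2`. -/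
noncomputable def square : MvPolynomial (Fin 3) k →ₐ[k] SkewPoly k :=
  (Subalgebra.center k (SkewPoly k)).val.comp
    (MvPolynomial.aeval fun i => ⟨x k i ^ 2, Subalgebra.mem_center_iff.2 fun a =>
      (x_sq_central i a).symm⟩)

theorem square_X (i : Fin 3) : square (MvPolynomial.X i) = x k i ^ 2 := by
  rw [square, AlgHom.comp_apply, MvPolynomial.aeval_X]
  rfl

theorem square_comm (f : MvPolynomial (Fin 3) k) (a : SkewPoly k) : square f * a = a * square f :=
  (Subalgebra.mem_center_iff.1 (Subtype.prop (MvPolynomial.aeval _ f)) a).symm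

noncomputable instance : Algebra (MvPolynomial (Fin 3) k) (SkewPoly k) :=
  square.toRingHom.toAlgebra' square_comm

theorem algebraMap_eq_square (f : MvPolynomial (Fin 3) k) :
    algebraMap (MvPolynomial (Fin 3) k) (SkewPoly k) f = square f := rfl

instance : IsScalarTower k (MvPolynomial (Fin 3) k) (SkewPoly k) :=
  IsScalarTower.of_algebraMap_eq fun c => (square.commutes c).symm

theorem X_smul (i : Fin 3) (a : SkewPoly k) :
    (MvPolynomial.X i : MvPolynomial (Fin 3) k) • a = x k i ^ 2 * a := by
  rw [Algebra.smul_def, algebraMap_eq_square, square_X]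

/-- In ordered monomials, `square f` is `f` with all exponents doubled, since squares commute with
everything and produce no signs. -/
theorem square_injective : Function.Injective (square (k := k)) := by
  have h : ∀ f a, toPoly (square f * a) = MvPolynomial.expand 2 f * toPoly (k := k) a := by
    intro f
    induction f using MvPolynomial.induction_on with
    | C c =>
      intro a
      rw [← MvPolynomial.algebraMap_eq, square.commutes, AlgHom.commutes, ← Algebra.smul_def,
        ← Algebra.smul_def, map_smul]
    | add f g hf hg => intro a; rw [map_add, map_add, add_mul, add_mul, map_add, hf, hg]
    | mul_X f i hf =>
      intro a
      rw [map_mul square, map_mul (MvPolynomial.expand 2), square_X, MvPolynomial.expand_X,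
        mul_assoc, mul_assoc, hf, toPoly_x_sq_mul]
  refine (injective_iff_map_eq_zero square).2 fun f hf => ?_
  have h1 := h f 1
  rwa [hf, zero_mul, map_zero, toPoly_one, mul_one, eq_comm,
    MvPolynomial.expand_eq_zero two_pos] at h1

section Extension

variable {V : Type u} [AddCommGroup V] [Module (MvPolynomial (Fin 3) k) V]

/-- The homomorphism `(a, b) ↦ φ a + Y φ b`. -/
noncomputable def extension (φ : V →ₗ[MvPolynomial (Fin 3) k] SkewPoly k) (Y : SkewPoly k) :
    V × V →ₗ[MvPolynomial (Fin 3) k] SkewPoly k :=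
  φ.coprod (LinearMap.mulLeft _ Y ∘ₗ φ)

theorem extension_apply (φ : V →ₗ[MvPolynomial (Fin 3) k] SkewPoly k) (Y : SkewPoly k) (a b : V) :
    extension φ Y (a, b) = φ a + Y * φ b := rfl

/-- The automorphism changing the sign of `x_i`. -/
def negate (i : Fin 3) : SkewPoly k →ₐ[k] SkewPoly k :=
  lift (fun j => if j = i then -x k j else x k j) fun j l h => by
    have := x_anticomm (k := k) h
    split_ifs <;> simp [← neg_add, this]

theorem negate_x (i j : Fin 3) : negate i (x k j) = if j = i then -x k j else x k j := lift_x ..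

theorem negate_square (i : Fin 3) (f : MvPolynomial (Fin 3) k) :
    negate i (square f) = square f := by
  refine DFunLike.congr_fun (MvPolynomial.algHom_ext (f := (negate i).comp square)
    (g := square) fun j => ?_) f
  rw [AlgHom.comp_apply, square_X, map_pow, negate_x]
  split_ifs
  · rw [neg_sq]
  · rfl

/-- Changing the sign of x_i fixes φ a and negates x_i φ b. If their sum is zero then 2 φ a = 0,
hence φ a = 0, and x_i can be cancelled from the rest. -/
theorem extension_injective [CharZero k] {φ : V →ₗ[MvPolynomial (Fin 3) k] SkewPoly k}
    (hφ : Function.Injective φ) {i : Fin 3} (h : ∀ v, negate i (φ v) = φ v) :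
    Function.Injective (extension φ (x k i)) := by
  refine (injective_iff_map_eq_zero _).2 fun ⟨a, b⟩ hab => ?_
  rw [extension_apply] at hab
  have h1 := congrArg (negate i) hab
  rw [map_add, map_mul, negate_x, if_pos rfl, h, h, map_zero] at h1
  have h2 : (2 : k) • φ a = 0 := by
    rw [two_smul, ← add_zero (0 : SkewPoly k)]
    nth_rw 1 [← hab]
    rw [← h1, neg_mul]
    abel
  have h3 : φ a = 0 := (smul_eq_zero_iff_right two_ne_zero).1 h2
  rw [h3, zero_add] at hab
  exact Prod.ext ((map_eq_zero_iff φ hφ).1 h3) ((map_eq_zero_iff φ hφ).1 (eq_zero_of_x_mul hab))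

theorem negate_extension {φ : V →ₗ[MvPolynomial (Fin 3) k] SkewPoly k} {i j : Fin 3}
    (h : ∀ v, negate i (φ v) = φ v) (hij : j ≠ i) (v : V × V) :
    negate i (extension φ (x k j) v) = extension φ (x k j) v := by
  obtain ⟨a, b⟩ := v
  rw [extension_apply, map_add, map_mul, negate_x, if_neg hij, h, h]

/-- Y' can be moved past Y with a central error from P: Y'(φ a + Y φ b) = Y' φ a + f φ b - Y Y' φ b.
Stability under Y' is thus inherited from the range of φ. -/
theorem mul_mem_range_extension {φ : V →ₗ[MvPolynomial (Fin 3) k] SkewPoly k} {Y Y' : SkewPoly k}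
    {f : MvPolynomial (Fin 3) k} (hf : Y' * Y = square f - Y * Y')
    (h : ∀ a ∈ LinearMap.range φ, Y' * a ∈ LinearMap.range φ) {a : SkewPoly k}
    (ha : a ∈ LinearMap.range (extension φ Y)) : Y' * a ∈ LinearMap.range (extension φ Y) := by
  obtain ⟨⟨a, b⟩, rfl⟩ := ha
  obtain ⟨a', ha'⟩ := h _ ⟨a, rfl⟩
  obtain ⟨b', hb'⟩ := h _ ⟨b, rfl⟩
  refine ⟨(a' + f • b, -b'), ?_⟩
  rw [extension_apply, extension_apply, map_add, map_neg, map_smul, ha', hb', mul_add, ← mul_assoc,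
    hf, sub_mul, Algebra.smul_def, algebraMap_eq_square, mul_neg, mul_assoc]
  abel

theorem self_mul_mem_range_extension {φ : V →ₗ[MvPolynomial (Fin 3) k] SkewPoly k} {Y : SkewPoly k}
    {f : MvPolynomial (Fin 3) k} (hf : Y * Y = square f) {a : SkewPoly k}
    (ha : a ∈ LinearMap.range (extension φ Y)) : Y * a ∈ LinearMap.range (extension φ Y) := by
  obtain ⟨⟨a, b⟩, rfl⟩ := ha
  refine ⟨(f • b, a), ?_⟩
  rw [extension_apply, extension_apply, map_smul, mul_add, ← mul_assoc, hf, Algebra.smul_def,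
    algebraMap_eq_square, add_comm]

end Extension

/-- Linear forms in the variables. -/
noncomputable def linForm (g : Fin 3 → k) : MvPolynomial (Fin 3) k :=
  ∑ i, MvPolynomial.C (g i) * MvPolynomial.X i

/-- Linear combinations of the generators. -/
noncomputable def lin (g : Fin 3 → k) : SkewPoly k := ∑ i, g i • x k i

/-- A Clifford relation: distinct generators anticommute, so only the squares survive in the
anticommutator of two linear combinations. -/
theorem lin_mul_lin (g h : Fin 3 → k) : lin h * lin g =
    square (linForm fun i => 2 * g i * h i) - lin g * lin h := by
  have h1 : x k 1 * x k 0 = -(x k 0 * x k 1) :=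
    eq_neg_of_add_eq_zero_left (x_anticomm (by decide))
  have h2 : x k 2 * x k 0 = -(x k 0 * x k 2) :=
    eq_neg_of_add_eq_zero_left (x_anticomm (by decide))
  have h3 : x k 2 * x k 1 = -(x k 1 * x k 2) :=
    eq_neg_of_add_eq_zero_left (x_anticomm (by decide))
  simp only [lin, linForm, Fin.sum_univ_three, mul_add, add_mul, smul_mul_smul_comm, h1, h2, h3,
    map_add, MvPolynomial.C_mul', map_smul, square_X, pow_two]
  module

theorem lin_mul_self (g : Fin 3 → k) : lin g * lin g =
    square (linForm fun i => g i ^ 2) := by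
  have h1 : x k 1 * x k 0 = -(x k 0 * x k 1) :=
    eq_neg_of_add_eq_zero_left (x_anticomm (by decide))
  have h2 : x k 2 * x k 0 = -(x k 0 * x k 2) :=
    eq_neg_of_add_eq_zero_left (x_anticomm (by decide))
  have h3 : x k 2 * x k 1 = -(x k 1 * x k 2) :=
    eq_neg_of_add_eq_zero_left (x_anticomm (by decide))
  simp only [lin, linForm, Fin.sum_univ_three, mul_add, add_mul, smul_mul_smul_comm, h1, h2, h3,
    map_add, MvPolynomial.C_mul', map_smul, square_X, pow_two]
  module

section Words

variable (Y : Fin 3 → SkewPoly k)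

/-- The combinations of `1` and `Y_2` over the squares. -/
noncomputable def words₁ :
    MvPolynomial (Fin 3) k × MvPolynomial (Fin 3) k →ₗ[MvPolynomial (Fin 3) k] SkewPoly k :=
  extension (Algebra.linearMap _ _) (Y 2)

/-- The combinations of the words `Y_0^a Y_1^b Y_2^c`, `a, b, c ≤ 1`, over the squares. -/
noncomputable def words := extension (extension (words₁ Y) (Y 1)) (Y 0)

/-- The generators are split off one at a time, the outermost being x_0. The inner words do not
contain it and are fixed by its sign change. -/
theorem words_x_injective [CharZero k] : Function.Injective (words (x k)) := by
  have h0 : ∀ (i : Fin 3) (f : MvPolynomial (Fin 3) k),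
      negate i (Algebra.linearMap _ (SkewPoly k) f) = Algebra.linearMap _ (SkewPoly k) f :=
    fun i f => negate_square i f
  refine extension_injective (extension_injective (extension_injective square_injective (h0 2))
    fun v => ?_) fun v => ?_
  · exact negate_extension (h0 1) (by decide) v
  · exact negate_extension (negate_extension (h0 0) (by decide)) (by decide) v

/-- The range contains 1 and, by the Clifford relations, is stable under left multiplication by
every Y_i. As G is invertible, each x_i is a combination of the Y_j, so the range is everything. -/
theorem words_lin_surjective {G : Matrix (Fin 3) (Fin 3) k} (hG : IsUnit G.det) :
    Function.Surjective (words fun i => lin (G i)) := by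
  set Y : Fin 3 → SkewPoly k := fun i => lin (G i) with hY
  have h2 : ∀ a ∈ LinearMap.range (words₁ Y), Y 2 * a ∈ LinearMap.range (words₁ Y) :=
    fun a ha => self_mul_mem_range_extension (lin_mul_self _) ha
  have h12 : ∀ a ∈ LinearMap.range (extension (words₁ Y) (Y 1)),
      Y 2 * a ∈ LinearMap.range (extension (words₁ Y) (Y 1)) :=
    fun a ha => mul_mem_range_extension (lin_mul_lin _ _) h2 ha
  have h11 : ∀ a ∈ LinearMap.range (extension (words₁ Y) (Y 1)),
      Y 1 * a ∈ LinearMap.range (extension (words₁ Y) (Y 1)) :=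
    fun a ha => self_mul_mem_range_extension (lin_mul_self _) ha
  have h0 : ∀ i, ∀ a ∈ LinearMap.range (words Y), Y i * a ∈ LinearMap.range (words Y) := by
    intro i a ha
    match i with
    | 0 => exact self_mul_mem_range_extension (lin_mul_self _) ha
    | 1 => exact mul_mem_range_extension (lin_mul_lin _ _) h11 ha
    | 2 => exact mul_mem_range_extension (lin_mul_lin _ _) h12 ha
  have hx : ∀ i, x k i = ∑ j, G⁻¹ i j • Y j := fun i => by
    have h : ∀ j, Y j = ∑ l, G j l • x k l := fun j => rfl
    simp only [h, Finset.smul_sum, smul_smul]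
    rw [Finset.sum_comm]
    simp only [← Finset.sum_smul, ← Matrix.mul_apply, Matrix.nonsing_inv_mul G hG,
      Matrix.one_apply, ite_smul, one_smul, zero_smul, Finset.sum_ite_eq, Finset.mem_univ, if_true]
  have hs : ∀ (c : k), ∀ a ∈ LinearMap.range (words Y), c • a ∈ LinearMap.range (words Y) :=
    fun c a ha => by
      rw [← algebraMap_smul (MvPolynomial (Fin 3) k) c a]
      exact Submodule.smul_mem _ _ ha
  intro a
  change a ∈ LinearMap.range (words Y)
  induction a using induction_x with
  | one =>
    refine ⟨(((1, 0), 0), 0), ?_⟩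
    simp [words, words₁, extension_apply]
  | smul c a h => exact hs c a h
  | add a b ha hb => exact Submodule.add_mem _ ha hb
  | x_mul i a h =>
    rw [hx, Finset.sum_mul]
    refine Submodule.sum_mem _ fun j _ => ?_
    rw [smul_mul_assoc]
    exact hs _ _ (h0 j a h)

/-- The same free P-module embeds through the words in the x_i and surjects through the words in the
Y_i. By Orzech's theorem such a surjection onto a finite module is injective, so independence of the
Y-words need not be checked directly. -/
theorem words_lin_bijective [CharZero k] {G : Matrix (Fin 3) (Fin 3) k} (hG : IsUnit G.det) :
    Function.Bijective (words fun i => lin (G i)) := by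
  have hfin : Module.Finite (MvPolynomial (Fin 3) k) (SkewPoly k) :=
    Module.Finite.of_surjective _ (words_lin_surjective hG)
  exact ⟨OrzechProperty.injective_of_surjective_of_injective (words (x k))
    (words fun i => lin (G i)) words_x_injective (words_lin_surjective hG),
    words_lin_surjective hG⟩

end Words

end SkewPoly

/-! ### Iterated cones -/

section Cone

variable {S : Type*} [CommRing S] {V W : Type*} [AddCommGroup V] [Module S V] [AddCommGroup W]
  [Module S W]

/-- The differential `(a, b) ↦ (δ a + ℓ b, -δ b)` of the cone of the multiplication by `ℓ`. -/
def cone (δ : V →ₗ[S] V) (ℓ : S) : V × V →ₗ[S] V × V :=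
  (δ.coprod (ℓ • LinearMap.id)).prod (-(δ ∘ₗ LinearMap.snd S V V))

theorem cone_apply (δ : V →ₗ[S] V) (ℓ : S) (a b : V) :
    cone δ ℓ (a, b) = (δ a + ℓ • b, -δ b) := rfl

/-- The cohomology of the differential `δ` is presented as `W / I` by `ι`. -/
structure CohomologyPresentation (δ : V →ₗ[S] V) (ι : W →ₗ[S] V) (I : Submodule S W) : Prop where
  exists_eq : ∀ v, δ v = 0 → ∃ p a, v = ι p + δ a
  apply_eq_zero : ∀ p, δ (ι p) = 0
  mem_iff : ∀ p, p ∈ I ↔ ∃ a, δ a = ι p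

theorem CohomologyPresentation.zero :
    CohomologyPresentation (0 : W →ₗ[S] W) LinearMap.id ⊥ where
  exists_eq v _ := ⟨v, 0, by simp⟩
  apply_eq_zero _ := rfl
  mem_iff p := by simp [eq_comm]

/-- The cohomology of a cone is built from the kernel and the cokernel of ℓ on W/I. By `hℓ` the
kernel is zero, and `hI` describes the cokernel W/(I + ℓW). -/
theorem CohomologyPresentation.cone {δ : V →ₗ[S] V} {ι : W →ₗ[S] V} {I I' : Submodule S W}
    (h : CohomologyPresentation δ ι I) {ℓ : S} (hℓ : ∀ p, ℓ • p ∈ I → p ∈ I)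
    (hI : ∀ p, p ∈ I' ↔ ∃ q, p - ℓ • q ∈ I) :
    CohomologyPresentation (cone δ ℓ) (LinearMap.inl S V V ∘ₗ ι) I' where
  exists_eq := by
    rintro ⟨a, b⟩ hab
    rw [cone_apply, Prod.mk_eq_zero, neg_eq_zero] at hab
    obtain ⟨ha, hb⟩ := hab
    obtain ⟨q, b', rfl⟩ := h.exists_eq b hb
    -- The first component of the cocycle condition says that ℓ ι q is the coboundary of -(a + ℓ
    -- b').
    have hq : q ∈ I := hℓ q ((h.mem_iff _).2 ⟨-(a + ℓ • b'), by
      rw [map_neg, map_add, map_smul, map_smul, neg_eq_iff_add_eq_zero, ← ha, smul_add]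
      abel⟩)
    obtain ⟨c, hc⟩ := (h.mem_iff q).1 hq
    -- Now b = δ(c + b'). Subtracting the coboundary of (0, -(c + b')) clears the second component
    -- and leaves the cocycle a + ℓ(c + b') in the first.
    obtain ⟨p, a', ha'⟩ := h.exists_eq (a + ℓ • (c + b')) (by
      rw [map_add, map_smul, map_add, hc, ← ha])
    refine ⟨p, (a', -(c + b')), ?_⟩
    rw [LinearMap.comp_apply, LinearMap.inl_apply, cone_apply, Prod.mk_add_mk, zero_add, smul_neg,
      ← add_assoc, ← ha', add_neg_cancel_right, map_neg, neg_neg, map_add, hc]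
  apply_eq_zero p := by
    rw [LinearMap.comp_apply, LinearMap.inl_apply, cone_apply, h.apply_eq_zero, smul_zero, map_zero,
      neg_zero, add_zero, Prod.mk_zero_zero]
  mem_iff p := by
    rw [hI]
    constructor
    · rintro ⟨q, hq⟩
      obtain ⟨a, ha⟩ := (h.mem_iff _).1 hq
      refine ⟨(a, ι q), ?_⟩
      rw [cone_apply, ha, h.apply_eq_zero, map_sub, map_smul, sub_add_cancel, neg_zero]
      rfl
    · rintro ⟨⟨a, b⟩, hab⟩
      rw [cone_apply, LinearMap.comp_apply, LinearMap.inl_apply, Prod.mk_inj, neg_eq_zero] at hab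
      obtain ⟨ha, hb⟩ := hab
      obtain ⟨q, b', rfl⟩ := h.exists_eq b hb
      refine ⟨q, (h.mem_iff _).2 ⟨a + ℓ • b', ?_⟩⟩
      rw [map_sub, map_smul, ← ha, map_add, map_smul, smul_add]
      abel

end Cone

/-! ### The differential as an iterated cone over the ring of squares -/

namespace SkewPoly

variable {k : Type u} [Field k]

section Differential

theorem square_linForm (g : Fin 3 → k) : square (linForm g) = ∑ j, g j • x k j ^ 2 := by
  simp only [linForm, map_sum, MvPolynomial.C_mul', map_smul, square_X]

variable (M : Matrix (Fin 3) (Fin 3) k)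

theorem differential_x_mul (i : Fin 3) (a : SkewPoly k) :
    (differential M).d (x k i * a) = -(x k i * (differential M).d a) +
      square (linForm (M i)) * a := by
  rw [square_linForm]
  exact diffHom_x_mul M i a

/-- Each x_i² is central and a cocycle, since the two Leibniz terms cancel. This P-linearity turns
the computation of cohomology into commutative algebra. -/
theorem differential_smul (f : MvPolynomial (Fin 3) k) (a : SkewPoly k) :
    (differential M).d (f • a) = f • (differential M).d a := by
  induction f using MvPolynomial.induction_on generalizing a with
  | C c => rw [← MvPolynomial.algebraMap_eq, algebraMap_smul, algebraMap_smul, map_smul]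
  | add f g hf hg => rw [add_smul, map_add, hf, hg, add_smul]
  | mul_X f i hf =>
    rw [mul_smul, mul_smul, hf, X_smul, X_smul]
    exact congrArg (f • ·) (diffHom_x_sq_mul M i a)

/-- The differential as a linear map over the squares of the generators. -/
noncomputable def differentialLinear : SkewPoly k →ₗ[MvPolynomial (Fin 3) k] SkewPoly k :=
  { (differential M).d with map_smul' := differential_smul M }

theorem differential_lin_mul (g : Fin 3 → k) (a : SkewPoly k) :
    (differential M).d (lin g * a) = -(lin g * (differential M).d a) +
      square (linForm (Matrix.vecMul g M)) * a := by
  simp only [lin, linForm, Matrix.vecMul, dotProduct, Finset.sum_mul, map_sum, smul_mul_assoc,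
    map_smul, differential_x_mul, smul_add, Finset.sum_add_distrib, smul_neg,
    Finset.sum_neg_distrib, MvPolynomial.C_mul',
    Finset.smul_sum, smul_smul]
  rw [Finset.sum_comm]

/-- With Y the linear combination given by `g` and ℓ the form of ∂Y, one has ∂(a + Y b) = (∂a + ℓ b)
- Y ∂b, which is the differential of the cone of ℓ. -/
theorem differentialLinear_extension {V : Type u} [AddCommGroup V]
    [Module (MvPolynomial (Fin 3) k) V] {φ : V →ₗ[MvPolynomial (Fin 3) k] SkewPoly k}
    {δ : V →ₗ[MvPolynomial (Fin 3) k] V} (h : ∀ v, differentialLinear M (φ v) = φ (δ v))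
    (g : Fin 3 → k) (v : V × V) :
    differentialLinear M (extension φ (lin g) v) =
      extension φ (lin g) (cone δ (linForm (Matrix.vecMul g M)) v) := by
  obtain ⟨a, b⟩ := v
  rw [extension_apply, cone_apply, extension_apply, map_add, map_add, map_neg, map_smul, ← h, ← h,
    Algebra.smul_def, mul_neg, add_assoc, add_comm (algebraMap _ (SkewPoly k) _ * φ b)]
  exact congrArg (_ + ·) (differential_lin_mul M g (φ b))

end Differential

/-! ### Linear forms, linear changes of variables and restriction to a line -/

section PolynomialRing

open MvPolynomial

theorem linForm_single (i : Fin 3) : linForm (Pi.single i (1 : k)) = X i := by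
  simp [linForm, Pi.single_apply]

/-- The restriction of polynomial functions to the line generated by `s`. -/
noncomputable def restrictLine (s : Fin 3 → k) : MvPolynomial (Fin 3) k →ₐ[k] Polynomial k :=
  aeval fun i => s i • Polynomial.X

theorem restrictLine_linForm (s g : Fin 3 → k) :
    restrictLine s (linForm g) = (∑ i, g i * s i) • Polynomial.X := by
  simp only [linForm, map_sum, restrictLine, aeval_X, C_mul', map_smul, smul_smul,
    Finset.sum_smul]

/-- Modulo the other two variables, a polynomial is the polynomial in X_i given by its restriction
to the i-th axis. -/
theorem exists_eq_of_restrictLine_single_eq_zero {i j l : Fin 3} (h : ∀ m, m = i ∨ m = j ∨ m = l)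
    {f : MvPolynomial (Fin 3) k} (hf : restrictLine (Pi.single i (1 : k)) f = 0) :
    ∃ a b, a * X j + b * X l = f := by
  have key : ∀ f : MvPolynomial (Fin 3) k,
      f - Polynomial.aeval (X i) (restrictLine (Pi.single i (1 : k)) f) ∈
        Ideal.span {X j, X l} := by
    intro f
    induction f using MvPolynomial.induction_on with
    | C c =>
      rw [← algebraMap_eq, AlgHom.commutes, AlgHom.commutes, sub_self]
      exact Ideal.zero_mem _
    | add f g hf hg =>
      rw [map_add, map_add, add_sub_add_comm]
      exact Ideal.add_mem _ hf hg
    | mul_X f m hf =>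
      have hm : X m - Polynomial.aeval (X i : MvPolynomial (Fin 3) k)
          (restrictLine (Pi.single i (1 : k)) (X m)) ∈ Ideal.span {X j, X l} := by
        rw [restrictLine, aeval_X]
        by_cases hmi : m = i
        · subst hmi
          simp
        · rw [Pi.single_eq_of_ne hmi, zero_smul, map_zero, sub_zero]
          refine Ideal.subset_span ?_
          rcases h m with rfl | rfl | rfl
          · exact absurd rfl hmi
          · exact Or.inl rfl
          · exact Or.inr rfl
      rw [map_mul, map_mul]
      have := Ideal.add_mem _ (Ideal.mul_mem_right (X m) _ hf) (Ideal.mul_mem_left _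
        (Polynomial.aeval (X i) (restrictLine (Pi.single i (1 : k)) f)) hm)
      convert this using 1
      ring
  have h1 := key f
  rw [hf, map_zero, sub_zero] at h1
  exact Ideal.mem_span_pair.1 h1

/-- The linear substitution given by a matrix. -/
noncomputable def linSubst (Q : Matrix (Fin 3) (Fin 3) k) :
    MvPolynomial (Fin 3) k →ₐ[k] MvPolynomial (Fin 3) k :=
  aeval fun i => linForm (Q i)

theorem linSubst_X (Q : Matrix (Fin 3) (Fin 3) k) (i : Fin 3) :
    linSubst Q (X i) = linForm (Q i) := aeval_X ..

theorem linSubst_linSubst (P Q : Matrix (Fin 3) (Fin 3) k) (f : MvPolynomial (Fin 3) k) :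
    linSubst P (linSubst Q f) = linSubst (Q * P) f := by
  refine DFunLike.congr_fun (MvPolynomial.algHom_ext (f := (linSubst P).comp (linSubst Q))
    (g := linSubst (Q * P)) fun i => ?_) f
  rw [AlgHom.comp_apply, linSubst_X, linSubst_X]
  simp only [linForm, map_sum, C_mul', map_smul, linSubst_X, Finset.smul_sum, smul_smul,
    Matrix.mul_apply]
  rw [Finset.sum_comm]
  refine Finset.sum_congr rfl fun j _ => ?_
  rw [Finset.sum_mul]
  simp only [C_mul']

theorem linSubst_one (f : MvPolynomial (Fin 3) k) : linSubst 1 f = f := by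
  refine DFunLike.congr_fun (MvPolynomial.algHom_ext (f := linSubst 1)
    (g := AlgHom.id k _) fun i => ?_) f
  rw [linSubst_X]
  exact (congrArg linForm (funext fun j => Matrix.one_eq_pi_single)).trans (linForm_single i)

/-- The linear change of variables given by an invertible matrix. -/
noncomputable def linSubstEquiv (Q : Matrix (Fin 3) (Fin 3) k) (hQ : IsUnit Q.det) :
    MvPolynomial (Fin 3) k ≃ₐ[k] MvPolynomial (Fin 3) k :=
  AlgEquiv.ofAlgHom (linSubst Q) (linSubst Q⁻¹)
    (AlgHom.ext fun f => by
      rw [AlgHom.comp_apply, linSubst_linSubst, Matrix.nonsing_inv_mul Q hQ, linSubst_one]; rfl)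
    (AlgHom.ext fun f => by
      rw [AlgHom.comp_apply, linSubst_linSubst, Matrix.mul_nonsing_inv Q hQ, linSubst_one]; rfl)

theorem linSubstEquiv_X (Q : Matrix (Fin 3) (Fin 3) k) (hQ : IsUnit Q.det) (i : Fin 3) :
    linSubstEquiv Q hQ (X i) = linForm (Q i) := linSubst_X Q i

theorem prime_linForm {Q : Matrix (Fin 3) (Fin 3) k} (hQ : IsUnit Q.det) (i : Fin 3) :
    Prime (linForm (Q i)) := by
  rw [← linSubstEquiv_X Q hQ, MulEquiv.prime_iff (linSubstEquiv Q hQ)]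
  exact X_prime

theorem not_linForm_dvd {Q : Matrix (Fin 3) (Fin 3) k} (hQ : IsUnit Q.det) {i j : Fin 3}
    (hij : i ≠ j) : ¬linForm (Q i) ∣ linForm (Q j) := by
  rw [← linSubstEquiv_X Q hQ, ← linSubstEquiv_X Q hQ, map_dvd_iff]
  intro h
  exact hij (X_dvd_X.1 h)

theorem restrictLine_linSubst (s : Fin 3 → k) (Q : Matrix (Fin 3) (Fin 3) k)
    (f : MvPolynomial (Fin 3) k) :
    restrictLine s (linSubst Q f) = restrictLine (Q.mulVec s) f := by
  refine DFunLike.congr_fun (MvPolynomial.algHom_ext (f := (restrictLine s).comp (linSubst Q))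
    (g := restrictLine (Q.mulVec s)) fun i => ?_) f
  rw [AlgHom.comp_apply, linSubst_X, restrictLine_linForm, restrictLine, aeval_X]
  rfl

/-- The substitution by Q carries the line of `s` to the i-th coordinate axis, whose ideal is
generated by the two other variables. Hence the ideal of the line is generated by the two other rows
of Q. -/
theorem restrictLine_eq_zero_iff {Q : Matrix (Fin 3) (Fin 3) k} (hQ : IsUnit Q.det)
    {s : Fin 3 → k} {i j l : Fin 3} (h : ∀ m, m = i ∨ m = j ∨ m = l) (hj : j ≠ i) (hl : l ≠ i)
    (hs : Q.mulVec s = Pi.single i (1 : k))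
    {f : MvPolynomial (Fin 3) k} :
    restrictLine s f = 0 ↔ ∃ a b, a * linForm (Q j) + b * linForm (Q l) = f := by
  obtain ⟨f, rfl⟩ := (linSubstEquiv Q hQ).surjective f
  change restrictLine s (linSubst Q f) = 0 ↔ _
  rw [restrictLine_linSubst, hs]
  constructor
  · intro hf
    obtain ⟨a, b, rfl⟩ := exists_eq_of_restrictLine_single_eq_zero h hf
    refine ⟨linSubstEquiv Q hQ a, linSubstEquiv Q hQ b, ?_⟩
    rw [map_add, map_mul, map_mul, linSubstEquiv_X, linSubstEquiv_X]
  · rintro ⟨a, b, hab⟩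
    obtain ⟨a, rfl⟩ := (linSubstEquiv Q hQ).surjective a
    obtain ⟨b, rfl⟩ := (linSubstEquiv Q hQ).surjective b
    rw [← linSubstEquiv_X Q hQ, ← linSubstEquiv_X Q hQ, ← map_mul, ← map_mul, ← map_add] at hab
    rw [← (linSubstEquiv Q hQ).injective hab, map_add, map_mul, map_mul]
    simp [restrictLine, hj, hl]

end PolynomialRing

end SkewPoly

/-! ### The cohomology of the skew polynomial algebra -/

namespace SkewPoly

variable {k : Type u} [Field k]

section Connected

variable (M : Matrix (Fin 3) (Fin 3) k)

/-- Cocycles of degree 0 are constants, and a coboundary has no component of degree 0. -/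
theorem isConnectedGraded_cohomology :
    IsConnectedGraded k (differential M).cohomologyGrading := by
  have hc : ∀ c : k, ((algebraMap k ((differential M).cohomologyGrading 0) c :
      (differential M).cohomologyGrading 0) : (differential M).Cohomology) =
      (differential M).toCohomology (algebraMap k _ c) := fun c =>
    ((differential M).toCohomology.commutes c).symm
  constructor
  · refine (injective_iff_map_eq_zero _).2 fun c h => ?_
    have h1 := (hc c).symm.trans (congrArg Subtype.val h)
    obtain ⟨a, ha⟩ := (differential M).toCohomology_eq_zero.1 h1
    have h2 := (differential M).d_proj_zero a
    rw [ha] at h2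
    have h3 : algebraMap k (SkewPoly k) c = 0 := by
      rw [← h2]
      exact (DirectSum.decompose_of_mem_same (grading k)
        (SetLike.algebraMap_mem_graded (grading k) c)).symm
    rwa [map_eq_zero_iff _ (algebraMap k (SkewPoly k)).injective] at h3
  · rintro ⟨_, z, hz, rfl⟩
    have hz' : (z : SkewPoly k) ∈ grading k 0 := hz
    rw [grading, pow_zero] at hz'
    obtain ⟨c, hcz⟩ := Submodule.mem_one.1 hz'
    exact ⟨c, Subtype.ext ((hc c).trans
      (congrArg (differential M).toCohomology (Subtype.ext hcz)))⟩

end Connected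

section Zero

theorem differential_zero_d (a : SkewPoly k) :
    (differential (0 : Matrix (Fin 3) (Fin 3) k)).d a = 0 := by
  induction a using induction_x with
  | one => exact CochainDifferential.d_one _
  | smul c a h => rw [map_smul, h, smul_zero]
  | add a b ha hb => rw [map_add, ha, hb, add_zero]
  | x_mul i a h =>
    rw [differential_x_mul, h, square_linForm]
    simp

variable (k) in
/-- The isomorphism with the cohomology, for the zero differential. -/
noncomputable def cohomologyEquiv :
    SkewPoly k ≃ₐ[k] (differential (0 : Matrix (Fin 3) (Fin 3) k)).Cohomology :=
  AlgEquiv.ofBijective ((differential 0).toCohomology.comp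
      ((AlgHom.id k _).codRestrict _ differential_zero_d)) <| by
    constructor
    · refine (injective_iff_map_eq_zero _).2 fun a ha => ?_
      obtain ⟨b, hb⟩ := (differential 0).toCohomology_eq_zero.1 ha
      rw [differential_zero_d] at hb
      exact hb.symm
    · intro h
      obtain ⟨z, rfl⟩ := (differential 0).toCohomology_surjective h
      exact ⟨z, rfl⟩

theorem cohomologyEquiv_isClassOf (a : SkewPoly k) :
    (differential 0).IsClassOf (cohomologyEquiv k a) a := ⟨⟨a, differential_zero_d a⟩, rfl, rfl⟩

theorem cohomologyEquiv_mem_iff (n : ℕ) (a : SkewPoly k) :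
    cohomologyEquiv k a ∈ (differential 0).cohomologyGrading n ↔ a ∈ grading k n := by
  constructor
  · rintro ⟨z, hz, h⟩
    rw [← (cohomologyEquiv k).injective (a₁ := z) (a₂ := a) h]
    exact hz
  · exact fun ha => ⟨⟨a, differential_zero_d a⟩, ha, rfl⟩

end Zero

section Words

variable (k) in
/-- The coefficients of words, over the squares of the generators. -/
abbrev WordCoeffs : Type u :=
  ((MvPolynomial (Fin 3) k × MvPolynomial (Fin 3) k) ×
    (MvPolynomial (Fin 3) k × MvPolynomial (Fin 3) k)) ×
  ((MvPolynomial (Fin 3) k × MvPolynomial (Fin 3) k) ×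
    (MvPolynomial (Fin 3) k × MvPolynomial (Fin 3) k))

variable {M G : Matrix (Fin 3) (Fin 3) k} {ℓ : Fin 3 → MvPolynomial (Fin 3) k}

theorem words_inl (Y : Fin 3 → SkewPoly k) (p q : MvPolynomial (Fin 3) k) :
    words Y (((p, q), 0), 0) = square p + Y 2 * square q := by
  rw [words, extension_apply, extension_apply, map_zero, map_zero, mul_zero, mul_zero, add_zero,
    add_zero]
  rfl

/-- The differential on the coefficients of words. -/
noncomputable def wordsCone (ℓ : Fin 3 → MvPolynomial (Fin 3) k) :
    WordCoeffs k →ₗ[MvPolynomial (Fin 3) k] WordCoeffs k :=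
  cone (cone (cone 0 (ℓ 2)) (ℓ 1)) (ℓ 0)

theorem differentialLinear_words (h : ∀ i, linForm (Matrix.vecMul (G i) M) = ℓ i)
    (v : WordCoeffs k) :
    differentialLinear M (words (fun i => lin (G i)) v) =
      words (fun i => lin (G i)) (wordsCone ℓ v) := by
  have h0 : ∀ f, differentialLinear M (Algebra.linearMap _ (SkewPoly k) f) =
      Algebra.linearMap _ (SkewPoly k) ((0 : MvPolynomial (Fin 3) k →ₗ[MvPolynomial (Fin 3) k]
        MvPolynomial (Fin 3) k) f) := fun f => by
    rw [LinearMap.zero_apply, map_zero, Algebra.linearMap_apply, Algebra.algebraMap_eq_smul_one,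
      map_smul]
    exact (congrArg (f • ·) (differential M).d_one).trans (smul_zero f)
  obtain rfl : (fun i => linForm (Matrix.vecMul (G i) M)) = ℓ := funext h
  exact differentialLinear_extension M (fun v => differentialLinear_extension M
    (fun v => differentialLinear_extension M h0 _ v) _ v) _ v

variable [CharZero k] {W : Type u} [AddCommGroup W] [Module (MvPolynomial (Fin 3) k) W]
  {ι : W →ₗ[MvPolynomial (Fin 3) k] WordCoeffs k} {I : Submodule (MvPolynomial (Fin 3) k) W}
  (hG : IsUnit G.det) (h : ∀ i, linForm (Matrix.vecMul (G i) M) = ℓ i)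
  (hP : CohomologyPresentation (wordsCone ℓ) ι I)

include hG h hP

/-- The words give an isomorphism of complexes from the iterated cone, so the presentation of
cohomology transports. This covers cocycles, the next lemma coboundaries. -/
theorem exists_eq_words_add {a : SkewPoly k} (ha : (differential M).d a = 0) :
    ∃ p b, a = words (fun i => lin (G i)) (ι p) + (differential M).d b := by
  obtain ⟨v, rfl⟩ := (words_lin_bijective hG).2 a
  have hv := (differentialLinear_words h v).symm.trans ha
  rw [map_eq_zero_iff _ (words_lin_bijective hG).1] at hv
  obtain ⟨p, w, rfl⟩ := hP.exists_eq v hv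
  refine ⟨p, words (fun i => lin (G i)) w, ?_⟩
  rw [map_add]
  exact congrArg (_ + ·) (differentialLinear_words h w).symm

theorem exists_d_eq_words_iff (p : W) :
    (∃ b, (differential M).d b = words (fun i => lin (G i)) (ι p)) ↔ p ∈ I := by
  rw [hP.mem_iff, (words_lin_bijective hG).2.exists]
  refine exists_congr fun v => ?_
  rw [← (words_lin_bijective hG).1.eq_iff]
  exact Eq.congr_left (differentialLinear_words h v)

end Words

section Invertible

open MvPolynomial

variable [CharZero k] {M : Matrix (Fin 3) (Fin 3) k}

omit [CharZero k] in
theorem sub_C_constantCoeff_mem (p : MvPolynomial (Fin 3) k) :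
    p - C (constantCoeff p) ∈ Ideal.span {(X 0 : MvPolynomial (Fin 3) k), X 1, X 2} := by
  induction p using MvPolynomial.induction_on with
  | C c => simp
  | add p q hp hq =>
    rw [map_add, map_add, add_sub_add_comm]
    exact Ideal.add_mem _ hp hq
  | mul_X p i hp =>
    rw [map_mul, constantCoeff_X, mul_zero, map_zero, sub_zero]
    refine Ideal.mul_mem_left _ _ (Ideal.subset_span ?_)
    fin_cases i <;> simp

/-- With G = M⁻¹ the cone is formed successively with X_2, X_1, X_0. They form a regular sequence in
P, so only P/(X_0, X_1, X_2) = k is left. -/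
theorem exists_eq_algebraMap_add (hM : IsUnit M.det) {a : SkewPoly k}
    (ha : (differential M).d a = 0) :
    ∃ c b, a = algebraMap k _ c + (differential M).d b := by
  have h : ∀ i, linForm (Matrix.vecMul (M⁻¹ i) M) = X i := fun i => by
    rw [← linForm_single]
    refine congrArg linForm (funext fun j => ?_)
    rw [← Matrix.one_eq_pi_single, ← Matrix.nonsing_inv_mul M hM]
    rfl
  have h1 : ∀ p : MvPolynomial (Fin 3) k, (X 1 : MvPolynomial (Fin 3) k) • p ∈
      Ideal.span {(X 2 : MvPolynomial (Fin 3) k)} → p ∈ Ideal.span {(X 2 : MvPolynomial (Fin 3) k)} := by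
    intro p hp
    rw [Ideal.mem_span_singleton] at hp ⊢
    refine (X_prime.dvd_or_dvd hp).resolve_left fun h => ?_
    exact absurd (X_dvd_X.1 h) (by decide)
  -- The ideal (X_1, X_2) is the kernel of restriction to the X_0-axis, which takes values in a
  -- domain and sends X_0 to the variable. Hence X_0 is regular modulo this ideal.
  have h2 : ∀ p : MvPolynomial (Fin 3) k, p ∈ Ideal.span {(X 1 : MvPolynomial (Fin 3) k), X 2} ↔
      restrictLine (Pi.single 0 (1 : k)) p = 0 := fun p => by
    rw [Ideal.mem_span_pair, restrictLine_eq_zero_iff (Q := 1) (by simp) (i := 0) (j := 1) (l := 2)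
      (by decide) (by decide) (by decide) (Matrix.one_mulVec _)]
    have h3 : ∀ i, linForm ((1 : Matrix (Fin 3) (Fin 3) k) i) = X i := fun i =>
      (congrArg linForm (funext fun j => Matrix.one_eq_pi_single)).trans (linForm_single i)
    rw [h3, h3]
  have hP := ((CohomologyPresentation.zero (S := MvPolynomial (Fin 3) k)
    (W := MvPolynomial (Fin 3) k)).cone (ℓ := X 2)
      (I' := Ideal.span {(X 2 : MvPolynomial (Fin 3) k)}) (fun p hp => by
      rw [Submodule.mem_bot, smul_eq_zero_iff_right (X_ne_zero 2)] at hp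
      exact hp) (fun p => by
        simp only [Submodule.mem_bot, sub_eq_zero]
        exact Ideal.mem_span_singleton)).cone
      (ℓ := X 1) (I' := Ideal.span {(X 1 : MvPolynomial (Fin 3) k), X 2}) h1 (fun p => by
        rw [Ideal.mem_span_insert']
        constructor
        · rintro ⟨q, hq⟩
          exact ⟨-q, by rwa [smul_eq_mul, mul_neg, sub_neg_eq_add, mul_comm]⟩
        · rintro ⟨q, hq⟩
          exact ⟨-q, by rwa [neg_mul, ← sub_eq_add_neg, mul_comm]⟩) |>.cone
      (ℓ := X 0) (I' := Ideal.span {(X 0 : MvPolynomial (Fin 3) k), X 1, X 2}) (fun p hp => by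
        rw [h2] at hp ⊢
        rw [smul_eq_mul, map_mul, restrictLine, aeval_X, Pi.single_eq_same, one_smul] at hp
        exact (mul_eq_zero.1 hp).resolve_left Polynomial.X_ne_zero) (fun p => by
        rw [Ideal.mem_span_insert']
        constructor
        · rintro ⟨q, hq⟩
          exact ⟨-q, by rwa [smul_eq_mul, mul_neg, sub_neg_eq_add, mul_comm]⟩
        · rintro ⟨q, hq⟩
          exact ⟨-q, by rwa [neg_mul, ← sub_eq_add_neg, mul_comm]⟩)
  have hG : IsUnit (M⁻¹).det := Matrix.isUnit_nonsing_inv_det M hM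
  obtain ⟨p, b, rfl⟩ := exists_eq_words_add hG h hP ha
  obtain ⟨b', hb'⟩ := (exists_d_eq_words_iff hG h hP _).2
    (sub_C_constantCoeff_mem p)
  refine ⟨constantCoeff p, b' + b, ?_⟩
  have hι : ∀ p, words (fun i => lin (M⁻¹ i)) (((p, 0), 0), 0) = square p := fun p => by
    rw [words_inl, map_zero, mul_zero, add_zero]
  have hb : (differential M).d b' = square p - square (C (constantCoeff p)) := by
    rw [← map_sub]
    exact hb'.trans (hι _)
  rw [map_add, hb, ← add_assoc, ← algebraMap_eq, square.commutes, add_sub_cancel]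
  exact congrArg (· + _) (hι p)

end Invertible

end SkewPoly

/-! ### Corank one: the cohomology as a quadratic extension of k[w] -/

namespace SkewPoly

open MvPolynomial

variable {k : Type u} [Field k]

theorem restrictLine_linForm_eq_X {s g : Fin 3 → k} (hg : ∑ i, g i * s i = 1) :
    restrictLine s (linForm g) = Polynomial.X := by
  rw [restrictLine_linForm, hg, one_smul]

section Square

variable (M : Matrix (Fin 3) (Fin 3) k)

theorem differential_square (f : MvPolynomial (Fin 3) k) :
    (differential M).d (square f) = 0 := by
  have h := differential_smul M f 1
  rwa [(differential M).d_one, smul_zero, Algebra.smul_def, mul_one] at h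

/-- The cohomology classes of polynomials in the squares of the generators. -/
noncomputable def squareClass : MvPolynomial (Fin 3) k →ₐ[k] (differential M).Cohomology :=
  (differential M).toCohomology.comp (square.codRestrict _ (differential_square M))

theorem squareClass_apply (f : MvPolynomial (Fin 3) k) :
    squareClass M f = (differential M).toCohomology ⟨square f, differential_square M f⟩ := rfl

theorem squareClass_comm (f : MvPolynomial (Fin 3) k) (h : (differential M).Cohomology) :
    squareClass M f * h = h * squareClass M f := by
  obtain ⟨z, rfl⟩ := (differential M).toCohomology_surjective h
  rw [squareClass_apply, ← map_mul, ← map_mul]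
  exact congrArg _ (Subtype.ext (square_comm f z))

theorem square_linForm_mem (g : Fin 3 → k) : square (linForm g) ∈ grading k 2 := by
  rw [square_linForm]
  refine Submodule.sum_mem _ fun j _ => Submodule.smul_mem _ _ ?_
  rw [pow_two]
  exact SetLike.GradedMul.mul_mem (x_mem j) (x_mem j)

theorem lin_mem (g : Fin 3 → k) : lin g ∈ grading k 1 :=
  Submodule.sum_mem _ fun j _ => Submodule.smul_mem _ _ (x_mem j)

theorem differential_lin (g : Fin 3 → k) :
    (differential M).d (lin g) = square (linForm (Matrix.vecMul g M)) := by
  have h := differential_lin_mul M g 1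
  rwa [(differential M).d_one, mul_zero, neg_zero, zero_add, mul_one, mul_one] at h

end Square

section Corank

variable [CharZero k] {M G Q : Matrix (Fin 3) (Fin 3) k} {s : Fin 3 → k}

/-- `M` has corank `1`: the last row of `G` spans the left kernel, `s` spans the right kernel,
and the last row of `Q` is a linear form with value `1` at `s`. -/
structure IsCorankOne (M G Q : Matrix (Fin 3) (Fin 3) k) (s : Fin 3 → k) : Prop where
  isUnit_G : IsUnit G.det
  isUnit_Q : IsUnit Q.det
  row_zero : Matrix.vecMul (G 0) M = Q 0
  row_one : Matrix.vecMul (G 1) M = Q 1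
  row_two : Matrix.vecMul (G 2) M = 0
  mulVec : Q.mulVec s = Pi.single 2 1

namespace IsCorankOne

variable (h : IsCorankOne M G Q s)

include h

omit [CharZero k] in
theorem linForm_eq (i : Fin 3) : linForm (Matrix.vecMul (G i) M) =
    (![linForm (Q 0), linForm (Q 1), 0] : Fin 3 → MvPolynomial (Fin 3) k) i := by
  match i with
  | 0 => exact congrArg _ h.row_zero
  | 1 => exact congrArg _ h.row_one
  | 2 =>
    refine (congrArg _ h.row_two).trans ?_
    simp [linForm]

omit [CharZero k] in
theorem restrictLine_eq_zero_iff (f : MvPolynomial (Fin 3) k) :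
    restrictLine s f = 0 ↔ ∃ a b, a * linForm (Q 0) + b * linForm (Q 1) = f :=
  SkewPoly.restrictLine_eq_zero_iff h.isUnit_Q (i := 2) (by decide) (by decide) (by decide) h.mulVec

omit [CharZero k] in
-- Since ℓ_2 = 0, the innermost cone is P² with zero differential. The other two forms are primes
-- not dividing each other, hence a regular sequence, and the quotient of P by them is restriction
-- to the line of `s`, on each of the two coordinates.
theorem cohomologyPresentation : CohomologyPresentation
    (wordsCone ![linForm (Q 0), linForm (Q 1), 0])
    (LinearMap.inl _ _ _ ∘ₗ LinearMap.inl _ _ _ ∘ₗ LinearMap.id)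
    (Submodule.prod (RingHom.ker (restrictLine s)) (RingHom.ker (restrictLine s))) := by
  have hcone : wordsCone ![linForm (Q 0), linForm (Q 1), 0] =
      cone (cone (0 : MvPolynomial (Fin 3) k × MvPolynomial (Fin 3) k →ₗ[MvPolynomial (Fin 3) k] _)
        (linForm (Q 1))) (linForm (Q 0)) := by
    have h0 : cone (0 : MvPolynomial (Fin 3) k →ₗ[MvPolynomial (Fin 3) k] _) 0 = 0 := by
      refine LinearMap.ext fun a => ?_
      rw [← Prod.mk.eta (p := a), cone_apply]
      simp
    rw [← h0]
    rfl
  have hp := prime_linForm h.isUnit_Q 1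
  rw [hcone]
  refine (CohomologyPresentation.zero.cone
    (I' := Submodule.prod (Ideal.span {linForm (Q 1)}) (Ideal.span {linForm (Q 1)}))
    (fun p hp' => ?_) fun p => ?_).cone (fun p hp' => ?_) fun p => ?_
  · rw [Submodule.mem_bot, smul_eq_zero_iff_right hp.ne_zero] at hp'
    exact hp'
  · rw [Submodule.mem_prod, Ideal.mem_span_singleton, Ideal.mem_span_singleton]
    constructor
    · rintro ⟨⟨a, ha⟩, b, hb⟩
      exact ⟨(a, b), (Submodule.mem_bot _).2 (sub_eq_zero.2 (Prod.ext ha hb))⟩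
    · rintro ⟨q, hq⟩
      have hq' := sub_eq_zero.1 ((Submodule.mem_bot _).1 hq)
      exact ⟨⟨q.1, congrArg Prod.fst hq'⟩, q.2, congrArg Prod.snd hq'⟩
  · rw [Submodule.mem_prod, Ideal.mem_span_singleton, Ideal.mem_span_singleton] at hp' ⊢
    have h10 := not_linForm_dvd h.isUnit_Q (i := 1) (j := 0) (by decide)
    exact ⟨(hp.dvd_or_dvd hp'.1).resolve_left h10, (hp.dvd_or_dvd hp'.2).resolve_left h10⟩
  · rw [Submodule.mem_prod, RingHom.mem_ker, RingHom.mem_ker]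
    refine (and_congr (h.restrictLine_eq_zero_iff _) (h.restrictLine_eq_zero_iff _)).trans ?_
    simp only [Submodule.mem_prod, Ideal.mem_span_singleton']
    constructor
    · rintro ⟨⟨a, b, hab⟩, c, d, hcd⟩
      refine ⟨(a, c), ⟨b, ?_⟩, d, ?_⟩
      · rw [Prod.fst_sub, ← hab, Prod.smul_mk, smul_eq_mul]
        ring
      · rw [Prod.snd_sub, ← hcd, Prod.smul_mk, smul_eq_mul]
        ring
    · rintro ⟨q, ⟨a, ha⟩, b, hb⟩
      refine ⟨⟨q.1, a, ?_⟩, q.2, b, ?_⟩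
      · rw [ha, Prod.fst_sub, Prod.smul_fst, smul_eq_mul]
        ring
      · rw [hb, Prod.snd_sub, Prod.smul_snd, smul_eq_mul]
        ring

theorem exists_eq_add {a : SkewPoly k} (ha : (differential M).d a = 0) :
    ∃ p q b, a = square p + lin (G 2) * square q + (differential M).d b := by
  obtain ⟨⟨p, q⟩, b, rfl⟩ := exists_eq_words_add h.isUnit_G h.linForm_eq h.cohomologyPresentation ha
  exact ⟨p, q, b, congrArg (· + _) (words_inl _ p q)⟩

theorem exists_d_eq_iff (p q : MvPolynomial (Fin 3) k) :
    (∃ b, (differential M).d b = square p + lin (G 2) * square q) ↔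
      restrictLine s p = 0 ∧ restrictLine s q = 0 := by
  rw [← words_inl (fun i => lin (G i)) p q]
  exact exists_d_eq_words_iff h.isUnit_G h.linForm_eq h.cohomologyPresentation (p, q)

omit [CharZero k] in
theorem differential_lin : (differential M).d (lin (G 2)) = 0 := by
  rw [SkewPoly.differential_lin, h.row_two]
  simp [linForm]

/-- The class of the cocycle `∑ i, t_i x_i`, where `t` is the last row of `G`. -/
noncomputable def linClass : (differential M).Cohomology :=
  (differential M).toCohomology ⟨lin (G 2), h.differential_lin⟩

theorem squareClass_add_eq_zero_iff (p q : MvPolynomial (Fin 3) k) :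
    squareClass M p + squareClass M q * h.linClass = 0 ↔
      restrictLine s p = 0 ∧ restrictLine s q = 0 := by
  rw [← h.exists_d_eq_iff, ← square_comm, linClass, squareClass_apply, squareClass_apply, ← map_mul,
    ← map_add, (differential M).toCohomology_eq_zero]
  rfl

theorem squareClass_eq_of_restrictLine_eq {p q : MvPolynomial (Fin 3) k}
    (hpq : restrictLine s p = restrictLine s q) : squareClass M p = squareClass M q := by
  have := (h.squareClass_add_eq_zero_iff (p - q) 0).2 ⟨by rw [map_sub, hpq, sub_self], map_zero _⟩
  rwa [map_zero, zero_mul, add_zero, map_sub, sub_eq_zero] at this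

/-- Restriction to the line of `s` identifies the classes of squares with k[T]. The form `c` has
value 1 at `s` and so represents T, and the square of `linClass`, a linear form in the squares with
coefficients `G 2 i ^ 2`, restricts to κT. Every class is a class of squares plus another one times
`linClass`, with no relation beyond vanishing on the line. -/
theorem isQuadratic {κ : k} {c : Fin 3 → k} (hc : ∑ i, c i * s i = 1)
    (hκ : ∑ i, G 2 i ^ 2 * s i = κ) :
    IsQuadratic κ (squareClass M (linForm c)) h.linClass where
  comm := squareClass_comm M _ _
  sq := by
    rw [← map_smul]
    refine Eq.trans ?_ (h.squareClass_eq_of_restrictLine_eq (p := linForm fun i => G 2 i ^ 2) ?_)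
    · rw [linClass, ← map_mul, squareClass_apply]
      exact congrArg _ (Subtype.ext (lin_mul_self (G 2)))
    · rw [map_smul, restrictLine_linForm_eq_X hc, restrictLine_linForm, hκ]
  bijective := by
    have hr : ∀ p : Polynomial k, restrictLine s (Polynomial.aeval (linForm c) p) = p := fun p => by
      rw [← Polynomial.aeval_algHom_apply, restrictLine_linForm_eq_X hc,
        Polynomial.aeval_X_left_apply]
    constructor
    · rintro ⟨p, q⟩ ⟨p', q'⟩ hpq
      dsimp only at hpq
      rw [← sub_eq_zero, add_sub_add_comm, ← sub_mul, ← map_sub, ← map_sub,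
        Polynomial.aeval_algHom_apply, Polynomial.aeval_algHom_apply,
        squareClass_add_eq_zero_iff, hr, hr, sub_eq_zero, sub_eq_zero] at hpq
      exact Prod.ext hpq.1 hpq.2
    · intro y
      obtain ⟨⟨a, ha⟩, rfl⟩ := (differential M).toCohomology_surjective y
      obtain ⟨p, q, b, rfl⟩ := h.exists_eq_add ha
      refine ⟨(restrictLine s p, restrictLine s q), ?_⟩
      dsimp only
      rw [Polynomial.aeval_algHom_apply, Polynomial.aeval_algHom_apply,
        h.squareClass_eq_of_restrictLine_eq (hr (restrictLine s p)),
        h.squareClass_eq_of_restrictLine_eq (hr (restrictLine s q)), linClass, squareClass_apply,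
        squareClass_apply, ← map_mul, ← map_add, ← sub_eq_zero, ← map_sub,
        (differential M).toCohomology_eq_zero]
      refine ⟨-b, ?_⟩
      change _ = square p + square q * lin (G 2) - (square p + lin (G 2) * square q +
        (differential M).d b)
      rw [map_neg, square_comm]
      abel

end IsCorankOne

end Corank

end SkewPoly

/-! ### Quadratic extensions with κ = 1 and κ = 0 as polynomial rings -/

section QuadraticIso

open Polynomial

variable {k A : Type u} [Field k] [Ring A] [Algebra k A] {w z : A}

/-- The splitting into even and odd parts matches k[z] with k[w] ⊕ k[w] z when w = z². -/
theorem exists_eq_expand_add (f : k[X]) : ∃ p q, f = expand k 2 p + expand k 2 q * X := by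
  induction f using Polynomial.induction_on' with
  | add f g hf hg =>
    obtain ⟨p, q, rfl⟩ := hf
    obtain ⟨p', q', rfl⟩ := hg
    exact ⟨p + p', q + q', by rw [map_add, map_add]; ring⟩
  | monomial n a =>
    rcases Nat.even_or_odd' n with ⟨m, rfl | rfl⟩
    · exact ⟨monomial m a, 0, by rw [expand_monomial, map_zero, zero_mul, add_zero, mul_comm]⟩
    · exact ⟨0, monomial m a, by
        rw [expand_monomial, map_zero, zero_add, monomial_mul_X, mul_comm]⟩

/-- If `κ = 1`, then `k[w] ⊕ k[w] z` is the polynomial ring `k[z]`. -/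
theorem IsQuadratic.bijective_aeval (h : IsQuadratic (1 : k) w z) :
    Function.Bijective (aeval (R := k) z) := by
  have hz : ∀ p : k[X], aeval z (expand k 2 p) = aeval w p := fun p => by
    rw [expand_aeval, pow_two, h.sq, one_smul]
  constructor
  · refine (injective_iff_map_eq_zero _).2 fun f hf => ?_
    obtain ⟨p, q, rfl⟩ := exists_eq_expand_add f
    rw [map_add, map_mul, hz, hz, aeval_X] at hf
    have := h.coord_eq p q
    rw [hf, map_zero, eq_comm, Prod.mk_eq_zero] at this
    rw [this.1, this.2, map_zero, zero_mul, add_zero]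
  · intro a
    obtain ⟨p, q, rfl⟩ := h.exists_eq a
    exact ⟨expand k 2 p + expand k 2 q * X, by rw [map_add, map_mul, hz, hz, aeval_X]⟩

/-- The dual numbers as a quotient of the polynomial ring. -/
abbrev TruncatedPoly (k : Type u) [Field k] : Type u := k[X] ⧸ Ideal.span {(X : k[X]) ^ 2}

theorem exists_eq_algebraMap_add_mul (d : TruncatedPoly k) :
    ∃ a b : k, d = algebraMap k _ a + Ideal.Quotient.mk _ X * algebraMap k _ b := by
  have hX : (Ideal.Quotient.mk _ X : TruncatedPoly k) * Ideal.Quotient.mk _ X = 0 := by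
    rw [← map_mul, ← pow_two]
    exact Ideal.Quotient.eq_zero_iff_mem.2 (Ideal.mem_span_singleton_self _)
  obtain ⟨g, rfl⟩ := Ideal.Quotient.mk_surjective d
  induction g using Polynomial.induction_on with
  | C a => exact ⟨a, 0, by rw [map_zero, mul_zero, add_zero]; rfl⟩
  | add f g hf hg =>
    obtain ⟨a, b, hf⟩ := hf
    obtain ⟨a', b', hg⟩ := hg
    exact ⟨a + a', b + b', by rw [map_add, hf, hg, map_add, map_add]; ring⟩
  | monomial n a hn =>
    obtain ⟨a', b', hn⟩ := hn
    refine ⟨0, a', ?_⟩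
    have h1 : C a * X ^ (n + 1) = C a * X ^ n * X := by rw [pow_succ, mul_assoc]
    rw [h1, map_mul, hn, add_mul, mul_right_comm, hX, zero_mul, map_zero,
      mul_comm, add_comm]

theorem exists_eq_map_add (f : (TruncatedPoly k)[X]) :
    ∃ p q : k[X], f = p.map (algebraMap k _) +
      C (Ideal.Quotient.mk _ X) * q.map (algebraMap k (TruncatedPoly k)) := by
  induction f using Polynomial.induction_on' with
  | add f g hf hg =>
    obtain ⟨p, q, rfl⟩ := hf
    obtain ⟨p', q', rfl⟩ := hg
    exact ⟨p + p', q + q', by rw [Polynomial.map_add, Polynomial.map_add]; ring⟩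
  | monomial n d =>
    obtain ⟨a, b, rfl⟩ := exists_eq_algebraMap_add_mul d
    exact ⟨monomial n a, monomial n b, by
      rw [map_monomial, map_monomial, C_mul_monomial, ← map_add]⟩

/-- If `κ = 0`, then `k[w] ⊕ k[w] z` is the polynomial ring over the dual numbers. -/
theorem IsQuadratic.exists_algEquiv (h : IsQuadratic (0 : k) w z) :
    ∃ e : (TruncatedPoly k)[X] ≃ₐ[k] A, e (C (Ideal.Quotient.mk _ X)) = z ∧ e X = w := by
  have hz : ∀ a : k[X], a ∈ Ideal.span {(X : k[X]) ^ 2} → aeval z a = 0 := fun a ha => by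
    obtain ⟨b, rfl⟩ := Ideal.mem_span_singleton.1 ha
    rw [map_mul, map_pow, aeval_X, pow_two, h.sq, zero_smul, zero_mul]
  let f : TruncatedPoly k →ₐ[k] A := Ideal.Quotient.liftₐ _ (aeval z) hz
  have hfX : f (Ideal.Quotient.mk _ X) = z := aeval_X z
  -- Evaluation at `w` of polynomials over the dual numbers needs this, as A is not assumed
  -- commutative.
  have hf : ∀ d, Commute (f d) w := fun d => by
    obtain ⟨d, rfl⟩ := Ideal.Quotient.mk_surjective d
    exact h.mul_w _
  let e : (TruncatedPoly k)[X] →ₐ[k] A := eval₂AlgHom f w hf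
  have heC : ∀ d, e (C d) = f d := fun d => eval₂_C (f : TruncatedPoly k →+* A) w
  have heX : e X = w := eval₂_X (f : TruncatedPoly k →+* A) w
  have hem : ∀ p : k[X], e (p.map (algebraMap k _)) = aeval w p := fun p => by
    refine DFunLike.congr_fun (Polynomial.algHom_ext
      (f := e.comp (mapAlgHom (Algebra.ofId k (TruncatedPoly k)))) (g := aeval w) ?_) p
    rw [aeval_X]
    exact (congrArg e (map_X _)).trans heX
  have he : ∀ p q : k[X], e (p.map (algebraMap k _) +
      C (Ideal.Quotient.mk _ X) * q.map (algebraMap k (TruncatedPoly k))) =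
      aeval w p + aeval w q * z := fun p q => by
    rw [map_add, map_mul, hem, hem, heC, hfX, h.commute_aeval]
  refine ⟨AlgEquiv.ofBijective e ⟨?_, fun a => ?_⟩, (heC _).trans hfX, heX⟩
  · refine (injective_iff_map_eq_zero _).2 fun g hg => ?_
    obtain ⟨p, q, rfl⟩ := exists_eq_map_add g
    have := h.coord_eq p q
    rw [← he, hg, map_zero, eq_comm, Prod.mk_eq_zero] at this
    rw [this.1, this.2, Polynomial.map_zero, mul_zero, add_zero]
  · obtain ⟨p, q, rfl⟩ := h.exists_eq a
    exact ⟨_, he p q⟩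

end QuadraticIso

/-! ### Linear algebra of the matrix M -/

section MatrixRank

variable {k : Type u} [Field k] {M : Matrix (Fin 3) (Fin 3) k}

theorem Matrix.eq_zero_of_rank_eq_zero (h : M.rank = 0) : M = 0 := by
  have h1 : LinearMap.range M.mulVecLin = ⊥ := Submodule.finrank_eq_zero.1 h
  ext i j
  have h2 := LinearMap.congr_fun (LinearMap.range_eq_bot.1 h1) (Pi.single j 1)
  have h3 := congrFun h2 i
  simpa using h3

theorem Matrix.rank_add_finrank_ker :
    M.rank + Module.finrank k (LinearMap.ker M.mulVecLin) = 3 := by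
  have := LinearMap.finrank_range_add_finrank_ker M.mulVecLin
  rwa [Module.finrank_fin_fun] at this

theorem Matrix.isUnit_det_of_rank_eq_three (h : M.rank = 3) : IsUnit M.det := by
  rw [isUnit_iff_ne_zero]
  intro h0
  obtain ⟨v, hv, hMv⟩ := Matrix.exists_mulVec_eq_zero_iff.2 h0
  have h1 := M.rank_add_finrank_ker
  rw [h, Nat.add_eq_left, Submodule.finrank_eq_zero, LinearMap.ker_eq_bot'] at h1
  exact hv (h1 v hMv)

theorem Matrix.exists_smul_eq_of_rank_eq_two (h : M.rank = 2) {s : Fin 3 → k} (hs : s ≠ 0)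
    (hMs : M.mulVec s = 0) {v : Fin 3 → k} (hMv : M.mulVec v = 0) : ∃ c : k, c • s = v := by
  have h1 := M.rank_add_finrank_ker
  have h2 : Module.finrank k (LinearMap.ker M.mulVecLin) = 1 := by omega
  obtain ⟨c, hc⟩ := (finrank_eq_one_iff_of_nonzero' (⟨s, hMs⟩ : LinearMap.ker M.mulVecLin)
    fun h => hs (congrArg Subtype.val h)).1 h2 ⟨v, hMv⟩
  exact ⟨c, congrArg Subtype.val hc⟩

theorem Matrix.exists_isUnit_det_row_two_eq {t : Fin 3 → k} (ht : t ≠ 0) :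
    ∃ G : Matrix (Fin 3) (Fin 3) k, IsUnit G.det ∧ G 2 = t := by
  obtain ⟨i, hi⟩ := Function.ne_iff.1 ht
  -- With `t i ≠ 0`, the unit vectors at the two other indices complete `t` to a basis. The order is
  -- cyclic modulo 3, so the determinant is `t i`.
  refine ⟨Matrix.of ![Pi.single (i + 1) 1, Pi.single (i + 2) 1, t], ?_, rfl⟩
  rw [isUnit_iff_ne_zero, Matrix.det_fin_three]
  fin_cases i <;> simpa using hi

/-- Q consists of the first two rows of GM and of `c`. If Qv = 0 then GMv = 0, its last entry
vanishing because `t` is in the left kernel. So Mv = 0 and v = a s by the rank condition, and then c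
· v = a forces a = 0. -/
theorem SkewPoly.exists_isCorankOne (h : M.rank = 2) {s t c : Fin 3 → k} (hMs : M.mulVec s = 0)
    (ht : t ≠ 0) (hMt : M.transpose.mulVec t = 0) (hc : ∑ i, c i * s i = 1) :
    ∃ G Q, SkewPoly.IsCorankOne M G Q s ∧ G 2 = t := by
  obtain ⟨G, hG, rfl⟩ := Matrix.exists_isUnit_det_row_two_eq ht
  have hs : s ≠ 0 := by
    rintro rfl
    simp at hc
  rw [Matrix.mulVec_transpose] at hMt
  let Q : Matrix (Fin 3) (Fin 3) k :=
    Matrix.of ![Matrix.vecMul (G 0) M, Matrix.vecMul (G 1) M, c]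
  have hQ : ∀ v, Q.mulVec v =
      ![G 0 ⬝ᵥ M.mulVec v, G 1 ⬝ᵥ M.mulVec v, c ⬝ᵥ v] := fun v => by
    ext i
    fin_cases i
    · exact (Matrix.dotProduct_mulVec (G 0) M v).symm
    · exact (Matrix.dotProduct_mulVec (G 1) M v).symm
    · rfl
  refine ⟨G, Q, ⟨hG, ?_, rfl, rfl, hMt, ?_⟩, rfl⟩
  · rw [isUnit_iff_ne_zero]
    intro h0
    obtain ⟨v, hv, hQv⟩ := Matrix.exists_mulVec_eq_zero_iff.2 h0
    rw [hQ] at hQv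
    have hGM : G.mulVec (M.mulVec v) = 0 := by
      ext i
      fin_cases i
      · exact congrFun hQv 0
      · exact congrFun hQv 1
      · refine (Matrix.dotProduct_mulVec (G 2) M v).trans ?_
        rw [hMt, zero_dotProduct]
        rfl
    have hMv : M.mulVec v = 0 := by
      by_contra hne
      exact hG.ne_zero (Matrix.exists_mulVec_eq_zero_iff.1 ⟨_, hne, hGM⟩)
    obtain ⟨a, rfl⟩ := Matrix.exists_smul_eq_of_rank_eq_two h hs hMs hMv
    have h2 : c ⬝ᵥ (a • s) = 0 := congrFun hQv 2
    rw [dotProduct_smul, show c ⬝ᵥ s = 1 from hc, smul_eq_mul, mul_one] at h2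
    exact hv (by rw [h2, zero_smul])
  · rw [hQ, hMs, dotProduct_zero, dotProduct_zero, show c ⬝ᵥ s = 1 from hc]
    ext i
    fin_cases i <;> rfl

end MatrixRank

/-! ### The cohomology algebra in ranks three and two -/

namespace SkewPoly

variable {k : Type u} [Field k] [CharZero k] {M : Matrix (Fin 3) (Fin 3) k}

theorem bijective_algebraMap_cohomology (h : M.rank = 3) :
    Function.Bijective (algebraMap k (differential M).Cohomology) := by
  constructor
  · have := (isConnectedGraded_cohomology M).1
    exact Subtype.val_injective.comp this
  · intro y
    obtain ⟨⟨a, ha⟩, rfl⟩ := (differential M).toCohomology_surjective y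
    obtain ⟨c, b, rfl⟩ := exists_eq_algebraMap_add (Matrix.isUnit_det_of_rank_eq_three h) ha
    refine ⟨c, ?_⟩
    rw [← (differential M).toCohomology.commutes, ← sub_eq_zero, ← map_sub,
      (differential M).toCohomology_eq_zero]
    refine ⟨-b, ?_⟩
    change _ = algebraMap k _ c - (algebraMap k _ c + (differential M).d b)
    rw [map_neg, sub_add_cancel_left]

theorem isASGorenstein_cohomology_of_rank_eq_two (h : M.rank = 2) :
    IsASGorenstein k (differential M).cohomologyGrading := by
  have hdet : M.det = 0 := by
    by_contra h0
    have h1 := Matrix.rank_of_isUnit M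
      ((Matrix.isUnit_iff_isUnit_det M).2 (isUnit_iff_ne_zero.2 h0))
    rw [h, Fintype.card_fin] at h1
    omega
  obtain ⟨s, hs, hMs⟩ := Matrix.exists_mulVec_eq_zero_iff.2 hdet
  obtain ⟨t, ht, hMt⟩ := Matrix.exists_mulVec_eq_zero_iff.2 ((Matrix.det_transpose M).trans hdet)
  obtain ⟨i, hi⟩ := Function.ne_iff.1 hs
  -- Any form with value 1 at `s` will do; this one is supported at a nonzero coordinate of `s`.
  have hc : ∑ j, (Pi.single i (s i)⁻¹ : Fin 3 → k) j * s j = 1 := by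
    simp [Pi.single_apply, inv_mul_cancel₀ hi]
  obtain ⟨G, Q, hGQ, rfl⟩ := exists_isCorankOne h hMs ht hMt hc
  exact (isConnectedGraded_cohomology M).isASGorenstein_of_isQuadratic
    (hGQ.isQuadratic hc rfl) two_ne_zero one_ne_zero
    ⟨_, square_linForm_mem _, rfl⟩ ⟨_, lin_mem _, rfl⟩

end SkewPoly

theorem mainTheorem5 {k : Type u} [Field k] [IsAlgClosed k] [CharZero k]
    (M : Matrix (Fin 3) (Fin 3) k) :
    -- `H(A)` is AS-Gorenstein whenever `r(M) ≠ 1`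
    (M.rank ≠ 1 → IsASGorenstein k (SkewPoly.differential M).cohomologyGrading) ∧
    -- `r(M) = 0`: `H(A)` is the skew polynomial algebra, which is AS-regular of dimension `3`
    (M.rank = 0 →
      (∃ e : SkewPoly k ≃ₐ[k] (SkewPoly.differential M).Cohomology,
        (∀ i, (SkewPoly.differential M).IsClassOf (e (SkewPoly.x k i)) (SkewPoly.x k i)) ∧
        ∀ n a, e a ∈ (SkewPoly.differential M).cohomologyGrading n ↔ a ∈ SkewPoly.grading k n) ∧
      IsASRegular k (SkewPoly.differential M).cohomologyGrading ∧
      leftGlobalDimension (SkewPoly.differential M).Cohomology = 3 ∧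
      rightGlobalDimension (SkewPoly.differential M).Cohomology = 3) ∧
    -- `r(M) = 3`: `H(A) = k`
    (M.rank = 3 → Function.Bijective (algebraMap k (SkewPoly.differential M).Cohomology)) ∧
    -- `r(M) = 2`: `H(A)` is `k[z]` or `(k[z]/(z ^ 2))[w]`, with `|z| = 1` and `|w| = 2`
    (M.rank = 2 → ∀ s t : Fin 3 → k, s ≠ 0 → M.mulVec s = 0 → t ≠ 0 → M.transpose.mulVec t = 0 →
      (∑ i, s i * t i ^ 2 ≠ 0 →
        ∃ e : Polynomial k ≃ₐ[k] (SkewPoly.differential M).Cohomology,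
          (SkewPoly.differential M).IsClassOf (e Polynomial.X) (∑ i, t i • SkewPoly.x k i)) ∧
      (∑ i, s i * t i ^ 2 = 0 → ∀ c : Fin 3 → k, ∑ i, c i * s i ≠ 0 →
        ∃ e : Polynomial (Polynomial k ⧸ Ideal.span {(Polynomial.X : Polynomial k) ^ 2}) ≃ₐ[k]
            (SkewPoly.differential M).Cohomology,
          (SkewPoly.differential M).IsClassOf
            (e (Polynomial.C (Ideal.Quotient.mk _ Polynomial.X))) (∑ i, t i • SkewPoly.x k i) ∧
          (SkewPoly.differential M).IsClassOf (e Polynomial.X) (∑ i, c i • SkewPoly.x k i ^ 2))) := by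
  -- The right kernel vector may be rescaled so that a form not vanishing on it takes the value 1.
  have hdual : ∀ {s g : Fin 3 → k}, ∑ i, g i * s i ≠ 0 →
      ∑ i, g i * ((∑ i, g i * s i)⁻¹ • s) i = 1 := fun {s g} h => by
    simp only [Pi.smul_apply, smul_eq_mul, mul_left_comm (g _), ← Finset.mul_sum]
    exact inv_mul_cancel₀ h
  have hcomm : ∀ s t : Fin 3 → k, ∑ i, s i * t i ^ 2 = ∑ i, t i ^ 2 * s i := fun s t =>
    Finset.sum_congr rfl fun i _ => mul_comm _ _
  have hker : ∀ {s : Fin 3 → k} (a : k), M.mulVec s = 0 → M.mulVec (a • s) = 0 := fun a h => by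
    rw [Matrix.mulVec_smul, h, smul_zero]
  refine ⟨fun h => ?_, fun h => ?_, fun h => SkewPoly.bijective_algebraMap_cohomology h,
    fun h s t hs hMs ht hMt => ⟨fun hst => ?_, fun hst c hc => ?_⟩⟩
  · have h3 : M.rank ≤ 3 := M.rank_le_width
    have h4 : M.rank = 0 ∨ M.rank = 2 ∨ M.rank = 3 := by omega
    rcases h4 with h4 | h4 | h4
    · obtain rfl := Matrix.eq_zero_of_rank_eq_zero h4
      exact SkewPoly.isASGorenstein (SkewPoly.isConnectedGraded_cohomology 0)
        (SkewPoly.cohomologyEquiv k)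
        fun i => (SkewPoly.cohomologyEquiv_mem_iff 1 _).2 (SkewPoly.x_mem i)
    · exact SkewPoly.isASGorenstein_cohomology_of_rank_eq_two h4
    · exact (SkewPoly.isConnectedGraded_cohomology M).isASGorenstein_of_bijective
        (SkewPoly.bijective_algebraMap_cohomology h4)
  · obtain rfl := Matrix.eq_zero_of_rank_eq_zero h
    have hx : ∀ i, SkewPoly.cohomologyEquiv k (SkewPoly.x k i) ∈
        (SkewPoly.differential 0).cohomologyGrading 1 := fun i =>
      (SkewPoly.cohomologyEquiv_mem_iff 1 _).2 (SkewPoly.x_mem i)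
    have hconn := SkewPoly.isConnectedGraded_cohomology (0 : Matrix (Fin 3) (Fin 3) k)
    exact ⟨⟨SkewPoly.cohomologyEquiv k, fun i => SkewPoly.cohomologyEquiv_isClassOf _,
      SkewPoly.cohomologyEquiv_mem_iff⟩, SkewPoly.isASRegular hconn _ hx,
      SkewPoly.leftGlobalDimension_eq_three hconn _ hx,
      SkewPoly.rightGlobalDimension_eq_three hconn _ hx⟩
  · rw [hcomm] at hst
    have hc := hdual (g := fun i => t i ^ 2) hst
    obtain ⟨G, Q, hGQ, rfl⟩ := SkewPoly.exists_isCorankOne h (hker _ hMs) ht hMt hc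
    -- The choice c_i = t_i² makes w the class of z² itself, so the one equation `hc` serves both as
    -- normalisation of `c` and as κ = 1.
    refine ⟨AlgEquiv.ofBijective _ (hGQ.isQuadratic hc hc).bijective_aeval,
      ⟨_, rfl, (Polynomial.aeval_X _).symm⟩⟩
  · have hc' := hdual hc
    obtain ⟨G, Q, hGQ, rfl⟩ := SkewPoly.exists_isCorankOne h (hker _ hMs) ht hMt hc'
    -- Here κ is the vanishing sum up to the factor by which `s` was rescaled, hence 0.
    obtain ⟨e, hez, hew⟩ := (hGQ.isQuadratic (κ := 0) hc' (by
      simp only [Pi.smul_apply, smul_eq_mul, mul_left_comm (G 2 _ ^ 2), ← Finset.mul_sum]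
      rw [← hcomm, hst, mul_zero])).exists_algEquiv
    exact ⟨e, ⟨_, rfl, hez.symm⟩, ⟨_, SkewPoly.square_linForm c, hew.symm⟩⟩
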